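/- Theorem (Maximum Common Induced Subgraph parameterized by vertex cover is fixed-parameter enumerable). A common induced subgraph of two finite simple graphs $G_1,G_2$ is a graph $H$ that is isomorphic to an induced subgraph of $G_1$ and to an induced subgraph of $G_2$; it is presented by an isomorphism $\varphi\colon G_1[S_1]\to G_2[S_2]$ with $G_1[S_1]\cong H$. It is maximal if every common induced subgraph that contains an induced copy of $H$ is isomorphic to $H$. The isomorphism $\varphi$ is nonextendable if it is not the restriction of an isomorphism between induced subgraphs of $G_1$ and $G_2$ with a larger domain (if $H$ is maximal, every $\varphi$ presenting it is nonextendable). The input size $|I|$ is the size of the encoding of $(G_1,G_2)$ by adjacency matrices, $O^*$ hides constant factors and factors polynomial in $|I|$, and $0^0=1$. Time is the number of steps of a program on cons cells (linked binary trees, with unit-cost allocation of a cell, access to its two components, and test for the empty tree) plus the size of the written output. Let $k$ be any upper bound for the vertex cover numbers of $G_1$ and $G_2$; it is not given to the algorithms. (1) There is an algorithm that, given $G_1,G_2$, outputs in time $O^*\big((9k)^k\,2^{k^2}\big)$ a list of isomorphisms between induced subgraphs of $G_1$ and $G_2$, all of them nonextendable, such that every maximal common induced subgraph of $G_1$ and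 $G_2$ is isomorphic to one presented by the list. (2) There is an algorithm that, given $G_1,G_2$, outputs in time $O^*\big((9k)^k\,2^{k^2}\big)$ a list of isomorphisms between induced subgraphs of $G_1$ and $G_2$ such that, for every nonextendable isomorphism $G_1[S_1]\to G_2[S_2]$, the graph $G_1[S_1]$ is isomorphic to one presented by the list. (3) With the parameter $\kappa=\max(\mathrm{vc}(G_1),\mathrm{vc}(G_2))$, the enumeration of the maximal common induced subgraphs is fixed-parameter enumerable: there are a computable function $f$, a constant $c$ and an algorithm that, given $G_1,G_2$, lists in time $f(\kappa)\cdot|I|^{c}$ exactly the maximal common induced subgraphs of $G_1$ and $G_2$, each presented by an isomorphism and each exactly once up to isomorphism. -/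

import Mathlib

namespace MCIS

/-! ### The machine model: programs over cons cells, with a step count -/

/-- Data are binary trees of cons cells, as in LISP. -/
inductive Data : Type
  | nil : Data
  | cons : Data → Data → Data

namespace Data

/-- The number of nodes of the tree, fully written out (shared subtrees count each time). -/
def size : Data → ℕ
  | nil => 1
  | cons a b => size a + size b + 1

/-- A list, as a right-nested chain of cons cells that ends in `nil`. -/
def ofList : List Data → Data
  | [] => nil
  | a :: l => cons a (ofList l)

/-- A truth value: `nil` is false. -/
def ofBool : Bool → Data
  | false => nil
  | true => cons nil nil

/-- A natural number in unary. -/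
def ofNat : ℕ → Data
  | 0 => nil
  | n + 1 => cons nil (ofNat n)

end Data

/-- Programs transform one tree into another. Every construct costs a bounded number of pointer
operations on cons cells, in addition to the cost of the programs that it calls. -/
inductive Program : Type
  /-- return the input -/
  | id : Program
  /-- return the empty tree -/
  | nil : Program
  /-- return the first component of the input -/
  | hd : Program
  /-- return the second component of the input -/
  | tl : Program
  /-- run both programs on the input and allocate a cons cell for the two results -/
  | cons : Program → Program → Program
  /-- run the first program, and the second one on its result -/
  | seq : Program → Program → Program
  /-- run the first program as a test on the input, then one of the other two on the input -/
  | ite : Program → Program → Program → Program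
  /-- as long as the first program, run as a test on the current tree, succeeds, replace the
  current tree by the result of the second one -/
  | loop : Program → Program → Program

/-- `Run p x y t`: on input `x` the program `p` halts with output `y` after exactly `t` steps. A
test succeeds when its result is not `nil`. -/
inductive Run : Program → Data → Data → ℕ → Prop
  | id (x : Data) : Run .id x x 1
  | nil (x : Data) : Run .nil x .nil 1
  | hd_nil : Run .hd .nil .nil 1
  | hd_cons (a b : Data) : Run .hd (.cons a b) a 1
  | tl_nil : Run .tl .nil .nil 1
  | tl_cons (a b : Data) : Run .tl (.cons a b) b 1
  | cons {p q : Program} {x a b : Data} {s t : ℕ} :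
      Run p x a s → Run q x b t → Run (.cons p q) x (.cons a b) (s + t + 1)
  | seq {p q : Program} {x y z : Data} {s t : ℕ} :
      Run p x y s → Run q y z t → Run (.seq p q) x z (s + t + 1)
  | ite_true {c p q : Program} {x a b y : Data} {s t : ℕ} :
      Run c x (.cons a b) s → Run p x y t → Run (.ite c p q) x y (s + t + 1)
  | ite_false {c p q : Program} {x y : Data} {s t : ℕ} :
      Run c x .nil s → Run q x y t → Run (.ite c p q) x y (s + t + 1)
  | loop_stop {c p : Program} {x : Data} {s : ℕ} :
      Run c x .nil s → Run (.loop c p) x x (s + 1)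
  | loop_step {c p : Program} {x a b y z : Data} {s t u : ℕ} :
      Run c x (.cons a b) s → Run p x y t → Run (.loop c p) y z u →
        Run (.loop c p) x z (s + t + u + 1)

/-- On input `x` the program `p` computes `y` in time at most `T`, where the time comprises the
steps of the run and the writing of the whole output. -/
def Program.OutputsWithin (p : Program) (x y : Data) (T : ℕ) : Prop :=
  ∃ t, Run p x y t ∧ t + y.size ≤ T

/-! ### Parameterized enumeration problems -/

/-- An enumeration problem: every instance has a set of solutions, and `Same` tells which
solutions are regarded as the same one. -/
structure EnumerationProblem where
  Instance : Type
  encode : Instance → Data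
  Solution : Instance → Type
  encodeSolution : (x : Instance) → Solution x → Data
  Same : (x : Instance) → Solution x → Solution x → Prop

/-- There is one program that, on every instance `x`, lists all solutions, each exactly once (up to
`Same`), in time `f (κ x) * |x| ^ c`, with `f` computable and `c` a constant. -/
def FixedParameterEnumerable (P : EnumerationProblem) (κ : P.Instance → ℕ) : Prop :=
  ∃ (p : Program) (f : ℕ → ℕ) (c : ℕ), Computable f ∧
    ∀ x : P.Instance, ∃ L : List (P.Solution x),
      (∀ s : P.Solution x, ∃ s' ∈ L, P.Same x s s') ∧
      L.Pairwise (fun s s' => ¬ P.Same x s s') ∧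
      p.OutputsWithin (P.encode x) (Data.ofList (L.map (P.encodeSolution x)))
        (f (κ x) * (P.encode x).size ^ c)

/-! ### Common induced subgraphs -/

/-- A common induced subgraph of `G₁` and `G₂`: an induced subgraph of `G₁`, an induced subgraph of
`G₂`, and an isomorphism between them. -/
structure CommonInducedSubgraph {V₁ V₂ : Type*} (G₁ : SimpleGraph V₁) (G₂ : SimpleGraph V₂) where
  left : Set V₁
  right : Set V₂
  iso : G₁.induce left ≃g G₂.induce right

namespace CommonInducedSubgraph

variable {V₁ V₂ : Type*} {G₁ : SimpleGraph V₁} {G₂ : SimpleGraph V₂}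

/-- The common induced subgraph as a graph by itself. -/
def graph (s : CommonInducedSubgraph G₁ G₂) : SimpleGraph s.left :=
  G₁.induce s.left

/-- Two common induced subgraphs are the same when they are isomorphic as graphs. -/
def Same (s t : CommonInducedSubgraph G₁ G₂) : Prop :=
  Nonempty (s.graph ≃g t.graph)

/-- The isomorphism `t.iso` extends the isomorphism `s.iso`. -/
def ExtendedBy (s t : CommonInducedSubgraph G₁ G₂) : Prop :=
  ∃ h : s.left ⊆ t.left, ∀ u : s.left, (t.iso ⟨u.1, h u.2⟩ : V₂) = s.iso u

/-- The isomorphism does not extend to one between larger induced subgraphs. -/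
def IsNonextendable (s : CommonInducedSubgraph G₁ G₂) : Prop :=
  ∀ t : CommonInducedSubgraph G₁ G₂, s.ExtendedBy t → t.left = s.left

/-- The graph is maximal: every common induced subgraph that contains it (up to isomorphism) as an
induced subgraph is isomorphic to it. -/
def IsMaximal (s : CommonInducedSubgraph G₁ G₂) : Prop :=
  ∀ t : CommonInducedSubgraph G₁ G₂, Nonempty (s.graph ↪g t.graph) → s.Same t

end CommonInducedSubgraph

/-! ### The problem as an enumeration problem -/

/-- An instance: two finite graphs, on the vertex sets `{0, …, n₁ - 1}` and `{0, …, n₂ - 1}`. -/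
structure GraphPair where
  n₁ : ℕ
  n₂ : ℕ
  G₁ : SimpleGraph (Fin n₁)
  G₂ : SimpleGraph (Fin n₂)

open Classical in
/-- A graph is given by its adjacency matrix, as a list of rows. -/
noncomputable def encodeGraph {n : ℕ} (G : SimpleGraph (Fin n)) : Data :=
  Data.ofList (List.ofFn fun i =>
    Data.ofList (List.ofFn fun j => Data.ofBool (decide (G.Adj i j))))

noncomputable def GraphPair.encode (x : GraphPair) : Data :=
  .cons (encodeGraph x.G₁) (encodeGraph x.G₂)

/-- The parameter: the larger one of the two vertex cover numbers. -/
noncomputable def GraphPair.vertexCover (x : GraphPair) : ℕ :=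
  max x.G₁.vertexCoverNum.toNat x.G₂.vertexCoverNum.toNat

open Classical in
/-- A common induced subgraph is written as a table with one entry for each vertex `i` of the first
graph: `nil` if `i` is not used, and `j + 1` in unary if `i` is mapped to `j`. -/
noncomputable def encodeSubgraph (x : GraphPair) (s : CommonInducedSubgraph x.G₁ x.G₂) : Data :=
  Data.ofList (List.ofFn fun i : Fin x.n₁ =>
    if h : i ∈ s.left then Data.ofNat ((s.iso ⟨i, h⟩).1.1 + 1) else Data.ofNat 0)

/-- On the instance `x` the program outputs, in time at most `T`, a list of common induced
subgraphs that contains only subgraphs with property `Q`, and contains, up to isomorphism,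
all those with property `R`. -/
def Lists (p : Program) (x : GraphPair) (Q R : CommonInducedSubgraph x.G₁ x.G₂ → Prop) (T : ℕ) :
    Prop :=
  ∃ L : List (CommonInducedSubgraph x.G₁ x.G₂),
    (∀ s ∈ L, Q s) ∧ (∀ s, R s → ∃ s' ∈ L, s.Same s') ∧
    p.OutputsWithin x.encode (Data.ofList (L.map (encodeSubgraph x))) T

/-- The enumeration of all maximal common induced subgraphs, up to isomorphism. -/
noncomputable def mcisEnumeration : EnumerationProblem where
  Instance := GraphPair
  encode := GraphPair.encode
  Solution x := {s : CommonInducedSubgraph x.G₁ x.G₂ // s.IsMaximal}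
  encodeSolution x s := encodeSubgraph x s.1
  Same _ s t := s.1.Same t.1

end MCIS

/-!
The algorithms are bounded search trees. Let `C₁`, `C₂` be minimum vertex covers of `G₁`, `G₂`,
found by branching on the ends of uncovered edges, level by level (`minCover`), and consider an
isomorphism `φ` between induced subgraphs that cannot be extended. Vertices outside of `C₂` with the
same neighbours in `C₂` are twins, so exchanging them changes `φ` only up to isomorphism of its
domain. Hence the search (`leaves`) can build `φ` as follows. A vertex of `C₁` is not used, or it is
mapped to a vertex of `C₂`, or to a representative of one of the at most `2 ^ |C₂|` classes of
twins. A vertex of `C₂` that has not been hit is not used, or it is the image of the first vertex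
outside of `C₁` that fits. The remaining pairs lie in the product of two independent sets, and they
are chosen greedily. The search has at most `(1 + k + 2 ^ k) ^ k * 2 ^ k ≤ (9 * k) ^ k * 2 ^ k ^ 2`
leaves (`leafBound_self_le`).

Completeness (`Represents.exists_mem_leaves`) is an exchange argument. A target `P`, thought of as a
set of pairs, accompanies the search; whenever the search picks another vertex than `P` does, a
transposition of the two vertices turns `P` into a target that agrees with the choice
(`IsPartOf.exchange_left`, `IsPartOf.exchange_right`). The transposition is an isomorphism on the
vertices in question, either because the two vertices are twins, or because all cover vertices that
the target uses have been decided upon and both vertices fit the decisions. In the greedy part this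
needs that `P` cannot be extended.

All leaves together contain every nonextendable isomorphism up to isomorphism of domains. The leaves
that are nonextendable still contain every maximal common induced subgraph, since all presentations
of a maximal one are nonextendable. For the exact enumeration, the same search is used as a test
whether one induced subgraph of `G₁` embeds into another one (`embeds_iff`): a nonextendable leaf
presents a maximal common induced subgraph if and only if it does not embed into a larger
nonextendable leaf, and one of several isomorphic leaves is kept.

The running time is tracked by three predicates. `Feasible N f` says that a program computes `f` in
time `N x` times a polynomial, with output of polynomial size; `Poly` is the case `N = 1`, and it is
registered with `fun_prop`, which then proves that the auxiliary functions run in polynomial time.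
`Listable N L` allows the output list to have about `N x` elements of polynomial size; a level of a
search tree is such a list, and it is expanded in time linear in its length (`Listable.search`).
-/

namespace MCIS

open Polynomial

/-! ### Encodings and feasible functions -/

/-- A type whose elements are written as trees of cons cells. -/
class Enc (α : Type) where
  /-- The tree that represents an element. -/
  enc : α → Data

open Enc (enc)

variable {α β γ δ ε : Type} [Enc α] [Enc β] [Enc γ] [Enc δ] [Enc ε]

instance : Enc ℕ := ⟨Data.ofNat⟩
instance : Enc Bool := ⟨Data.ofBool⟩
instance : Enc Unit := ⟨fun _ => .nil⟩
instance : Enc (List α) := ⟨fun l => Data.ofList (l.map enc)⟩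
instance : Enc (α × β) := ⟨fun x => .cons (enc x.1) (enc x.2)⟩

/-- The size of the encoding. -/
def esize (x : α) : ℕ := (enc x).size

theorem enc_nil : enc ([] : List α) = .nil := rfl
theorem enc_cons (a : α) (l : List α) : enc (a :: l) = .cons (enc a) (enc l) := rfl
theorem enc_pair (a : α) (b : β) : enc (a, b) = .cons (enc a) (enc b) := rfl

theorem Data.size_pos (x : Data) : 1 ≤ x.size := by
  cases x <;> simp [Data.size]

theorem esize_pos (x : α) : 1 ≤ esize x := Data.size_pos _

theorem esize_pair (a : α) (b : β) : esize (a, b) = esize a + esize b + 1 := rfl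
theorem esize_nil : esize ([] : List α) = 1 := rfl
theorem esize_cons (a : α) (l : List α) : esize (a :: l) = esize a + esize l + 1 := rfl

theorem esize_list (l : List α) : esize l = (l.map fun a => esize a + 1).sum + 1 := by
  induction l with
  | nil => rfl
  | cons a l ih => rw [esize_cons, ih]; simp; ring

theorem length_le_esize (l : List α) : l.length ≤ esize l := by
  induction l with
  | nil => simp
  | cons a l ih => rw [esize_cons]; simp; omega

theorem esize_le_of_mem {a : α} {l : List α} (h : a ∈ l) : esize a ≤ esize l := by
  induction l with
  | nil => simp at h
  | cons b l ih =>
    rw [esize_cons]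
    rcases List.mem_cons.1 h with rfl | h
    · omega
    · have := ih h; omega

theorem esize_list_le {l : List α} {B : ℕ} (h : ∀ a ∈ l, esize a ≤ B) :
    esize l ≤ l.length * (B + 1) + 1 := by
  induction l with
  | nil => simp [esize_nil]
  | cons a l ih =>
    have h1 := ih fun b hb => h b (List.mem_cons_of_mem _ hb)
    have h2 := h a List.mem_cons_self
    rw [esize_cons, List.length_cons, Nat.succ_mul]
    omega

theorem esize_nat (n : ℕ) : esize n = 2 * n + 1 := by
  induction n with
  | zero => rfl
  | succ n ih =>
    have : esize (n + 1) = 1 + esize n + 1 := rfl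
    omega

theorem esize_bool_le (b : Bool) : esize b ≤ 3 := by
  cases b <;> decide

theorem esize_append (l l' : List α) : esize (l ++ l') + 1 = esize l + esize l' := by
  simp only [esize_list, List.map_append, List.sum_append]; omega

/-- The program computes `y` from `x` in at most `T` steps. -/
def Runs (p : Program) (x y : Data) (T : ℕ) : Prop :=
  ∃ t ≤ T, Run p x y t

theorem Runs.mono {p : Program} {x y : Data} {S T : ℕ} (h : Runs p x y S) (hST : S ≤ T) :
    Runs p x y T :=
  let ⟨t, ht, hr⟩ := h
  ⟨t, ht.trans hST, hr⟩

theorem Runs.seq {p q : Program} {x y z : Data} {S T : ℕ} (h : Runs p x y S) (h' : Runs q y z T) :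
    Runs (.seq p q) x z (S + T + 1) :=
  let ⟨s, hs, hr⟩ := h
  let ⟨t, ht, hr'⟩ := h'
  ⟨s + t + 1, by omega, .seq hr hr'⟩

theorem Runs.cons {p q : Program} {x y z : Data} {S T : ℕ} (h : Runs p x y S)
    (h' : Runs q x z T) : Runs (.cons p q) x (.cons y z) (S + T + 1) :=
  let ⟨s, hs, hr⟩ := h
  let ⟨t, ht, hr'⟩ := h'
  ⟨s + t + 1, by omega, .cons hr hr'⟩

theorem Run.pos {p : Program} {x y : Data} {t : ℕ} (h : Run p x y t) : 1 ≤ t := by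
  cases h <;> omega

theorem eval_le_eval (P : ℕ[X]) {a b : ℕ} (h : a ≤ b) : P.eval a ≤ P.eval b := by
  induction P using Polynomial.induction_on' with
  | add p q hp hq => simp only [eval_add]; omega
  | monomial n c => simp only [eval_monomial]; gcongr

/-- Some program computes `f` in time `N x` times a polynomial in the size of the input `x`, and
the output has polynomial size. The size has to be bounded separately, since a program can share
subtrees and so build a tree that is larger than its running time. -/
def Feasible (N : α → ℕ) (f : α → β) : Prop :=
  ∃ (p : Program) (P : ℕ[X]), ∀ x,
    Runs p (enc x) (enc (f x)) (N x * P.eval (esize x)) ∧ esize (f x) ≤ P.eval (esize x)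

theorem Feasible.one_le {N : α → ℕ} {f : α → β} (h : Feasible N f) (x : α) : 1 ≤ N x := by
  obtain ⟨p, P, h⟩ := h
  obtain ⟨t, ht, hr⟩ := (h x).1
  have := hr.pos
  by_contra! h0
  have h0 : N x = 0 := by omega
  simp [h0] at ht
  omega

theorem Feasible.mono {N M : α → ℕ} {f : α → β} (h : Feasible N f) (hNM : ∀ x, N x ≤ M x) :
    Feasible M f :=
  let ⟨p, P, h⟩ := h
  ⟨p, P, fun x => ⟨(h x).1.mono (Nat.mul_le_mul_right _ (hNM x)), (h x).2⟩⟩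

theorem Feasible.comp {M : β → ℕ} {N : α → ℕ} {g : β → γ} {f : α → β} (hg : Feasible M g)
    (hf : Feasible N f) (h : ∀ x, M (f x) ≤ N x) : Feasible N (fun x => g (f x)) := by
  have h1 := hf.one_le
  obtain ⟨p, P, hf⟩ := hf
  obtain ⟨q, Q, hg⟩ := hg
  refine ⟨.seq p q, P + Q.comp P + 1, fun x => ?_⟩
  obtain ⟨r1, s1⟩ := hf x
  obtain ⟨r2, s2⟩ := hg (f x)
  have h2 := eval_le_eval Q s1
  simp only [eval_add, eval_comp, eval_one]
  refine ⟨(r1.seq r2).mono ?_, by omega⟩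
  have := Nat.mul_le_mul (h x) h2
  have := h1 x
  simp only [mul_add, mul_one]
  omega

theorem Feasible.pair {N : α → ℕ} {f : α → β} {g : α → γ} (hf : Feasible N f)
    (hg : Feasible N g) : Feasible N (fun x => (f x, g x)) := by
  have h1 := hf.one_le
  obtain ⟨p, P, hf⟩ := hf
  obtain ⟨q, Q, hg⟩ := hg
  refine ⟨.cons p q, P + Q + 1, fun x => ?_⟩
  obtain ⟨r1, s1⟩ := hf x
  obtain ⟨r2, s2⟩ := hg x
  have := h1 x
  simp only [eval_add, eval_one, esize_pair]
  refine ⟨(r1.cons r2).mono ?_, by omega⟩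
  simp only [mul_add, mul_one]
  omega

theorem Feasible.ite {N : α → ℕ} {c : α → Bool} {f g : α → β} (hc : Feasible N c)
    (hf : Feasible N f) (hg : Feasible N g) :
    Feasible N (fun x => if c x then f x else g x) := by
  have h1 := hf.one_le
  obtain ⟨r, R, hc⟩ := hc
  obtain ⟨p, P, hf⟩ := hf
  obtain ⟨q, Q, hg⟩ := hg
  refine ⟨.ite r p q, R + P + Q + 1, fun x => ?_⟩
  obtain ⟨⟨t1, l1, r1⟩, s1⟩ := hc x
  obtain ⟨⟨t2, l2, r2⟩, s2⟩ := hf x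
  obtain ⟨⟨t3, l3, r3⟩, s3⟩ := hg x
  have := h1 x
  simp only [eval_add, eval_one, mul_add, mul_one]
  cases hx : c x with
  | true =>
    rw [hx] at r1
    exact ⟨⟨t1 + t2 + 1, by omega, by simpa using .ite_true r1 r2⟩, by simp; omega⟩
  | false =>
    rw [hx] at r1
    exact ⟨⟨t1 + t3 + 1, by omega, by simpa using .ite_false r1 r3⟩, by simp; omega⟩

/-- Folds the program `p`, which takes `((x, e), a)` to the next accumulator, over the list `l`
in the input `(x, l, a)`. -/
def foldProgram (p : Program) : Program :=
  .seq
    (.loop (.seq .tl .hd)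
      (.cons .hd (.cons (.seq .tl (.seq .hd .tl))
        (.seq (.cons (.cons .hd (.seq .tl (.seq .hd .hd))) (.seq .tl .tl)) p))))
    (.seq .tl .tl)

/-- One call of `p` for each element of the list, plus a bounded number of steps. Only the
accumulators that occur matter for the running time `K` of `p`. -/
theorem runs_foldProgram {p : Program} {f : β → γ → γ} {K : ℕ} (x : α) (l : List β) (a : γ)
    (h : ∀ l' e, l' ++ [e] <+: l →
      Runs p (enc ((x, e), l'.foldl (fun a e => f e a) a))
        (enc (f e (l'.foldl (fun a e => f e a) a))) K) :
    Runs (foldProgram p) (enc (x, l, a)) (enc (l.foldl (fun a e => f e a) a))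
      ((l.length + 1) * (K + 24)) := by
  have key : ∀ (l : List β) (a : γ),
      (∀ l' e, l' ++ [e] <+: l →
        Runs p (enc ((x, e), l'.foldl (fun a e => f e a) a))
          (enc (f e (l'.foldl (fun a e => f e a) a))) K) →
      Runs (.loop (.seq .tl .hd)
        (.cons .hd (.cons (.seq .tl (.seq .hd .tl))
          (.seq (.cons (.cons .hd (.seq .tl (.seq .hd .hd))) (.seq .tl .tl)) p))))
        (enc (x, l, a)) (enc (x, ([] : List β), l.foldl (fun a e => f e a) a))
        (l.length * (K + 24) + 4) := by
    intro l
    induction l with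
    | nil =>
      intro a _
      refine ⟨4, by simp, ?_⟩
      -- The list is empty, so the test fails and the loop ends.
      constructor
      exact .seq (s := 1) (t := 1) (.tl_cons _ _) (.hd_cons _ _)
    | cons e l ih =>
      intro a h
      obtain ⟨t, ht, hr⟩ := h [] e (by simp)
      obtain ⟨u, hu, hr'⟩ := ih (f e a) fun l' e' hl' => h (e :: l') e' (by simpa using hl')
      have hb := Run.loop_step (c := .seq .tl .hd)
        (p := .cons .hd (.cons (.seq .tl (.seq .hd .tl))
          (.seq (.cons (.cons .hd (.seq .tl (.seq .hd .hd))) (.seq .tl .tl)) p)))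
        (x := enc (x, e :: l, a)) (.seq (.tl_cons _ _) (.hd_cons _ _))
        (.cons (.hd_cons _ _) (.cons (.seq (.tl_cons _ _) (.seq (.hd_cons _ _) (.tl_cons _ _)))
          (.seq (.cons (.cons (.hd_cons _ _) (.seq (.tl_cons _ _) (.seq (.hd_cons _ _)
            (.hd_cons _ _)))) (.seq (.tl_cons _ _) (.tl_cons _ _))) hr))) hr'
      refine ⟨_, ?_, hb⟩
      rw [List.length_cons, Nat.succ_mul]
      omega
  have h1 := (key l a h).seq (q := .seq .tl .tl) (T := 3)
    ⟨3, le_rfl, .seq (.tl_cons _ _) (.tl_cons _ _)⟩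
  refine h1.mono ?_
  rw [Nat.succ_mul]
  omega

/-- Folding is feasible if the accumulator keeps polynomial size: a bound `B` for its size has to be
supplied, since `hf` alone would allow the size to be squared in each step. -/
theorem Feasible.foldl {N : α → ℕ} {M : (α × β) × γ → ℕ} {l : α → List β} {a : α → γ}
    {f : α → β → γ → γ} (hl : Feasible N l) (ha : Feasible N a)
    (hf : Feasible M (fun y : (α × β) × γ => f y.1.1 y.1.2 y.2)) (B : ℕ[X])
    (hM : ∀ x l' e, l' ++ [e] <+: l x → M ((x, e), l'.foldl (fun a e => f x e a) (a x)) ≤ N x)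
    (hB : ∀ x l', l' <+: l x → esize (l'.foldl (fun a e => f x e a) (a x)) ≤ B.eval (esize x)) :
    Feasible N (fun x => (l x).foldl (fun a e => f x e a) (a x)) := by
  have h1 := hl.one_le
  obtain ⟨p, P, hl⟩ := hl
  obtain ⟨q, Q, ha⟩ := ha
  obtain ⟨r, R, hf⟩ := hf
  refine ⟨.seq (.cons .id (.cons p q)) (foldProgram r),
    P + Q + B + 4 + (P + 1) * (R.comp (X + P + B + 2) + 24), fun x => ?_⟩
  obtain ⟨r1, s1⟩ := hl x
  obtain ⟨r2, s2⟩ := ha x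
  have hid : Runs .id (enc x) (enc x) 1 := ⟨1, le_rfl, .id _⟩
  have r3 := runs_foldProgram (p := r) (f := f x) (K := N x * R.eval (esize x + P.eval (esize x) +
    B.eval (esize x) + 2)) x (l x) (a x) (by
    intro l' e he
    have hmem : e ∈ l x := he.subset (by simp)
    have h2 := esize_le_of_mem hmem
    have h3 := hB x l' ((List.prefix_append _ _).trans he)
    refine (hf ((x, e), l'.foldl (fun a e => f x e a) (a x))).1.mono ?_
    refine Nat.mul_le_mul (hM x l' e he) (eval_le_eval R ?_)
    simp only [esize_pair]
    omega)
  have h4 := hB x (l x) List.prefix_rfl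
  have h5 := h1 x
  have h6 := (length_le_esize (l x)).trans s1
  simp only [eval_add, eval_mul, eval_comp, eval_one, eval_X, eval_ofNat]
  refine ⟨((hid.cons (r1.cons r2)).seq r3).mono ?_, by omega⟩
  generalize R.eval (esize x + P.eval (esize x) + B.eval (esize x) + 2) = K at *
  have h7 : ((l x).length + 1) * (N x * K + 24) ≤ N x * ((P.eval (esize x) + 1) * (K + 24)) := by
    calc _ ≤ (P.eval (esize x) + 1) * (N x * K + N x * 24) := by gcongr; omega
      _ = _ := by ring
  simp only [mul_add (N x)] at h7 ⊢
  omega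

theorem Feasible.of_const_time {f : α → β} (p : Program) (c : ℕ) (P : ℕ[X])
    (h : ∀ x, Runs p (enc x) (enc (f x)) c) (hs : ∀ x, esize (f x) ≤ P.eval (esize x)) :
    Feasible (fun _ => 1) f := by
  refine ⟨p, P + (c : ℕ[X]), fun x => ⟨(h x).mono ?_, ?_⟩⟩
  · simp
  · have := hs x
    simp
    omega

/-- Computability in polynomial time. -/
@[fun_prop]
def Poly (f : α → β) : Prop :=
  Feasible (fun _ => 1) f

theorem Poly.feasible {N : α → ℕ} {f : α → β} (h : Poly f) (hN : ∀ x, 1 ≤ N x) : Feasible N f :=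
  Feasible.mono h hN

@[fun_prop]
theorem Poly.id : Poly (fun x : α => x) :=
  .of_const_time .id 1 X (fun _ => ⟨1, le_rfl, .id _⟩) (by simp)

theorem runs_const (y : Data) : ∃ p c, ∀ x, Runs p x y c := by
  induction y with
  | nil => exact ⟨.nil, 1, fun x => ⟨1, le_rfl, .nil x⟩⟩
  | cons a b iha ihb =>
    obtain ⟨p, c, hp⟩ := iha
    obtain ⟨q, d, hq⟩ := ihb
    exact ⟨.cons p q, c + d + 1, fun x => (hp x).cons (hq x)⟩

@[fun_prop]
theorem Poly.const (b : β) : Poly (fun _ : α => b) := by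
  obtain ⟨p, c, hp⟩ := runs_const (enc b)
  exact .of_const_time p c (esize b : ℕ[X]) (fun _ => hp _) (by simp)

@[fun_prop]
theorem Poly.comp {g : β → γ} {f : α → β} (hg : Poly g) (hf : Poly f) :
    Poly (fun x => g (f x)) :=
  Feasible.comp hg hf fun _ => le_rfl

@[fun_prop]
theorem Poly.pair {f : α → β} {g : α → γ} (hf : Poly f) (hg : Poly g) :
    Poly (fun x => (f x, g x)) :=
  Feasible.pair hf hg

theorem Poly.fst' : Poly (fun x : α × β => x.1) :=
  .of_const_time .hd 1 X (fun _ => ⟨1, le_rfl, .hd_cons _ _⟩) (by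
    rintro ⟨a, b⟩
    simp [esize_pair]
    omega)

theorem Poly.snd' : Poly (fun x : α × β => x.2) :=
  .of_const_time .tl 1 X (fun _ => ⟨1, le_rfl, .tl_cons _ _⟩) (by
    rintro ⟨a, b⟩
    simp [esize_pair]
    omega)

@[fun_prop]
theorem Poly.fst {f : α → β × γ} (hf : Poly f) : Poly (fun x => (f x).1) :=
  Poly.fst'.comp hf

@[fun_prop]
theorem Poly.snd {f : α → β × γ} (hf : Poly f) : Poly (fun x => (f x).2) :=
  Poly.snd'.comp hf

@[fun_prop]
theorem Poly.ite {c : α → Bool} {f g : α → β} (hc : Poly c) (hf : Poly f) (hg : Poly g) :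
    Poly (fun x => if c x then f x else g x) :=
  Feasible.ite hc hf hg

@[fun_prop]
theorem Poly.cons {f : α → β} {g : α → List β} (hf : Poly f) (hg : Poly g) :
    Poly (fun x => f x :: g x) :=
  Poly.comp (g := fun y : β × List β => y.1 :: y.2)
    (.of_const_time .id 1 X (fun _ => ⟨1, le_rfl, .id _⟩) (by
      rintro ⟨a, b⟩
      simp [esize_pair, esize_cons])) (hf.pair hg)

theorem Poly.foldl {l : α → List β} {a : α → γ} {f : α → β → γ → γ} (hl : Poly l) (ha : Poly a)
    (hf : Poly (fun y : (α × β) × γ => f y.1.1 y.1.2 y.2)) (B : ℕ[X])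
    (hB : ∀ x l', l' <+: l x → esize (l'.foldl (fun a e => f x e a) (a x)) ≤ B.eval (esize x)) :
    Poly (fun x => (l x).foldl (fun a e => f x e a) (a x)) :=
  Feasible.foldl hl ha hf B (fun _ _ _ _ => le_rfl) hB

theorem Poly.size_le {f : α → β} (hf : Poly f) : ∃ P : ℕ[X], ∀ x, esize (f x) ≤ P.eval (esize x) :=
  let ⟨_, P, h⟩ := hf
  ⟨P, fun x => (h x).2⟩

/-! ### Feasible operations on lists -/

theorem esize_foldl_le {β : Type*} {l : List β} {f : β → γ → γ} {B : ℕ}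
    (h : ∀ e ∈ l, ∀ a, esize (f e a) ≤ esize a + B) (a : γ) :
    esize (l.foldl (fun a e => f e a) a) ≤ esize a + l.length * B := by
  induction l generalizing a with
  | nil => simp
  | cons e l ih =>
    have h1 := ih (fun e he => h e (List.mem_cons_of_mem _ he)) (f e a)
    have h2 := h e List.mem_cons_self a
    rw [List.foldl_cons, List.length_cons, Nat.succ_mul]
    omega

/-- Folding is feasible if every step adds at most a polynomial amount to the accumulator. -/
theorem Feasible.foldl_of_add {N : α → ℕ} {M : (α × β) × γ → ℕ} {l : α → List β} {a : α → γ}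
    {f : α → β → γ → γ} (hl : Feasible N l) (ha : Feasible N a)
    (hf : Feasible M (fun y : (α × β) × γ => f y.1.1 y.1.2 y.2)) (B : ℕ[X])
    (hM : ∀ x, ∀ e ∈ l x, ∀ a, M ((x, e), a) ≤ N x)
    (hB : ∀ x, ∀ e ∈ l x, ∀ a, esize (f x e a) ≤ esize a + B.eval (esize x)) :
    Feasible N (fun x => (l x).foldl (fun a e => f x e a) (a x)) := by
  obtain ⟨p, P, hl'⟩ := id hl
  obtain ⟨q, Q, ha'⟩ := id ha
  refine hl.foldl ha hf (Q + P * B) (fun x l' e he => hM x e (he.subset (by simp)) _) ?_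
  intro x l' hl''
  have h1 := esize_foldl_le (l := l') (f := f x) (B := B.eval (esize x))
    (fun e he => hB x e (hl''.subset he)) (a x)
  have h2 : l'.length ≤ P.eval (esize x) :=
    hl''.length_le.trans ((length_le_esize _).trans (hl' x).2)
  have h3 := (ha' x).2
  have h4 := Nat.mul_le_mul_right (B.eval (esize x)) h2
  simp only [eval_add, eval_mul]
  omega

theorem Poly.foldl_of_add {l : α → List β} {a : α → γ} {f : α → β → γ → γ} (hl : Poly l)
    (ha : Poly a) (hf : Poly (fun y : (α × β) × γ => f y.1.1 y.1.2 y.2)) (B : ℕ[X])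
    (hB : ∀ x, ∀ e ∈ l x, ∀ a, esize (f x e a) ≤ esize a + B.eval (esize x)) :
    Poly (fun x => (l x).foldl (fun a e => f x e a) (a x)) :=
  Feasible.foldl_of_add hl ha hf B (fun _ _ _ _ => le_rfl) hB

theorem Poly.congr {f g : α → β} (hf : Poly f) (h : ∀ x, f x = g x) : Poly g :=
  funext h ▸ hf

@[fun_prop]
theorem Poly.reverse {f : α → List β} (hf : Poly f) : Poly (fun x => (f x).reverse) := by
  have : Poly (fun l : List β => l.reverse) := by
    have h := Poly.foldl_of_add (α := List β) (l := fun l => l) (a := fun _ => ([] : List β))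
      (f := fun _ e a => e :: a) (by fun_prop) (by fun_prop) (by fun_prop) (X + 1) (by
        intro x e he a
        have := esize_le_of_mem he
        simp only [esize_cons, eval_add, eval_X, eval_one]
        omega)
    simpa using h
  exact this.comp hf

@[fun_prop]
theorem Poly.append {f g : α → List β} (hf : Poly f) (hg : Poly g) :
    Poly (fun x => f x ++ g x) := by
  have : Poly (fun y : List β × List β => y.1 ++ y.2) := by
    have h := Poly.foldl_of_add (α := List β × List β) (l := fun y => y.1.reverse)
      (a := fun y => y.2) (f := fun _ e a => e :: a) (by fun_prop) (by fun_prop) (by fun_prop)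
      (X + 1) (by
        intro x e he a
        have := esize_le_of_mem (List.mem_reverse.1 he)
        obtain ⟨x1, x2⟩ := x
        simp only [esize_cons, eval_add, eval_X, eval_one, esize_pair] at *
        omega)
    simpa using h
  exact this.comp (hf.pair hg)

theorem flatMap_eq_foldl {β γ : Type*} (l : List β) (f : β → List γ) :
    l.flatMap f = l.reverse.foldl (fun a e => f e ++ a) [] := by
  rw [List.foldl_reverse]
  induction l with
  | nil => rfl
  | cons a l ih => simp [ih]

theorem Feasible.flatMap {N : α → ℕ} {M : α × β → ℕ} {l : α → List β} {f : α → β → List γ}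
    (hl : Feasible N l) (hf : Feasible M (fun y : α × β => f y.1 y.2))
    (hM : ∀ x, ∀ e ∈ l x, M (x, e) ≤ N x) : Feasible N (fun x => (l x).flatMap (f x)) := by
  obtain ⟨p, P, hl'⟩ := id hl
  obtain ⟨q, Q, hf'⟩ := id hf
  have hM1 := hf.one_le
  have hrev : Poly (fun l : List β => l.reverse) := by fun_prop
  have happ : Poly (fun y : List γ × List γ => y.1 ++ y.2) := by fun_prop
  have h := Feasible.foldl_of_add (N := N) (M := fun y : (α × β) × List γ => M y.1)
    (l := fun x => (l x).reverse) (a := fun _ => ([] : List γ))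
    (f := fun x e a => f x e ++ a)
    (Feasible.comp hrev hl hl.one_le)
    ((Poly.const []).feasible hl.one_le)
    (Feasible.comp (f := fun y : (α × β) × List γ => (f y.1.1 y.1.2, y.2)) happ
      (Feasible.pair (Feasible.comp (g := fun y : α × β => f y.1 y.2)
          (f := fun y : (α × β) × List γ => y.1) hf
          (Poly.fst'.feasible fun y => hM1 _) fun _ => le_rfl)
        (Poly.snd'.feasible fun y => hM1 _)) fun _ => hM1 _)
    (Q.comp (X + P + 1)) (fun x e he a => hM x e (List.mem_reverse.1 he)) (by
      intro x e he a
      have h1 := esize_append (f x e) a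
      have h2 := (hf' (x, e)).2
      have h3 : Q.eval (esize (x, e)) ≤ Q.eval (esize x + P.eval (esize x) + 1) := by
        refine eval_le_eval _ ?_
        have := (esize_le_of_mem (List.mem_reverse.1 he)).trans (hl' x).2
        rw [esize_pair]
        omega
      simp only [eval_comp, eval_add, eval_X, eval_one]
      dsimp only at h2
      omega)
  simpa only [flatMap_eq_foldl] using h

@[fun_prop]
theorem Poly.flatMap {l : α → List β} {f : α → β → List γ}
    (hl : Poly l) (hf : Poly (fun y : α × β => f y.1 y.2)) :
    Poly (fun x => (l x).flatMap (f x)) :=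
  Feasible.flatMap hl hf fun _ _ _ => le_rfl

@[fun_prop]
theorem Poly.map {l : α → List β} {f : α → β → γ}
    (hl : Poly l) (hf : Poly (fun y : α × β => f y.1 y.2)) :
    Poly (fun x => (l x).map (f x)) := by
  have : Poly (fun x => (l x).flatMap (fun e => [f x e])) := by fun_prop
  simpa only [← List.map_eq_flatMap] using this

theorem filter_eq_flatMap {β : Type*} (p : β → Bool) (l : List β) :
    l.filter p = l.flatMap fun a => if p a then [a] else [] := by
  induction l with
  | nil => rfl
  | cons a l ih => by_cases h : p a <;> simp [h, ih]

theorem Feasible.filter {N : α → ℕ} {M : α × β → ℕ} {l : α → List β} {f : α → β → Bool}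
    (hl : Feasible N l) (hf : Feasible M (fun y : α × β => f y.1 y.2))
    (hM : ∀ x, ∀ e ∈ l x, M (x, e) ≤ N x) : Feasible N (fun x => (l x).filter (f x)) := by
  have h1 : Poly (fun y : α × β => [y.2]) := by fun_prop
  have h := hl.flatMap (f := fun x e => if f x e then [e] else [])
    (hf.ite (h1.feasible hf.one_le) ((Poly.const []).feasible hf.one_le)) hM
  simpa only [filter_eq_flatMap] using h

@[fun_prop]
theorem Poly.filter {l : α → List β} {f : α → β → Bool}
    (hl : Poly l) (hf : Poly (fun y : α × β => f y.1 y.2)) :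
    Poly (fun x => (l x).filter (f x)) :=
  Feasible.filter hl hf fun _ _ _ => le_rfl

@[fun_prop]
theorem Poly.isEmpty {f : α → List β} (hf : Poly f) : Poly (fun x => (f x).isEmpty) := by
  have : Poly (fun l : List β => l.isEmpty) := by
    refine .of_const_time (.ite .id .nil (.cons .nil .nil)) 10 3 (fun l => ?_) (fun l => ?_)
    · cases l with
      | nil => exact ⟨_, by norm_num, .ite_false (.id _) (.cons (.nil _) (.nil _))⟩
      | cons a l => exact ⟨_, by norm_num, .ite_true (.id _) (.nil _)⟩
    · simpa using esize_bool_le _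
  exact this.comp hf

@[fun_prop]
theorem Poly.take_one {f : α → List β} (hf : Poly f) : Poly (fun x => (f x).take 1) := by
  have : Poly (fun l : List β => l.take 1) := by
    refine .of_const_time (.ite .id (.cons .hd .nil) .nil) 10 X (fun l => ?_) (fun l => ?_)
    · cases l with
      | nil => exact ⟨_, by norm_num, .ite_false (.id _) (.nil _)⟩
      | cons a l => exact ⟨_, by norm_num, .ite_true (.id _) (.cons (.hd_cons _ _) (.nil _))⟩
    · cases l with
      | nil => simp
      | cons a l =>
        have := esize_pos l
        simpa [esize_cons, esize_nil] using this
  exact this.comp hf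

@[fun_prop]
theorem Poly.tail {f : α → List β} (hf : Poly f) : Poly (fun x => (f x).tail) := by
  have : Poly (fun l : List β => l.tail) := by
    refine .of_const_time .tl 1 X (fun l => ?_) (fun l => ?_)
    · cases l with
      | nil => exact ⟨_, le_rfl, .tl_nil⟩
      | cons a l => exact ⟨_, le_rfl, .tl_cons _ _⟩
    · cases l with
      | nil => simp
      | cons a l => simp [esize_cons]; omega
  exact this.comp hf

/-- The program reads the default value as the first component of the empty tree, so the default
value has to be encoded by the empty tree. -/
theorem Poly.headD {f : α → List β} (hf : Poly f) {d : β} (hd : enc d = .nil) :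
    Poly (fun x => (f x).headD d) := by
  have : Poly (fun l : List β => l.headD d) := by
    refine .of_const_time .hd 1 X (fun l => ?_) (fun l => ?_)
    · cases l with
      | nil => exact ⟨_, le_rfl, by simpa [hd, enc_nil] using Run.hd_nil⟩
      | cons a l => exact ⟨_, le_rfl, .hd_cons _ _⟩
    · cases l with
      | nil => simp [esize, hd, enc_nil]
      | cons a l => simp [esize_cons]; omega
  exact this.comp hf

@[fun_prop]
theorem Poly.headD_nil {f : α → List (List β)} (hf : Poly f) : Poly (fun x => (f x).headD []) :=
  hf.headD rfl

@[fun_prop]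
theorem Poly.headD_zero {f : α → List ℕ} (hf : Poly f) : Poly (fun x => (f x).headD 0) :=
  hf.headD rfl

@[fun_prop]
theorem Poly.headD_false {f : α → List Bool} (hf : Poly f) : Poly (fun x => (f x).headD false) :=
  hf.headD rfl

@[fun_prop]
theorem Poly.not {f : α → Bool} (hf : Poly f) : Poly (fun x => !f x) := by
  have : Poly (fun x => if f x then false else true) := by fun_prop
  exact this.congr fun x => by cases f x <;> rfl

@[fun_prop]
theorem Poly.and {f g : α → Bool} (hf : Poly f) (hg : Poly g) : Poly (fun x => f x && g x) := by
  have : Poly (fun x => if f x then g x else false) := by fun_prop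
  exact this.congr fun x => by cases f x <;> rfl

@[fun_prop]
theorem Poly.beq_bool {f g : α → Bool} (hf : Poly f) (hg : Poly g) :
    Poly (fun x => f x == g x) := by
  have : Poly (fun x => if f x then g x else !g x) := by fun_prop
  exact this.congr fun x => by cases f x <;> cases g x <;> rfl

theorem any_eq_filter {β : Type*} (p : β → Bool) (l : List β) :
    l.any p = !(l.filter p).isEmpty := by
  induction l with
  | nil => rfl
  | cons a l ih => by_cases h : p a <;> simp [h, ih]

theorem Feasible.any {N : α → ℕ} {M : α × β → ℕ} {l : α → List β} {f : α → β → Bool}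
    (hl : Feasible N l) (hf : Feasible M (fun y : α × β => f y.1 y.2))
    (hM : ∀ x, ∀ e ∈ l x, M (x, e) ≤ N x) : Feasible N (fun x => (l x).any (f x)) := by
  have h1 : Poly (fun l : List β => !l.isEmpty) := by fun_prop
  simp only [any_eq_filter]
  exact Feasible.comp (g := fun l : List β => !l.isEmpty) h1 (hl.filter hf hM) hl.one_le

@[fun_prop]
theorem Poly.any {l : α → List β} {f : α → β → Bool}
    (hl : Poly l) (hf : Poly (fun y : α × β => f y.1 y.2)) :
    Poly (fun x => (l x).any (f x)) :=
  Feasible.any hl hf fun _ _ _ => le_rfl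

@[fun_prop]
theorem Poly.all {l : α → List β} {f : α → β → Bool}
    (hl : Poly l) (hf : Poly (fun y : α × β => f y.1 y.2)) :
    Poly (fun x => (l x).all (f x)) := by
  have : Poly (fun x => !(l x).any (fun e => !f x e)) := by fun_prop
  simpa only [List.not_any_eq_all_not, Bool.not_not] using this

/-! ### Feasible operations on numbers -/

@[fun_prop]
theorem Poly.replicate {f : α → ℕ} (hf : Poly f) : Poly (fun x => List.replicate (f x) ()) := by
  have h (n : ℕ) : enc (List.replicate n ()) = enc n := by
    induction n with
    | zero => rfl
    | succ n ih =>
      rw [List.replicate_succ, enc_cons, ih]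
      rfl
  have : Poly (fun n : ℕ => List.replicate n ()) :=
    .of_const_time .id 1 X (fun n => ⟨1, le_rfl, by rw [h]; exact .id _⟩)
      (fun n => by simp [esize, h])
  exact this.comp hf

@[fun_prop]
theorem Poly.length {f : α → List β} (hf : Poly f) : Poly (fun x => (f x).length) := by
  have h1 : Poly (fun l : List Unit => l.length) := by
    have h (l : List Unit) : enc l.length = enc l := by
      induction l with
      | nil => rfl
      | cons a l ih =>
        rw [enc_cons, ← ih]
        rfl
    exact .of_const_time .id 1 X (fun n => ⟨1, le_rfl, by rw [h]; exact .id _⟩)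
      (fun n => by simp [esize, h])
  have h2 : Poly (fun l : List β => (l.map fun _ => ()).length) := by fun_prop
  simp only [List.length_map] at h2
  exact h2.comp hf

@[fun_prop]
theorem Poly.succ {f : α → ℕ} (hf : Poly f) : Poly (fun x => f x + 1) := by
  have : Poly (fun x => (() :: List.replicate (f x) ()).length) := by fun_prop
  simpa using this

theorem foldl_tail {β γ : Type*} (l : List β) (l' : List γ) :
    l'.foldl (fun a _ => a.tail) l = l.drop l'.length := by
  induction l' generalizing l with
  | nil => simp
  | cons a l' ih => simp [ih]

@[fun_prop]
theorem Poly.drop {n : α → ℕ} {l : α → List β} (hn : Poly n) (hl : Poly l) :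
    Poly (fun x => (l x).drop (n x)) := by
  have : Poly (fun x => (List.replicate (n x) ()).foldl (fun a _ => a.tail) (l x)) := by
    refine Poly.foldl_of_add (l := fun x => List.replicate (n x) ()) (f := fun _ _ a => a.tail)
      (by fun_prop) hl (by fun_prop) 0 ?_
    intro x e _ a
    cases a with
    | nil => simp
    | cons b a => simp [esize_cons]; omega
  simpa only [foldl_tail, List.length_replicate] using this

@[fun_prop]
theorem Poly.decide_le {m n : α → ℕ} (hm : Poly m) (hn : Poly n) :
    Poly (fun x => decide (m x ≤ n x)) := by
  have : Poly (fun x => ((List.replicate (m x) ()).drop (n x)).isEmpty) := by fun_prop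
  refine this.congr fun x => ?_
  rw [List.drop_replicate, Bool.eq_iff_iff]
  simp [Nat.sub_eq_zero_iff_le]

@[fun_prop]
theorem Poly.beq_nat {m n : α → ℕ} (hm : Poly m) (hn : Poly n) : Poly (fun x => m x == n x) := by
  have : Poly (fun x => decide (m x ≤ n x) && decide (n x ≤ m x)) := by fun_prop
  refine this.congr fun x => ?_
  rw [Bool.eq_iff_iff]
  simp only [Bool.and_eq_true, decide_eq_true_eq, beq_iff_eq]
  omega

theorem getD_eq_headD {β : Type*} (l : List β) (n : ℕ) (d : β) :
    l.getD n d = (l.drop n).headD d := by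
  rw [List.headD_eq_head?_getD, List.head?_drop, List.getD_eq_getElem?_getD]

@[fun_prop]
theorem Poly.getD_nil {l : α → List (List β)} {n : α → ℕ} (hl : Poly l) (hn : Poly n) :
    Poly (fun x => (l x).getD (n x) []) := by
  simp only [getD_eq_headD]
  fun_prop

@[fun_prop]
theorem Poly.getD_false {l : α → List Bool} {n : α → ℕ} (hl : Poly l) (hn : Poly n) :
    Poly (fun x => (l x).getD (n x) false) := by
  simp only [getD_eq_headD]
  fun_prop

theorem range_eq_foldl {β : Type*} (l : List β) :
    List.range l.length = (l.foldl (fun a _ => a.length :: a) []).reverse := by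
  have : ∀ (l : List β) (k : ℕ), l.foldl (fun a _ => a.length :: a) (List.range k).reverse =
      (List.range (k + l.length)).reverse := by
    intro l
    induction l with
    | nil => simp
    | cons a l ih =>
      intro k
      have := ih (k + 1)
      rw [List.range_succ] at this
      simp only [List.reverse_append, List.reverse_singleton, List.singleton_append] at this
      simp only [List.foldl_cons, List.length_reverse, List.length_range, List.length_cons, this]
      congr 2
      omega
  have h := this l 0
  simp only [List.range_zero, List.reverse_nil, zero_add] at h
  rw [h, List.reverse_reverse]

@[fun_prop]
theorem Poly.range_length {l : α → List β} (hl : Poly l) :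
    Poly (fun x => List.range (l x).length) := by
  simp only [range_eq_foldl]
  refine Poly.reverse ?_
  obtain ⟨P, hP⟩ := hl.size_le
  refine Poly.foldl (f := fun _ _ a => a.length :: a) hl (by fun_prop) (by fun_prop)
    (P * (2 * P + 2) + 1) ?_
  intro x l' hl'
  have h1 := range_eq_foldl l'
  rw [eq_comm, List.reverse_eq_iff] at h1
  have h2 : l'.length ≤ P.eval (esize x) :=
    hl'.length_le.trans ((length_le_esize _).trans (hP x))
  rw [h1]
  refine (esize_list_le (B := 2 * P.eval (esize x) + 1) ?_).trans ?_
  · intro i hi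
    simp at hi
    rw [esize_nat]
    omega
  · simp only [List.length_reverse, List.length_range, eval_add, eval_mul, eval_one, eval_ofNat]
    have := Nat.mul_le_mul_right (2 * P.eval (esize x) + 2) h2
    exact Nat.add_le_add_right this 1

/-! ### Long lists -/

/-- Some program computes the list `L x` in time `N x` times a polynomial in the size of `x`. The
list may be that long, but its elements have polynomial size. -/
def Listable (N : α → ℕ) (L : α → List β) : Prop :=
  ∃ (p : Program) (P : ℕ[X]), ∀ x, Runs p (enc x) (enc (L x)) (N x * P.eval (esize x)) ∧
    (L x).length ≤ N x * P.eval (esize x) ∧ ∀ a ∈ L x, esize a ≤ P.eval (esize x)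

/-- Some program computes `h x l` in time linear in the length of `l`, and polynomial in the size
of `x` and of the elements of `l`. -/
def LinearTime (h : α → List β → γ) : Prop :=
  ∃ (p : Program) (P : ℕ[X]), ∀ x l B, (∀ a ∈ l, esize a ≤ B) →
    Runs p (enc (x, l)) (enc (h x l)) ((l.length + 1) * P.eval (esize x + B))

theorem Runs.ite {r p q : Program} {x y z : Data} {c : Bool} {R S T : ℕ} (hc : Runs r x (enc c) R)
    (hp : c = true → Runs p x y S) (hq : c = false → Runs q x z T) :
    Runs (.ite r p q) x (if c then y else z) (R + S + T + 1) := by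
  obtain ⟨r, hr, hc⟩ := hc
  cases c with
  | true =>
    obtain ⟨s, hs, hp⟩ := hp rfl
    exact ⟨r + s + 1, by omega, by simpa using .ite_true hc hp⟩
  | false =>
    obtain ⟨t, ht, hq⟩ := hq rfl
    exact ⟨r + t + 1, by omega, by simpa using .ite_false hc hq⟩

theorem runs_id (x : Data) : Runs .id x x 1 := ⟨1, le_rfl, .id x⟩
theorem runs_nil (x : Data) : Runs .nil x .nil 1 := ⟨1, le_rfl, .nil x⟩
theorem runs_hd (a : α) (b : β) : Runs .hd (enc (a, b)) (enc a) 1 := ⟨1, le_rfl, .hd_cons _ _⟩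
theorem runs_tl (a : α) (b : β) : Runs .tl (enc (a, b)) (enc b) 1 := ⟨1, le_rfl, .tl_cons _ _⟩

theorem exists_runs_reverseAppend :
    ∃ p, ∀ l l' : List α, Runs p (enc (l, l')) (enc (l.reverse ++ l')) ((l.length + 2) * 40) := by
  refine ⟨.seq (.cons .id .id) (foldProgram (.cons (.seq .hd .tl) .tl)), fun l l' => ?_⟩
  have h := runs_foldProgram (p := .cons (.seq .hd .tl) .tl) (K := 6) (f := fun e a => e :: a)
    (l, l') l l' (fun l'' e _ => by
      exact ((((runs_hd _ _).seq (runs_tl _ _)).cons (runs_tl _ _)).mono (by norm_num)))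
  rw [show l.foldl (fun a e => e :: a) l' = l.reverse ++ l' by simp] at h
  refine (((runs_id _).cons (runs_id _)).seq h).mono ?_
  rw [add_mul, add_mul]
  omega

theorem exists_runs_reverse :
    ∃ p, ∀ l : List α, Runs p (enc l) (enc l.reverse) ((l.length + 3) * 40) := by
  obtain ⟨p, hp⟩ := exists_runs_reverseAppend (α := α)
  refine ⟨.seq (.cons .id .nil) p, fun l => ?_⟩
  have h := hp l []
  rw [List.append_nil] at h
  refine (((runs_id _).cons (runs_nil _)).seq h).mono ?_
  rw [add_mul, add_mul]
  omega

theorem exists_runs_append :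
    ∃ p, ∀ l l' : List α, Runs p (enc (l, l')) (enc (l ++ l')) ((l.length + 4) * 80) := by
  obtain ⟨p, hp⟩ := exists_runs_reverse (α := α)
  obtain ⟨q, hq⟩ := exists_runs_reverseAppend (α := α)
  refine ⟨.seq (.cons (.seq .hd p) .tl) q, fun l l' => ?_⟩
  have h := hq l.reverse l'
  rw [List.reverse_reverse, List.length_reverse] at h
  refine (((((runs_hd _ _).seq (hp l)).cons (runs_tl _ _)).seq h)).mono ?_
  simp only [add_mul]
  omega

theorem LinearTime.flatMap {g : α → β → List γ} (hg : Poly (fun y : α × β => g y.1 y.2)) :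
    LinearTime (fun x (l : List β) => l.flatMap (g x)) := by
  obtain ⟨p, P, hg⟩ := hg
  obtain ⟨q, hq⟩ := exists_runs_append (α := γ)
  obtain ⟨r, hr⟩ := exists_runs_reverse (α := β)
  refine ⟨.seq (.cons .hd (.cons (.seq .tl r) .nil))
      (foldProgram (.seq (.cons (.seq .hd p) .tl) q)),
    2 * 40 * 10 + (P.comp (X + 1) * 81 + 1000), fun x l B hB => ?_⟩
  have h := runs_foldProgram (p := .seq (.cons (.seq .hd p) .tl) q) (f := fun e a => g x e ++ a)
    (K := P.eval (esize x + B + 1) * 81 + 500) x l.reverse ([] : List γ) (by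
      intro l' e he
      have hmem : e ∈ l := List.mem_reverse.1 (he.subset (by simp))
      have h1 := hg (x, e)
      have h2 : P.eval (esize (x, e)) ≤ P.eval (esize x + B + 1) := by
        refine eval_le_eval _ ?_
        have := hB e hmem
        rw [esize_pair]
        omega
      have h3 := length_le_esize (g x e)
      refine ((((runs_hd _ _).seq h1.1).cons (runs_tl _ _)).seq (hq _ _)).mono ?_
      dsimp only at h1 ⊢
      rw [one_mul]
      omega)
  rw [← flatMap_eq_foldl, List.length_reverse] at h
  refine ((((runs_hd _ _).cons (((runs_tl _ _).seq (hr l)).cons (runs_nil _)))).seq h).mono ?_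
  simp only [eval_add, eval_mul, eval_comp, eval_X, eval_ofNat, eval_one]
  generalize P.eval (esize x + B + 1) = K
  simp only [mul_add (l.length + 1)]
  rw [show (l.length + 3) * 40 = (l.length + 1) * 40 + 80 by ring]
  omega

theorem LinearTime.any {t : α → β → Bool} (ht : Poly (fun y : α × β => t y.1 y.2)) :
    LinearTime (fun x (l : List β) => l.any (t x)) := by
  obtain ⟨p, P, ht⟩ := ht
  have hfold (t : β → Bool) (l : List β) :
      l.any t = l.foldl (fun a e => if t e then true else a) false := by
    have : ∀ (l : List β) (b : Bool),
        l.foldl (fun a e => if t e then true else a) b = (b || l.any t) := by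
      intro l
      induction l with
      | nil => simp
      | cons a l ih =>
        intro b
        rw [List.foldl_cons, ih, List.any_cons]
        cases b <;> cases t a <;> simp
    rw [this, Bool.false_or]
  refine ⟨.seq (.cons .hd (.cons .tl .nil))
    (foldProgram (.ite (.seq .hd p) (.cons .nil .nil) .tl)),
    P.comp (X + 1) + 100, fun x l B hB => ?_⟩
  have h := runs_foldProgram (p := .ite (.seq .hd p) (.cons .nil .nil) .tl)
    (f := fun e a => if t x e then true else a)
    (K := P.eval (esize x + B + 1) + 20) x l false (by
      intro l' e he
      have hmem : e ∈ l := he.subset (by simp)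
      have h1 := ht (x, e)
      have h2 : P.eval (esize (x, e)) ≤ P.eval (esize x + B + 1) := by
        refine eval_le_eval _ ?_
        have := hB e hmem
        rw [esize_pair]
        omega
      have h3 := Runs.ite (p := .cons .nil .nil) (q := .tl) ((runs_hd (x, e)
        (l'.foldl (fun a e => if t x e then true else a) false)).seq h1.1)
        (fun _ => (runs_nil _).cons (runs_nil _)) (fun _ => runs_tl _ _)
      rw [apply_ite enc]
      refine h3.mono ?_
      rw [one_mul]
      omega)
  rw [← hfold] at h
  refine ((((runs_hd _ _).cons ((runs_tl _ _).cons (runs_nil _)))).seq h).mono ?_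
  simp only [eval_add, eval_comp, eval_X, eval_ofNat, eval_one]
  generalize P.eval (esize x + B + 1) = K
  simp only [mul_add (l.length + 1)]
  omega

theorem LinearTime.snd : LinearTime (fun (_ : α) (l : List β) => l) := by
  refine ⟨.tl, 1, fun x l B _ => (runs_tl _ _).mono ?_⟩
  simp

theorem LinearTime.ite {c : α → List β → Bool} {f g : α → List β → γ} (hc : LinearTime c)
    (hf : LinearTime f) (hg : LinearTime g) :
    LinearTime (fun x l => if c x l then f x l else g x l) := by
  obtain ⟨r, R, hc⟩ := hc
  obtain ⟨p, P, hf⟩ := hf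
  obtain ⟨q, Q, hg⟩ := hg
  refine ⟨.ite r p q, R + P + Q + 1, fun x l B hB => ?_⟩
  rw [apply_ite enc]
  refine ((hc x l B hB).ite (fun _ => hf x l B hB) (fun _ => hg x l B hB)).mono ?_
  simp only [eval_add, eval_one, mul_add]
  omega

theorem LinearTime.comp_fst {f : α → List β → γ} (hf : LinearTime f) :
    LinearTime (fun (y : α × δ) l => f y.1 l) := by
  obtain ⟨p, P, hf⟩ := hf
  refine ⟨.seq (.cons (.seq .hd .hd) .tl) p, P + 10, fun y l B hB => ?_⟩
  refine ((((runs_hd _ _).seq (runs_hd y.1 y.2)).cons (runs_tl _ _)).seq (hf y.1 l B hB)).mono ?_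
  have h1 : esize y = esize y.1 + esize y.2 + 1 := rfl
  have h2 : P.eval (esize y.1 + B) ≤ P.eval (esize y + B) := eval_le_eval _ (by omega)
  have h3 := Nat.mul_le_mul_left (l.length + 1) h2
  simp only [eval_add, eval_ofNat, mul_add (l.length + 1)]
  omega

theorem Listable.one_le {N : α → ℕ} {L : α → List β} (h : Listable N L) (x : α) : 1 ≤ N x := by
  obtain ⟨p, P, h⟩ := h
  obtain ⟨t, ht, hr⟩ := (h x).1
  have := hr.pos
  by_contra! h0
  have h0 : N x = 0 := by omega
  simp [h0] at ht
  omega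

theorem Feasible.listable {N : α → ℕ} {L : α → List β} (h : Feasible N L) : Listable N L := by
  have h1 := h.one_le
  obtain ⟨p, P, h⟩ := h
  refine ⟨p, P, fun x => ⟨(h x).1, ?_, fun a ha => (esize_le_of_mem ha).trans (h x).2⟩⟩
  exact ((length_le_esize _).trans (h x).2).trans (Nat.le_mul_of_pos_left _ (h1 x))

theorem Listable.mono {N M : α → ℕ} {L : α → List β} (h : Listable N L) (hNM : ∀ x, N x ≤ M x) :
    Listable M L := by
  obtain ⟨p, P, h⟩ := h
  exact ⟨p, P, fun x => ⟨(h x).1.mono (Nat.mul_le_mul_right _ (hNM x)),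
    (h x).2.1.trans (Nat.mul_le_mul_right _ (hNM x)), (h x).2.2⟩⟩

theorem Listable.comp {M : β → ℕ} {N : α → ℕ} {L : β → List γ} {f : α → β} (hL : Listable M L)
    (hf : Feasible N f) (h : ∀ x, M (f x) ≤ N x) : Listable N (fun x => L (f x)) := by
  have h1 := hf.one_le
  obtain ⟨p, P, hf⟩ := hf
  obtain ⟨q, Q, hL⟩ := hL
  refine ⟨.seq p q, P + Q.comp P + 1, fun x => ?_⟩
  obtain ⟨r1, s1⟩ := hf x
  obtain ⟨r2, s2, s3⟩ := hL (f x)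
  have h2 := eval_le_eval Q s1
  have h3 := Nat.mul_le_mul (h x) h2
  have := h1 x
  simp only [eval_add, eval_comp, eval_one, mul_add, mul_one]
  exact ⟨(r1.seq r2).mono (by omega), by omega, fun a ha => (s3 a ha).trans (by omega)⟩

/-- A program that is linear in the length of a list can be run on a long list. -/
theorem Listable.runs_linearTime {N : α → ℕ} {L : α → List β} {h : α → List β → γ}
    (hL : Listable N L) (hh : LinearTime h) :
    ∃ (p : Program) (P : ℕ[X]), ∀ x, Runs p (enc x) (enc (h x (L x))) (N x * P.eval (esize x)) := by
  have h1 := hL.one_le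
  obtain ⟨p, P, hL⟩ := hL
  obtain ⟨q, Q, hh⟩ := hh
  refine ⟨.seq (.cons .id p) q, P + 3 + (P + 1) * Q.comp (X + P), fun x => ?_⟩
  obtain ⟨r1, s1, s2⟩ := hL x
  refine (((runs_id _).cons r1).seq (hh x (L x) _ s2)).mono ?_
  simp only [eval_add, eval_comp, eval_one, eval_ofNat, eval_mul, eval_X]
  generalize Q.eval (esize x + P.eval (esize x)) = K
  have := h1 x
  have h2 : ((L x).length + 1) * K ≤ N x * ((P.eval (esize x) + 1) * K) := by
    rw [← mul_assoc]
    gcongr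
    rw [mul_add]
    omega
  simp only [mul_add (N x)] at h2 ⊢
  omega

theorem Listable.flatMap {N : α → ℕ} {L : α → List β} {g : α → β → List γ}
    (hL : Listable N L) (hg : Poly (fun y : α × β => g y.1 y.2)) :
    Listable N (fun x => (L x).flatMap (g x)) := by
  obtain ⟨r, R, hr⟩ := hL.runs_linearTime (.flatMap hg)
  obtain ⟨Q, hQ⟩ := hg.size_le
  obtain ⟨p, P, hL⟩ := hL
  refine ⟨r, R + P * Q.comp (X + P + 1) + Q.comp (X + P + 1), fun x => ?_⟩
  obtain ⟨-, s1, s2⟩ := hL x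
  have h1 : ∀ a ∈ L x, esize (g x a) ≤ Q.eval (esize x + P.eval (esize x) + 1) := fun a ha => by
    refine (hQ (x, a)).trans (eval_le_eval _ ?_)
    have := s2 a ha
    rw [esize_pair]
    omega
  simp only [eval_add, eval_comp, eval_one, eval_mul, eval_X]
  refine ⟨(hr x).mono (Nat.mul_le_mul_left _ (by omega)), ?_, ?_⟩
  · rw [List.length_flatMap]
    refine (List.sum_le_card_nsmul _ (Q.eval (esize x + P.eval (esize x) + 1)) ?_).trans ?_
    · intro n hn
      obtain ⟨a, ha, rfl⟩ := List.mem_map.1 hn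
      exact (length_le_esize _).trans (h1 a ha)
    · rw [List.length_map, smul_eq_mul]
      refine (Nat.mul_le_mul_right _ s1).trans ?_
      rw [mul_assoc]
      exact Nat.mul_le_mul_left _ (by omega)
  · intro b hb
    obtain ⟨a, ha, hb⟩ := List.mem_flatMap.1 hb
    have := (esize_le_of_mem hb).trans (h1 a ha)
    omega

theorem Listable.filter {N : α → ℕ} {L : α → List β} {t : α → β → Bool}
    (hL : Listable N L) (ht : Poly (fun y : α × β => t y.1 y.2)) :
    Listable N (fun x => (L x).filter (t x)) := by
  have h := hL.flatMap (g := fun x a => if t x a then [a] else [])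
    (ht.ite (g := fun _ => []) (by fun_prop) (by fun_prop))
  simpa only [filter_eq_flatMap] using h

theorem Listable.map {N : α → ℕ} {L : α → List β} {g : α → β → γ}
    (hL : Listable N L) (hg : Poly (fun y : α × β => g y.1 y.2)) :
    Listable N (fun x => (L x).map (g x)) := by
  have h := hL.flatMap (g := fun x a => [g x a]) (by fun_prop)
  simpa only [← List.map_eq_flatMap] using h

theorem Listable.any {N : α → ℕ} {L : α → List β} {t : α → β → Bool}
    (hL : Listable N L) (ht : Poly (fun y : α × β => t y.1 y.2)) :
    Feasible N (fun x => (L x).any (t x)) := by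
  have h1 := hL.one_le
  obtain ⟨r, R, hr⟩ := hL.runs_linearTime (.any ht)
  refine ⟨r, R + 3, fun x => ⟨(hr x).mono (Nat.mul_le_mul_left _ (by simp)), ?_⟩⟩
  have := esize_bool_le ((L x).any (t x))
  simp only [eval_add, eval_ofNat]
  omega

theorem Listable.headD {N : α → ℕ} {L : α → List β} {d : β} (hL : Listable N L)
    (hd : enc d = .nil) : Feasible N (fun x => (L x).headD d) := by
  have h1 := hL.one_le
  obtain ⟨p, P, hL⟩ := hL
  refine ⟨.seq p .hd, P + 2, fun x => ?_⟩
  obtain ⟨r1, s1, s2⟩ := hL x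
  simp only [eval_add, eval_ofNat]
  have := h1 x
  cases h : L x with
  | nil =>
    rw [h] at r1
    refine ⟨(r1.seq ⟨1, le_rfl, by simpa [hd, enc_nil] using Run.hd_nil⟩).mono ?_, ?_⟩
    · rw [mul_add]; omega
    · simp [esize, hd, Data.size]
  | cons a l =>
    rw [h] at r1 s2
    refine ⟨(r1.seq ⟨1, le_rfl, .hd_cons _ _⟩).mono ?_, ?_⟩
    · rw [mul_add]; omega
    · have := s2 a (by simp)
      simp only [List.headD_cons]
      omega

/-- One level of a breadth-first search: all states are expanded, unless some state passes the
test that ends the search. -/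
def searchStep {γ : Type*} (t : γ → Bool) (g : γ → List γ) (L : List γ) : List γ :=
  if L.any t then L else L.flatMap g

/-- A breadth-first search takes time about the number of its states, if an expansion adds at
most a polynomial amount to the size of a state. -/
theorem Listable.search {N : α → ℕ} {es : α → List β} {L : α → List γ} {t : α → γ → Bool}
    {g : α → β → γ → List γ} (hL : Listable N L) (hes : Poly es)
    (ht : Poly (fun y : α × γ => t y.1 y.2))
    (hg : Poly (fun y : (α × β) × γ => g y.1.1 y.1.2 y.2)) (Q : ℕ[X])
    (hQ : ∀ x, ∀ e ∈ es x, ∀ s, ∀ s' ∈ g x e s, esize s' ≤ esize s + Q.eval (esize x))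
    (hN : ∀ x l, l <+: es x →
      (l.foldl (fun L e => searchStep (t x) (g x e) L) (L x)).length ≤ N x) :
    Listable N (fun x => (es x).foldl (fun L e => searchStep (t x) (g x e) L) (L x)) := by
  have h1 := hL.one_le
  have hstep : LinearTime (fun (y : α × β) (L : List γ) => searchStep (t y.1) (g y.1 y.2) L) :=
    .ite (.comp_fst (.any ht)) .snd (.flatMap hg)
  obtain ⟨p, P, hL⟩ := hL
  obtain ⟨r, R, hr⟩ := hstep
  obtain ⟨q, S, hes⟩ := hes
  have hsize : ∀ x l, l <+: es x → ∀ s ∈ l.foldl (fun L e => searchStep (t x) (g x e) L) (L x),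
      esize s ≤ P.eval (esize x) + l.length * Q.eval (esize x) := by
    intro x l
    induction l using List.reverseRecOn with
    | nil =>
      intro _ s hs
      have := (hL x).2.2 s hs
      omega
    | append_singleton l e ih =>
      intro hl s hs
      have ih := ih ((List.prefix_append _ _).trans hl)
      rw [List.foldl_append, List.foldl_cons, List.foldl_nil, searchStep] at hs
      rw [List.length_append, List.length_singleton, add_mul, one_mul]
      split_ifs at hs
      · have := ih s hs
        omega
      · obtain ⟨s', hs', hs⟩ := List.mem_flatMap.1 hs
        have h2 := ih s' hs'
        have h3 := hQ x e (hl.subset (by simp)) s' s hs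
        omega
  have hlen : ∀ x l, l <+: es x → l.length ≤ S.eval (esize x) := fun x l hl =>
    hl.length_le.trans ((length_le_esize _).trans (hes x).2)
  have hsize' : ∀ x l, l <+: es x → ∀ s ∈ l.foldl (fun L e => searchStep (t x) (g x e) L) (L x),
      esize s ≤ P.eval (esize x) + S.eval (esize x) * Q.eval (esize x) := fun x l hl s hs =>
    (hsize x l hl s hs).trans (by gcongr; exact hlen x l hl)
  refine ⟨.seq (.cons .id (.cons q p)) (foldProgram r), P + S * Q + S + 4 + 1 +
    (S + 1) * (2 * R.comp (X + S + 1 + (P + S * Q)) + 24), fun x => ⟨?_, ?_, ?_⟩⟩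
  · have h3 := runs_foldProgram (p := r) (f := fun e L => searchStep (t x) (g x e) L)
      (K := N x * (2 * R.eval (esize x + S.eval (esize x) + 1 +
        (P.eval (esize x) + S.eval (esize x) * Q.eval (esize x))))) x (es x) (L x) (by
      intro l e hl
      have hl' := (List.prefix_append _ _).trans hl
      refine (hr (x, e) _ _ (hsize' x l hl')).mono ?_
      have h4 := hN x l hl'
      have h5 : esize (x, e) ≤ esize x + S.eval (esize x) + 1 := by
        have := (esize_le_of_mem (hl.subset (by simp : e ∈ l ++ [e]))).trans (hes x).2
        rw [esize_pair]
        omega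
      calc _ ≤ (N x + N x) * R.eval (esize x + S.eval (esize x) + 1 +
              (P.eval (esize x) + S.eval (esize x) * Q.eval (esize x))) := by
            have := h1 x
            exact Nat.mul_le_mul (by omega) (eval_le_eval _ (by omega))
        _ = _ := by ring)
    refine (((runs_id _).cons ((hes x).1.cons (hL x).1)).seq h3).mono ?_
    simp only [eval_add, eval_mul, eval_comp, eval_X, eval_ofNat, eval_one]
    generalize R.eval (esize x + S.eval (esize x) + 1 +
        (P.eval (esize x) + S.eval (esize x) * Q.eval (esize x))) = K
    have h6 := hlen x (es x) List.prefix_rfl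
    have h7 := h1 x
    have h8 : ((es x).length + 1) * (N x * (2 * K) + 24) ≤
        N x * ((S.eval (esize x) + 1) * (2 * K + 24)) := by
      calc _ ≤ (S.eval (esize x) + 1) * (N x * (2 * K) + N x * 24) := by gcongr; omega
        _ = _ := by ring
    have h9 := Nat.mul_le_mul_right (S.eval (esize x)) h7
    simp only [mul_add (N x), one_mul] at h8 h9 ⊢
    omega
  · refine (hN x _ List.prefix_rfl).trans (Nat.le_mul_of_pos_right _ ?_)
    simp only [eval_add, eval_ofNat]
    omega
  · intro s hs
    have := hsize' x _ List.prefix_rfl s hs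
    simp only [eval_add, eval_mul]
    omega

theorem length_foldl_flatMap_le {β γ : Type*} {g : β → γ → List γ} {m : ℕ}
    (hg : ∀ e s, (g e s).length ≤ m) (l : List β) (L : List γ) :
    (l.foldl (fun L e => L.flatMap (g e)) L).length ≤ L.length * m ^ l.length := by
  induction l generalizing L with
  | nil => simp
  | cons e l ih =>
    rw [List.foldl_cons, List.length_cons, pow_succ', ← mul_assoc]
    refine (ih _).trans (Nat.mul_le_mul_right _ ?_)
    rw [List.length_flatMap]
    refine (List.sum_le_card_nsmul _ m ?_).trans (by simp)
    intro n hn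
    obtain ⟨a, _, rfl⟩ := List.mem_map.1 hn
    exact hg e a

theorem searchStep_false {γ : Type*} (g : γ → List γ) (L : List γ) :
    searchStep (fun _ => false) g L = L.flatMap g := by
  simp [searchStep]

/-- A branching search takes time about the bound `|L₀| * m ^ n` for the number of its leaves, if
every one of the `n` steps replaces a state by at most `m` states. -/
theorem Listable.branch {N m : α → ℕ} {es : α → List β} {L : α → List γ}
    {g : α → β → γ → List γ} (hL : Listable N L) (hes : Poly es)
    (hg : Poly (fun y : (α × β) × γ => g y.1.1 y.1.2 y.2)) (Q : ℕ[X])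
    (hQ : ∀ x, ∀ e ∈ es x, ∀ s, ∀ s' ∈ g x e s, esize s' ≤ esize s + Q.eval (esize x))
    (hm : ∀ x, 1 ≤ m x) (hgm : ∀ x e s, (g x e s).length ≤ m x)
    (hN : ∀ x, (L x).length * m x ^ (es x).length ≤ N x) :
    Listable N (fun x => (es x).foldl (fun L e => L.flatMap (g x e)) (L x)) := by
  have h := hL.search (t := fun _ _ => false) hes (by fun_prop) hg Q hQ (by
    intro x l hl
    simp only [searchStep_false]
    exact (length_foldl_flatMap_le (hgm x) l (L x)).trans ((Nat.mul_le_mul_left _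
      (Nat.pow_le_pow_right (hm x) hl.length_le)).trans (hN x)))
  simpa only [searchStep_false] using h

/-! ### Vertex covers -/

/-- Adjacency according to an adjacency matrix; positions outside of the matrix count as `false`. -/
def adj (M : List (List Bool)) (u v : ℕ) : Bool := (M.getD u []).getD v false

@[fun_prop]
theorem Poly.adj {M : α → List (List Bool)} {u v : α → ℕ} (hM : Poly M) (hu : Poly u)
    (hv : Poly v) : Poly (fun x => adj (M x) (u x) (v x)) := by
  unfold MCIS.adj
  fun_prop

/-- Membership in a list of numbers. -/
def memb (u : ℕ) (l : List ℕ) : Bool := l.any fun v => u == v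

@[simp]
theorem memb_iff {u : ℕ} {l : List ℕ} : memb u l = true ↔ u ∈ l := by
  simp [memb]

@[fun_prop]
theorem Poly.memb {u : α → ℕ} {l : α → List ℕ} (hu : Poly u) (hl : Poly l) :
    Poly (fun x => memb (u x) (l x)) := by
  unfold MCIS.memb
  fun_prop

/-- The edges on the vertex list `g.2` that have no end in `C`, where `g.1` is an adjacency
matrix. -/
def uncovered (g : List (List Bool) × List ℕ) (C : List ℕ) : List (ℕ × ℕ) :=
  (g.2.flatMap fun u => g.2.map fun v => (u, v)).filter fun e =>
    adj g.1 e.1 e.2 && (!memb e.1 C && !memb e.2 C)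

@[fun_prop]
theorem Poly.uncovered {g : α → List (List Bool) × List ℕ} {C : α → List ℕ} (hg : Poly g)
    (hC : Poly C) : Poly (fun x => uncovered (g x) (C x)) := by
  unfold MCIS.uncovered
  fun_prop

/-- Whether the list `C` covers all edges on the vertex list `g.2`. -/
def isCover (g : List (List Bool) × List ℕ) (C : List ℕ) : Bool := (uncovered g C).isEmpty

@[fun_prop]
theorem Poly.isCover {g : α → List (List Bool) × List ℕ} {C : α → List ℕ} (hg : Poly g)
    (hC : Poly C) : Poly (fun x => isCover (g x) (C x)) := by
  unfold MCIS.isCover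
  fun_prop

/-- The two ways to cover the first uncovered edge. -/
def coverBranch (g : List (List Bool) × List ℕ) (C : List ℕ) : List (List ℕ) :=
  ((uncovered g C).take 1).flatMap fun e => [e.1 :: C, e.2 :: C]

@[fun_prop]
theorem Poly.coverBranch {g : α → List (List Bool) × List ℕ} {C : α → List ℕ} (hg : Poly g)
    (hC : Poly C) : Poly (fun x => coverBranch (g x) (C x)) := by
  unfold MCIS.coverBranch
  fun_prop

/-- The partial covers of the first level of the search tree that contains a cover. -/
def coverLevel (g : List (List Bool) × List ℕ) : List (List ℕ) :=
  g.2.foldl (fun L _ => searchStep (isCover g) (coverBranch g) L) [[]]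

/-- A vertex cover of minimum size. -/
def minCover (g : List (List Bool) × List ℕ) : List ℕ :=
  ((coverLevel g).filter (isCover g)).headD []

theorem mem_uncovered {g : List (List Bool) × List ℕ} {C : List ℕ} {e : ℕ × ℕ} :
    e ∈ uncovered g C ↔
      e.1 ∈ g.2 ∧ e.2 ∈ g.2 ∧ adj g.1 e.1 e.2 = true ∧ e.1 ∉ C ∧ e.2 ∉ C := by
  obtain ⟨u, v⟩ := e
  simp only [uncovered, List.mem_filter, List.mem_flatMap, List.mem_map, Prod.mk.injEq,
    Bool.and_eq_true, Bool.not_eq_true', ← Bool.not_eq_true, memb_iff]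
  constructor
  · rintro ⟨⟨a, ha, b, hb, rfl, rfl⟩, h1, h2, h3⟩
    exact ⟨ha, hb, h1, h2, h3⟩
  · rintro ⟨ha, hb, h1, h2, h3⟩
    exact ⟨⟨u, ha, v, hb, rfl, rfl⟩, h1, h2, h3⟩

theorem isCover_iff {g : List (List Bool) × List ℕ} {C : List ℕ} :
    isCover g C = true ↔
      ∀ u ∈ g.2, ∀ v ∈ g.2, adj g.1 u v = true → u ∈ C ∨ v ∈ C := by
  rw [isCover, List.isEmpty_iff, List.eq_nil_iff_forall_not_mem]
  simp only [mem_uncovered, Prod.forall]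
  constructor
  · intro h u hu v hv huv
    by_contra! hc
    exact h u v ⟨hu, hv, huv, hc⟩
  · rintro h u v ⟨hu, hv, huv, hc⟩
    rcases h u hu v hv huv with h | h
    · exact hc.1 h
    · exact hc.2 h

theorem coverBranch_eq {g : List (List Bool) × List ℕ} {C : List ℕ} (h : ¬ isCover g C = true) :
    ∃ e ∈ uncovered g C, coverBranch g C = [e.1 :: C, e.2 :: C] := by
  rw [isCover, List.isEmpty_iff] at h
  obtain ⟨e, l, hl⟩ := List.exists_cons_of_ne_nil h
  exact ⟨e, by simp [hl], by simp [coverBranch, hl]⟩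

/-- The invariant of the search for a vertex cover: after the expansions of `l`, all partial covers
have the same size `j`, there are at most `2 ^ j` of them, every cover contains one of them, and
`j` counts the expansions as long as no partial cover is a cover. -/
theorem exists_level (g : List (List Bool) × List ℕ) (l : List ℕ) :
    let L := l.foldl (fun L _ => searchStep (isCover g) (coverBranch g) L) [[]]
    ∃ j, (∀ C ∈ L, C.length = j ∧ C.Nodup ∧ C ⊆ g.2) ∧ L.length ≤ 2 ^ j ∧
      (∀ D, isCover g D = true → ∃ C ∈ L, C ⊆ D) ∧
      (L.any (isCover g) = true ∨ j = l.length) := by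
  induction l using List.reverseRecOn with
  | nil => exact ⟨0, by simp⟩
  | append_singleton l e ih =>
    obtain ⟨j, h1, h2, h3, h4⟩ := ih
    simp only [List.foldl_append, List.foldl_cons, List.foldl_nil, List.length_append,
      List.length_singleton]
    generalize l.foldl (fun L _ => searchStep (isCover g) (coverBranch g) L) [[]] = L at *
    by_cases hL : L.any (isCover g) = true
    · simp only [searchStep, hL, if_true]
      exact ⟨j, h1, h2, h3, .inl trivial⟩
    · have hj := h4.resolve_left hL
      have hL' : ∀ C ∈ L, ¬ isCover g C = true := by simpa using hL
      simp only [searchStep, hL]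
      refine ⟨j + 1, ?_, ?_, ?_, .inr (by rw [hj])⟩
      · intro C hC
        obtain ⟨C', hC', hC⟩ := List.mem_flatMap.1 hC
        obtain ⟨e, he, heq⟩ := coverBranch_eq (hL' C' hC')
        rw [mem_uncovered] at he
        rw [heq] at hC
        obtain ⟨h5, h6, h7⟩ := h1 C' hC'
        simp only [List.mem_cons, List.not_mem_nil, or_false] at hC
        rcases hC with rfl | rfl
        · exact ⟨by simp [h5], List.nodup_cons.2 ⟨he.2.2.2.1, h6⟩,
            List.cons_subset.2 ⟨he.1, h7⟩⟩
        · exact ⟨by simp [h5], List.nodup_cons.2 ⟨he.2.2.2.2, h6⟩,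
            List.cons_subset.2 ⟨he.2.1, h7⟩⟩
      · rw [if_neg (by simp), List.length_flatMap]
        refine (List.sum_le_card_nsmul _ 2 ?_).trans ?_
        · intro n hn
          obtain ⟨C, hC, rfl⟩ := List.mem_map.1 hn
          obtain ⟨e, he, heq⟩ := coverBranch_eq (hL' C hC)
          simp [heq]
        · rw [List.length_map, smul_eq_mul, pow_succ]
          exact Nat.mul_le_mul_right _ h2
      · intro D hD
        obtain ⟨C, hC, hCD⟩ := h3 D hD
        obtain ⟨e, he, heq⟩ := coverBranch_eq (hL' C hC)
        rw [mem_uncovered] at he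
        rw [if_neg (by simp)]
        rcases isCover_iff.1 hD e.1 he.1 e.2 he.2.1 he.2.2.1 with h | h
        · exact ⟨e.1 :: C, List.mem_flatMap.2 ⟨C, hC, by simp [heq]⟩,
            List.cons_subset.2 ⟨h, hCD⟩⟩
        · exact ⟨e.2 :: C, List.mem_flatMap.2 ⟨C, hC, by simp [heq]⟩,
            List.cons_subset.2 ⟨h, hCD⟩⟩

theorem any_coverLevel (g : List (List Bool) × List ℕ) :
    (coverLevel g).any (isCover g) = true := by
  obtain ⟨j, h1, h2, h3, h4⟩ := exists_level g g.2
  refine h4.elim id fun hj => ?_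
  have hself : isCover g g.2 = true := isCover_iff.2 fun u hu v hv _ => .inl hu
  obtain ⟨C, hC, -⟩ := h3 g.2 hself
  refine List.any_eq_true.2 ⟨C, hC, isCover_iff.2 fun u hu v hv _ => .inl ?_⟩
  -- A partial cover with as many vertices as the graph has contains all vertices.
  obtain ⟨h5, h6, h7⟩ := h1 C hC
  exact (((List.subperm_of_subset h6 h7).perm_of_length_le (by omega)).mem_iff).2 hu

theorem minCover_mem (g : List (List Bool) × List ℕ) :
    minCover g ∈ coverLevel g ∧ isCover g (minCover g) = true := by
  obtain ⟨C, hC, hC'⟩ := List.any_eq_true.1 (any_coverLevel g)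
  have hne : (coverLevel g).filter (isCover g) ≠ [] :=
    List.ne_nil_of_mem (List.mem_filter.2 ⟨hC, hC'⟩)
  obtain ⟨D, l, hD⟩ := List.exists_cons_of_ne_nil hne
  rw [minCover, hD, List.headD_cons]
  exact List.mem_filter.1 (hD ▸ List.mem_cons_self)

theorem isCover_minCover (g : List (List Bool) × List ℕ) : isCover g (minCover g) = true :=
  (minCover_mem g).2

theorem minCover_subset (g : List (List Bool) × List ℕ) : minCover g ⊆ g.2 := by
  obtain ⟨j, h1, -⟩ := exists_level g g.2
  exact (h1 _ (minCover_mem g).1).2.2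

theorem length_minCover_le {g : List (List Bool) × List ℕ} {D : List ℕ}
    (hD : isCover g D = true) : (minCover g).length ≤ D.length := by
  obtain ⟨j, h1, h2, h3, h4⟩ := exists_level g g.2
  obtain ⟨C, hC, hCD⟩ := h3 D hD
  rw [(h1 _ (minCover_mem g).1).1, ← (h1 C hC).1]
  exact (List.subperm_of_subset (h1 C hC).2.1 hCD).length_le

theorem length_level_le (g : List (List Bool) × List ℕ) (l : List ℕ) :
    (l.foldl (fun L _ => searchStep (isCover g) (coverBranch g) L) [[]]).length ≤
      2 ^ (minCover g).length := by
  obtain ⟨j, h1, h2, h3, h4⟩ := exists_level g l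
  refine h2.trans (Nat.pow_le_pow_right (by norm_num) ?_)
  obtain ⟨C, hC, hCD⟩ := h3 _ (isCover_minCover g)
  rw [← (h1 C hC).1]
  exact (List.subperm_of_subset (h1 C hC).2.1 hCD).length_le

theorem feasible_minCover : Feasible (fun g => 2 ^ (minCover g).length) minCover := by
  have h : Listable (fun g => 2 ^ (minCover g).length) coverLevel := by
    refine Listable.search (es := fun g => g.2) (L := fun _ => [[]]) (t := isCover)
      (g := fun g _ C => coverBranch g C) ?_ (by fun_prop) (by fun_prop) (by fun_prop) (X + 1) ?_
      fun g l _ => length_level_le g l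
    · exact ((Poly.const _).feasible fun _ => Nat.one_le_two_pow).listable
    · intro g u _ C C' hC'
      obtain ⟨e, he, hC'⟩ := List.mem_flatMap.1 hC'
      have he := mem_uncovered.1 (List.mem_of_mem_take he)
      have h1 := esize_le_of_mem he.1
      have h2 := esize_le_of_mem he.2.1
      have h3 : esize g = esize g.1 + esize g.2 + 1 := rfl
      simp only [eval_add, eval_X, eval_one]
      simp only [List.mem_cons, List.not_mem_nil, or_false] at hC'
      rcases hC' with rfl | rfl <;> rw [esize_cons] <;> omega
  exact (h.filter (by fun_prop)).headD rfl

/-! ### Representatives -/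

/-- A sublist of representatives: an element is dropped if it is related to one that is kept. -/
def dedupBy {β : Type*} (r : β → β → Bool) (l : List β) : List β :=
  l.foldl (fun acc a => if acc.any (r a) then acc else a :: acc) []

theorem dedupBy_append_singleton {β : Type*} (r : β → β → Bool) (l : List β) (a : β) :
    dedupBy r (l ++ [a]) =
      if (dedupBy r l).any (r a) then dedupBy r l else a :: dedupBy r l := by
  simp [dedupBy]

theorem dedupBy_subset {β : Type*} (r : β → β → Bool) (l : List β) : dedupBy r l ⊆ l := by
  induction l using List.reverseRecOn with
  | nil => simp [dedupBy]
  | append_singleton l a ih =>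
    rw [dedupBy_append_singleton]
    split_ifs
    · exact List.Subset.trans ih (List.subset_append_left _ _)
    · exact List.cons_subset.2 ⟨by simp, List.Subset.trans ih (List.subset_append_left _ _)⟩

theorem dedupBy_pairwise {β : Type*} (r : β → β → Bool) (l : List β) :
    (dedupBy r l).Pairwise fun a b => r a b = false := by
  induction l using List.reverseRecOn with
  | nil => simp [dedupBy]
  | append_singleton l a ih =>
    rw [dedupBy_append_singleton]
    split_ifs with h
    · exact ih
    · refine List.pairwise_cons.2 ⟨fun b hb => ?_, ih⟩
      by_contra hab
      exact h (List.any_eq_true.2 ⟨b, hb, by simpa using hab⟩)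

theorem exists_mem_dedupBy {β : Type*} {r : β → β → Bool} {l : List β} {a : β}
    (hr : r a a = true) (ha : a ∈ l) : ∃ b ∈ dedupBy r l, r a b = true := by
  induction l using List.reverseRecOn with
  | nil => simp at ha
  | append_singleton l c ih =>
    rw [dedupBy_append_singleton]
    rcases List.mem_append.1 ha with ha | ha
    · obtain ⟨b, hb, hab⟩ := ih ha
      refine ⟨b, ?_, hab⟩
      split_ifs
      · exact hb
      · exact List.mem_cons_of_mem _ hb
    · obtain rfl := List.mem_singleton.1 ha
      split_ifs with h
      · exact List.any_eq_true.1 h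
      · exact ⟨a, List.mem_cons_self, hr⟩

theorem foldr_max_le_iff {β : Type*} {f : β → ℕ} {l : List β} {n : ℕ} :
    (l.map f).foldr max 1 ≤ n ↔ 1 ≤ n ∧ ∀ b ∈ l, f b ≤ n := by
  induction l with
  | nil => simp
  | cons b l ih =>
    simp only [List.map_cons, List.foldr_cons, max_le_iff, ih, List.forall_mem_cons]
    tauto

theorem Feasible.dedupBy {N : α → ℕ} {M : (α × β) × β → ℕ} {l : α → List β}
    {r : α → β → β → Bool} (hl : Feasible N l)
    (hr : Feasible M (fun y : (α × β) × β => r y.1.1 y.1.2 y.2))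
    (hM : ∀ x, ∀ a ∈ l x, ∀ b ∈ l x, M ((x, a), b) ≤ N x) :
    Feasible N (fun x => dedupBy (r x) (l x)) := by
  obtain ⟨p, P, hl'⟩ := id hl
  have hany : Feasible (fun y : (α × β) × List β => (y.2.map fun b => M (y.1, b)).foldr max 1)
      (fun y : (α × β) × List β => y.2.any (r y.1.1 y.1.2)) := by
    have h1 (y : (α × β) × List β) : 1 ≤ (y.2.map fun b => M (y.1, b)).foldr max 1 :=
      (foldr_max_le_iff.1 le_rfl).1
    refine Feasible.any (l := fun y : (α × β) × List β => y.2)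
      (f := fun y b => r y.1.1 y.1.2 b)
      (M := fun z => M (z.1.1, z.2)) (Poly.snd'.feasible h1) ?_ ?_
    · exact Feasible.comp (f := fun z : ((α × β) × List β) × β => (z.1.1, z.2)) hr
        (Poly.feasible (by fun_prop) fun z => hr.one_le _) fun _ => le_rfl
    · exact fun y => (foldr_max_le_iff.1 le_rfl).2
  refine Feasible.foldl (l := l) (a := fun _ => ([] : List β)) (B := P)
    (f := fun x a acc => if acc.any (r x a) then acc else a :: acc) hl
    ((Poly.const []).feasible hl.one_le)
    (hany.ite (Poly.snd'.feasible hany.one_le)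
      (Poly.feasible (f := fun y : (α × β) × List β => y.1.2 :: y.2) (by fun_prop) hany.one_le))
    ?_ ?_
  · intro x l' e hl''
    exact foldr_max_le_iff.2 ⟨hl.one_le x, fun b hb => hM x e (hl''.subset (by simp)) b
      (hl''.subset (List.mem_append_left _ (dedupBy_subset _ _ hb)))⟩
  · intro x l' hl''
    refine le_trans ?_ (hl' x).2
    have h1 : esize l' ≤ esize (l x) := by
      obtain ⟨l'', h⟩ := hl''
      have := esize_append l' l''
      rw [h] at this
      have := esize_pos l''
      omega
    refine le_trans ?_ h1
    clear hl'' h1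
    change esize (MCIS.dedupBy (r x) l') ≤ _
    induction l' using List.reverseRecOn with
    | nil => exact le_rfl
    | append_singleton l a ih =>
      rw [dedupBy_append_singleton]
      have h2 := esize_append l [a]
      rw [esize_cons, esize_nil] at h2
      split_ifs
      · omega
      · rw [esize_cons]
        omega

@[fun_prop]
theorem Poly.dedupBy {l : α → List β} {r : α → β → β → Bool} (hl : Poly l)
    (hr : Poly (fun y : (α × β) × β => r y.1.1 y.1.2 y.2)) :
    Poly (fun x => dedupBy (r x) (l x)) :=
  Feasible.dedupBy hl hr fun _ _ _ _ _ => le_rfl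

/-! ### Search for isomorphisms between induced subgraphs -/

/-- An adjacency matrix, the list of the vertices in use, and a vertex cover. -/
abbrev CoveredGraph : Type := (List (List Bool) × List ℕ) × List ℕ

/-- Whether the two assignments `p.1 ↦ p.2` and `q.1 ↦ q.2` may belong to the same isomorphism
between induced subgraphs. -/
def compatible (E : CoveredGraph × CoveredGraph) (p q : ℕ × ℕ) : Bool :=
  !(p.1 == q.1) && (!(p.2 == q.2) && (adj E.1.1.1 p.1 q.1 == adj E.2.1.1 p.2 q.2))

@[fun_prop]
theorem Poly.compatible {E : α → CoveredGraph × CoveredGraph} {p q : α → ℕ × ℕ} (hE : Poly E)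
    (hp : Poly p) (hq : Poly q) : Poly (fun x => compatible (E x) (p x) (q x)) := by
  unfold MCIS.compatible
  fun_prop

/-- Whether the partial isomorphism `φ`, given as a list of assignments, can be extended by `p`. -/
def fits (E : CoveredGraph × CoveredGraph) (φ : List (ℕ × ℕ)) (p : ℕ × ℕ) : Bool :=
  φ.all fun q => compatible E p q

@[fun_prop]
theorem Poly.fits {E : α → CoveredGraph × CoveredGraph} {φ : α → List (ℕ × ℕ)} {p : α → ℕ × ℕ}
    (hE : Poly E) (hφ : Poly φ) (hp : Poly p) : Poly (fun x => fits (E x) (φ x) (p x)) := by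
  unfold MCIS.fits
  fun_prop

/-- The vertices outside of the vertex cover. -/
def independent (S : CoveredGraph) : List ℕ :=
  S.1.2.filter fun u => !memb u S.2

@[fun_prop]
theorem Poly.independent {S : α → CoveredGraph} (hS : Poly S) :
    Poly (fun x => independent (S x)) := by
  unfold MCIS.independent
  fun_prop

/-- Whether two vertices have the same neighbours in the vertex cover. -/
def twins (S : CoveredGraph) (v w : ℕ) : Bool :=
  S.2.all fun z => adj S.1.1 v z == adj S.1.1 w z

@[fun_prop]
theorem Poly.twins {S : α → CoveredGraph} {v w : α → ℕ} (hS : Poly S) (hv : Poly v)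
    (hw : Poly w) : Poly (fun x => twins (S x) (v x) (w x)) := by
  unfold MCIS.twins
  fun_prop

/-- The ways to decide on the vertex `u` of the cover of the first graph: it is not used, or it is
mapped to a vertex of the other cover or to a representative of a class of twins. -/
def extendLeft (E : CoveredGraph × CoveredGraph) (u : ℕ) (φ : List (ℕ × ℕ)) :
    List (List (ℕ × ℕ)) :=
  φ :: ((E.2.2.filter fun v => fits E φ (u, v)) ++
    dedupBy (twins E.2) ((independent E.2).filter fun v => fits E φ (u, v))).map
      fun v => (u, v) :: φ

@[fun_prop]
theorem Poly.extendLeft {E : α → CoveredGraph × CoveredGraph} {u : α → ℕ}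
    {φ : α → List (ℕ × ℕ)} (hE : Poly E) (hu : Poly u) (hφ : Poly φ) :
    Poly (fun x => extendLeft (E x) (u x) (φ x)) := by
  unfold MCIS.extendLeft
  fun_prop

/-- The ways to decide on the vertex `v` of the cover of the second graph, when the cover of the
first graph has been dealt with: it is not used, or it is the image of the first possible vertex
outside of the cover. -/
def extendRight (E : CoveredGraph × CoveredGraph) (v : ℕ) (φ : List (ℕ × ℕ)) :
    List (List (ℕ × ℕ)) :=
  φ :: (((independent E.1).filter fun w => fits E φ (w, v)).take 1).map fun w => (w, v) :: φ

@[fun_prop]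
theorem Poly.extendRight {E : α → CoveredGraph × CoveredGraph} {v : α → ℕ}
    {φ : α → List (ℕ × ℕ)} (hE : Poly E) (hv : Poly v) (hφ : Poly φ) :
    Poly (fun x => extendRight (E x) (v x) (φ x)) := by
  unfold MCIS.extendRight
  fun_prop

/-- The vertex `w` outside of the first cover is mapped to the first possible vertex outside of the
second cover, if there is one. The result is a list with one element. -/
def extendIndependent (E : CoveredGraph × CoveredGraph) (w : ℕ) (φ : List (ℕ × ℕ)) :
    List (List (ℕ × ℕ)) :=
  (((independent E.2).filter fun v => fits E φ (w, v)).map (fun v => (w, v) :: φ) ++ [φ]).take 1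

@[fun_prop]
theorem Poly.extendIndependent {E : α → CoveredGraph × CoveredGraph} {w : α → ℕ}
    {φ : α → List (ℕ × ℕ)} (hE : Poly E) (hw : Poly w) (hφ : Poly φ) :
    Poly (fun x => extendIndependent (E x) (w x) (φ x)) := by
  unfold MCIS.extendIndependent
  fun_prop

/-- The results of the search for isomorphisms between induced subgraphs. The decisions on the cover
of the first graph come first, then those on the cover of the second graph; the rest is greedy. -/
def leaves (E : CoveredGraph × CoveredGraph) : List (List (ℕ × ℕ)) :=
  (independent E.1).foldl (fun L w => L.flatMap (extendIndependent E w))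
    (E.2.2.foldl (fun L v => L.flatMap (extendRight E v))
      (E.1.2.foldl (fun L u => L.flatMap (extendLeft E u)) [[]]))

/-- The state `φ'` is `φ` itself, or it extends `φ` by one assignment. -/
def IsStep (E : CoveredGraph × CoveredGraph) (φ φ' : List (ℕ × ℕ)) : Prop :=
  φ' = φ ∨ ∃ p, (p.1 ∈ E.1.1.2 ∨ p.1 ∈ E.1.2) ∧ (p.2 ∈ E.2.1.2 ∨ p.2 ∈ E.2.2) ∧
    fits E φ p = true ∧ φ' = p :: φ

theorem mem_independent {S : CoveredGraph} {u : ℕ} :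
    u ∈ independent S ↔ u ∈ S.1.2 ∧ u ∉ S.2 := by
  simp [independent, ← Bool.not_eq_true]

theorem isStep_of_mem_extendLeft {E : CoveredGraph × CoveredGraph} {u : ℕ}
    {φ φ' : List (ℕ × ℕ)} (hu : u ∈ E.1.2) (h : φ' ∈ extendLeft E u φ) : IsStep E φ φ' := by
  rcases List.mem_cons.1 h with h | h
  · exact .inl h
  · obtain ⟨v, hv, rfl⟩ := List.mem_map.1 h
    refine .inr ⟨(u, v), .inr hu, ?_⟩
    rcases List.mem_append.1 hv with hv | hv
    · obtain ⟨h1, h2⟩ := List.mem_filter.1 hv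
      exact ⟨.inr h1, h2, rfl⟩
    · obtain ⟨h1, h2⟩ := List.mem_filter.1 (dedupBy_subset _ _ hv)
      exact ⟨.inl (mem_independent.1 h1).1, h2, rfl⟩

theorem isStep_of_mem_extendRight {E : CoveredGraph × CoveredGraph} {v : ℕ}
    {φ φ' : List (ℕ × ℕ)} (hv : v ∈ E.2.2) (h : φ' ∈ extendRight E v φ) : IsStep E φ φ' := by
  rcases List.mem_cons.1 h with h | h
  · exact .inl h
  · obtain ⟨w, hw, rfl⟩ := List.mem_map.1 h
    obtain ⟨h1, h2⟩ := List.mem_filter.1 (List.mem_of_mem_take hw)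
    exact .inr ⟨(w, v), .inl (mem_independent.1 h1).1, .inr hv, h2, rfl⟩

theorem isStep_of_mem_extendIndependent {E : CoveredGraph × CoveredGraph} {w : ℕ}
    {φ φ' : List (ℕ × ℕ)} (hw : w ∈ independent E.1) (h : φ' ∈ extendIndependent E w φ) :
    IsStep E φ φ' := by
  rcases List.mem_append.1 (List.mem_of_mem_take h) with h | h
  · obtain ⟨v, hv, rfl⟩ := List.mem_map.1 h
    obtain ⟨h1, h2⟩ := List.mem_filter.1 hv
    exact .inr ⟨(w, v), .inl (mem_independent.1 hw).1, .inl (mem_independent.1 h1).1, h2, rfl⟩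
  · exact .inl (List.mem_singleton.1 h)

theorem IsStep.esize_le {E : CoveredGraph × CoveredGraph} {φ φ' : List (ℕ × ℕ)}
    (h : IsStep E φ φ') : esize φ' ≤ esize φ + (2 * X + 2 : ℕ[X]).eval (esize E) := by
  rcases h with rfl | ⟨⟨u, v⟩, hu, hv, -, rfl⟩
  · omega
  · have h1 : esize E = esize E.1.1.1 + esize E.1.1.2 + 1 + esize E.1.2 + 1 +
        (esize E.2.1.1 + esize E.2.1.2 + 1 + esize E.2.2 + 1) + 1 := rfl
    have h2 : esize u ≤ esize E := by
      rcases hu with h | h <;> have := esize_le_of_mem h <;> dsimp only at this <;> omega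
    have h3 : esize v ≤ esize E := by
      rcases hv with h | h <;> have := esize_le_of_mem h <;> dsimp only at this <;> omega
    simp only [esize_cons, esize_pair, eval_add, eval_mul, eval_X, eval_ofNat]
    omega

/-- There are at most `2 ^ |C|` classes of twins outside of the vertex cover `C`. -/
theorem length_dedupBy_twins_le (S : CoveredGraph) (l : List ℕ) :
    (dedupBy (twins S) l).length ≤ 2 ^ S.2.length := by
  have h : ((dedupBy (twins S) l).map
      fun v => fun i : Fin S.2.length => adj S.1.1 v (S.2.get i)).Nodup := by
    rw [List.nodup_iff_pairwise_ne, List.pairwise_map]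
    refine (dedupBy_pairwise _ _).imp fun {v w} hvw heq => ?_
    rw [← Bool.not_eq_true] at hvw
    refine hvw (List.all_eq_true.2 fun z hz => ?_)
    obtain ⟨i, rfl⟩ := List.get_of_mem hz
    simpa using congrFun heq i
  simpa using h.length_le_card

/-- An upper bound for the number of leaves of the search, where `a` and `b` are the sizes of the
vertex covers. -/
def leafBound (a b : ℕ) : ℕ := (1 + b + 2 ^ b) ^ a * 2 ^ b

theorem leafBound_mono {a b k : ℕ} (ha : a ≤ k) (hb : b ≤ k) :
    leafBound a b ≤ leafBound k k := by
  unfold leafBound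
  calc _ ≤ (1 + k + 2 ^ k) ^ a * 2 ^ k := by gcongr <;> norm_num
    _ ≤ _ := Nat.mul_le_mul_right _ (Nat.pow_le_pow_right (by positivity) ha)

/-- Since `1 + k + 2 ^ k ≤ 3 * k * 2 ^ k` for `k ≥ 1`, there is room to spare for the factor
`2 ^ k`. The case `k = 0` uses `0 ^ 0 = 1`. -/
theorem leafBound_self_le (k : ℕ) : leafBound k k ≤ (9 * k) ^ k * 2 ^ k ^ 2 := by
  rcases Nat.eq_zero_or_pos k with rfl | hk
  · norm_num [leafBound]
  have h1 : 1 ≤ 2 ^ k := Nat.one_le_two_pow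
  unfold leafBound
  rw [← mul_pow, sq, pow_mul 2 k k, ← mul_pow]
  refine Nat.pow_le_pow_left ?_ k
  have h2 := Nat.mul_le_mul hk h1
  have h3 := Nat.mul_le_mul_left k h1
  nlinarith

theorem two_pow_le_leafBound (a b : ℕ) : 2 ^ a ≤ leafBound a b ∧ 2 ^ b ≤ leafBound a b := by
  have h1 : 1 ≤ 2 ^ b := Nat.one_le_two_pow
  have h2 : 2 ^ a ≤ (1 + b + 2 ^ b) ^ a := Nat.pow_le_pow_left (by omega) a
  have h3 : 1 ≤ 2 ^ a := Nat.one_le_two_pow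
  unfold leafBound
  exact ⟨h2.trans (Nat.le_mul_of_pos_right _ h1), Nat.le_mul_of_pos_left _ (by omega)⟩

theorem length_extendLeft_le (E : CoveredGraph × CoveredGraph) (u : ℕ) (φ : List (ℕ × ℕ)) :
    (extendLeft E u φ).length ≤ 1 + E.2.2.length + 2 ^ E.2.2.length := by
  have h1 := length_dedupBy_twins_le E.2 ((independent E.2).filter fun v => fits E φ (u, v))
  have h2 := List.length_filter_le (fun v => fits E φ (u, v)) E.2.2
  simp only [extendLeft, List.length_cons, List.length_map, List.length_append]
  omega

theorem length_extendRight_le (E : CoveredGraph × CoveredGraph) (u : ℕ) (φ : List (ℕ × ℕ)) :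
    (extendRight E u φ).length ≤ 2 := by
  simp only [extendRight, List.length_cons, List.length_map, List.length_take]
  omega

theorem listable_leaves : Listable (fun E => leafBound E.1.2.length E.2.2.length) leaves := by
  have h1 : ∀ E : CoveredGraph × CoveredGraph, 1 ≤ leafBound E.1.2.length E.2.2.length :=
    fun E => Nat.one_le_two_pow.trans (two_pow_le_leafBound _ E.2.2.length).1
  have l1 (E : CoveredGraph × CoveredGraph) :
      (E.1.2.foldl (fun L u => L.flatMap (extendLeft E u)) [[]]).length ≤
        (1 + E.2.2.length + 2 ^ E.2.2.length) ^ E.1.2.length := by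
    simpa using length_foldl_flatMap_le (length_extendLeft_le E) E.1.2 [[]]
  have l2 (E : CoveredGraph × CoveredGraph) :
      (E.2.2.foldl (fun L v => L.flatMap (extendRight E v))
        (E.1.2.foldl (fun L u => L.flatMap (extendLeft E u)) [[]])).length ≤
        leafBound E.1.2.length E.2.2.length :=
    (length_foldl_flatMap_le (length_extendRight_le E) E.2.2 _).trans
      (Nat.mul_le_mul_right _ (l1 E))
  refine Listable.branch (m := fun _ => 1) (g := extendIndependent)
    (Listable.branch (m := fun _ => 2) (g := extendRight)
      (Listable.branch (m := fun E => 1 + E.2.2.length + 2 ^ E.2.2.length) (g := extendLeft)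
        ((Poly.const [[]]).feasible h1).listable (es := fun E => E.1.2) (by fun_prop)
        (by fun_prop) (2 * X + 2)
        (fun E u hu φ φ' h => (isStep_of_mem_extendLeft hu h).esize_le)
        (fun E => Nat.le_add_right_of_le (by omega)) length_extendLeft_le fun E => ?_)
      (es := fun E => E.2.2) (by fun_prop) (by fun_prop) (2 * X + 2)
      (fun E u hu φ φ' h => (isStep_of_mem_extendRight hu h).esize_le) (fun E => by omega)
      length_extendRight_le fun E => ?_)
    (es := fun E => independent E.1) (by fun_prop) (by fun_prop) (2 * X + 2)
    (fun E u hu φ φ' h => (isStep_of_mem_extendIndependent hu h).esize_le) (fun E => by omega)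
    (fun E w φ => by simp [extendIndependent]) fun E => ?_
  · simp only [List.length_singleton, one_mul, leafBound]
    exact Nat.le_mul_of_pos_right _ Nat.one_le_two_pow
  · exact Nat.mul_le_mul_right _ (l1 E)
  · rw [one_pow, mul_one]
    exact l2 E

/-- Two graphs, given by adjacency matrices and lists of the vertices in use, together with minimum
vertex covers. -/
def withCovers (x : (List (List Bool) × List ℕ) × (List (List Bool) × List ℕ)) :
    CoveredGraph × CoveredGraph :=
  ((x.1, minCover x.1), (x.2, minCover x.2))

/-- The time bound for two graphs that are given without vertex covers. -/
def coverBound (x : (List (List Bool) × List ℕ) × (List (List Bool) × List ℕ)) : ℕ :=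
  leafBound (minCover x.1).length (minCover x.2).length

theorem feasible_withCovers : Feasible coverBound withCovers := by
  have h1 : ∀ x, 1 ≤ coverBound x :=
    fun x => Nat.one_le_two_pow.trans (two_pow_le_leafBound (minCover x.1).length _).1
  exact ((Poly.fst'.feasible h1).pair (feasible_minCover.comp (Poly.fst'.feasible h1)
    fun x => (two_pow_le_leafBound _ _).1)).pair ((Poly.snd'.feasible h1).pair
      (feasible_minCover.comp (Poly.snd'.feasible h1) fun x => (two_pow_le_leafBound _ _).2))

theorem listable_leaves_withCovers : Listable coverBound (fun x => leaves (withCovers x)) :=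
  listable_leaves.comp feasible_withCovers fun _ => le_rfl

/-! ### Partial isomorphisms and exchange of twins -/

section Exchange

variable {V W : Type*} {G : SimpleGraph V} {H : SimpleGraph W}

/-- Two assignments that may belong to the same isomorphism between induced subgraphs. -/
def Compatible (G : SimpleGraph V) (H : SimpleGraph W) (p q : V × W) : Prop :=
  p.1 ≠ q.1 ∧ p.2 ≠ q.2 ∧ (G.Adj p.1 q.1 ↔ H.Adj p.2 q.2)

theorem Compatible.symm {p q : V × W} (h : Compatible G H p q) : Compatible G H q p :=
  ⟨h.1.symm, h.2.1.symm, by rw [G.adj_comm, H.adj_comm]; exact h.2.2⟩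

/-- An isomorphism between induced subgraphs, as a set of pairs. It uses only pairs from `A × B`,
and no pair from `I × J` can be added to it. -/
structure IsTarget (G : SimpleGraph V) (H : SimpleGraph W) (A I : Set V) (B J : Set W)
    (P : Set (V × W)) : Prop where
  pairwise : P.Pairwise (Compatible G H)
  subset : P ⊆ A ×ˢ B
  saturated : ∀ w ∈ I, ∀ v ∈ J, ¬ ∀ q ∈ P, Compatible G H (w, v) q

/-- `P'` arises from `P` by a permutation of the vertices that is an isomorphism between the
domains. -/
def Similar (G : SimpleGraph V) (P P' : Set (V × W)) : Prop :=
  ∃ σ : Equiv.Perm V, Prod.fst '' P' = σ '' (Prod.fst '' P) ∧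
    ∀ a ∈ Prod.fst '' P, ∀ b ∈ Prod.fst '' P, G.Adj (σ a) (σ b) ↔ G.Adj a b

theorem Similar.refl (P : Set (V × W)) : Similar G P P := ⟨1, by simp, by simp⟩

theorem Similar.trans {P P' P'' : Set (V × W)} (h : Similar G P P') (h' : Similar G P' P'') :
    Similar G P P'' := by
  obtain ⟨σ, h1, h2⟩ := h
  obtain ⟨τ, h3, h4⟩ := h'
  refine ⟨τ * σ, ?_, fun a ha b hb => ?_⟩
  · rw [h3, h1, ← Set.image_comp, Equiv.Perm.coe_mul]
  · rw [Equiv.Perm.mul_apply, Equiv.Perm.mul_apply, h4 _ (h1 ▸ Set.mem_image_of_mem σ ha) _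
      (h1 ▸ Set.mem_image_of_mem σ hb), h2 a ha b hb]

/-- Exchanging two vertices of an independent set preserves adjacency if they have the same
neighbours among the vertices of `D` that do not belong to the independent set. -/
theorem adj_swap_iff [DecidableEq V] {D I : Set V} {w w' : V} (hI : G.IsIndepSet I) (hw : w ∈ I)
    (hw' : w' ∈ I) (h : ∀ u ∈ D, u ∉ I → (G.Adj w u ↔ G.Adj w' u)) {a b : V} (ha : a ∈ D ∪ I)
    (hb : b ∈ D ∪ I) : G.Adj (Equiv.swap w w' a) (Equiv.swap w w' b) ↔ G.Adj a b := by
  have hI' : ∀ {a b}, a ∈ I → b ∈ I → ¬ G.Adj a b := fun {a b} ha hb hab =>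
    hI ha hb hab.ne hab
  have hmem : ∀ {a}, a ∈ I → Equiv.swap w w' a ∈ I := fun {a} ha => by
    rw [Equiv.swap_apply_def]
    split_ifs <;> assumption
  have hfix : ∀ {a}, a ∉ I → Equiv.swap w w' a = a := fun {a} ha =>
    Equiv.swap_apply_of_ne_of_ne (fun h => ha (h ▸ hw)) (fun h => ha (h ▸ hw'))
  have hadj : ∀ {a u}, a ∈ I → u ∈ D ∪ I → u ∉ I →
      (G.Adj (Equiv.swap w w' a) u ↔ G.Adj a u) := fun {a u} ha hu hu' => by
    have := h u (hu.resolve_right hu') hu'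
    rw [Equiv.swap_apply_def]
    split_ifs with h1 h2
    · rw [h1, this]
    · rw [h2, this]
    · rfl
  by_cases ha' : a ∈ I <;> by_cases hb' : b ∈ I
  · exact iff_of_false (hI' (hmem ha') (hmem hb')) (hI' ha' hb')
  · rw [hfix hb', hadj ha' hb hb']
  · rw [hfix ha', G.adj_comm, hadj hb' ha ha', G.adj_comm]
  · rw [hfix ha', hfix hb']

theorem isTarget_image {A I : Set V} {B J : Set W} {P : Set (V × W)} (hP : IsTarget G H A I B J P)
    {σ : Equiv.Perm V} {τ : Equiv.Perm W}
    (hσ : ∀ a ∈ Prod.fst '' P ∪ I, ∀ b ∈ Prod.fst '' P ∪ I, G.Adj (σ a) (σ b) ↔ G.Adj a b)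
    (hτ : ∀ a ∈ Prod.snd '' P ∪ J, ∀ b ∈ Prod.snd '' P ∪ J, H.Adj (τ a) (τ b) ↔ H.Adj a b)
    (hσA : ∀ a ∈ A, σ a ∈ A) (hτB : ∀ b ∈ B, τ b ∈ B)
    (hσI : ∀ a ∈ I, σ.symm a ∈ I) (hτJ : ∀ b ∈ J, τ.symm b ∈ J) :
    IsTarget G H A I B J (Prod.map σ τ '' P) := by
  have key : ∀ p : V × W, p.1 ∈ Prod.fst '' P ∪ I → p.2 ∈ Prod.snd '' P ∪ J → ∀ q ∈ P,
      (Compatible G H (Prod.map σ τ p) (Prod.map σ τ q) ↔ Compatible G H p q) := by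
    intro p hp1 hp2 q hq
    unfold Compatible
    rw [Prod.map_fst, Prod.map_fst, Prod.map_snd, Prod.map_snd, σ.injective.ne_iff,
      τ.injective.ne_iff, hσ _ hp1 _ (.inl (Set.mem_image_of_mem _ hq)),
      hτ _ hp2 _ (.inl (Set.mem_image_of_mem _ hq))]
  refine ⟨?_, ?_, ?_⟩
  · rintro _ ⟨p, hp, rfl⟩ _ ⟨q, hq, rfl⟩ hpq
    exact (key p (.inl (Set.mem_image_of_mem _ hp)) (.inl (Set.mem_image_of_mem _ hp)) q hq).2
      (hP.pairwise hp hq fun h => hpq (h ▸ rfl))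
  · rintro _ ⟨p, hp, rfl⟩
    exact ⟨hσA _ (hP.subset hp).1, hτB _ (hP.subset hp).2⟩
  · intro w hw v hv h
    refine hP.saturated _ (hσI w hw) _ (hτJ v hv) fun q hq => ?_
    rw [← key (σ.symm w, τ.symm v) (.inr (hσI w hw)) (.inr (hτJ v hv)) q hq]
    simpa using h _ (Set.mem_image_of_mem _ hq)

/-- The state of the search: the partial isomorphism `φ` is part of the target `P`, and it contains
all pairs of the target that involve a vertex on which a decision has been made. -/
structure IsPartOf (φ : List (V × W)) (D : Set V) (R : Set W) (P : Set (V × W)) : Prop where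
  subset : ∀ q ∈ φ, q ∈ P
  left : ∀ q ∈ P, q.1 ∈ D → q ∈ φ
  right : ∀ q ∈ P, q.2 ∈ R → q ∈ φ

variable {A I : Set V} {B J : Set W} {P : Set (V × W)} {φ : List (V × W)} {D : Set V} {R : Set W}

theorem IsPartOf.mono {D' : Set V} {R' : Set W} (h : IsPartOf φ D R P) (hD : D' ⊆ D)
    (hR : R' ⊆ R) : IsPartOf φ D' R' P :=
  ⟨h.subset, fun q hq hq' => h.left q hq (hD hq'), fun q hq hq' => h.right q hq (hR hq')⟩

theorem IsTarget.eq_of_fst_eq (hP : IsTarget G H A I B J P) {p q : V × W} (hp : p ∈ P)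
    (hq : q ∈ P) (h : p.1 = q.1) : p = q := by
  by_contra hpq
  exact (hP.pairwise hp hq hpq).1 h

theorem IsTarget.eq_of_snd_eq (hP : IsTarget G H A I B J P) {p q : V × W} (hp : p ∈ P)
    (hq : q ∈ P) (h : p.2 = q.2) : p = q := by
  by_contra hpq
  exact (hP.pairwise hp hq hpq).2.1 h

/-- The pair `(w, v)` of the target is chosen next. -/
theorem IsPartOf.cons (hP : IsTarget G H A I B J P) (h : IsPartOf φ D R P) {w : V} {v : W}
    (hwv : (w, v) ∈ P) : IsPartOf ((w, v) :: φ) (insert w D) (insert v R) P := by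
  refine ⟨List.forall_mem_cons.2 ⟨hwv, h.subset⟩, ?_, ?_⟩
  · rintro q hq (h1 | h1)
    · exact List.mem_cons.2 (.inl (hP.eq_of_fst_eq hq hwv h1))
    · exact List.mem_cons_of_mem _ (h.left q hq h1)
  · rintro q hq (h1 | h1)
    · exact List.mem_cons.2 (.inl (hP.eq_of_snd_eq hq hwv h1))
    · exact List.mem_cons_of_mem _ (h.right q hq h1)

/-- If the target contains `(w, v)`, then the search may choose `(w', v)` instead for a vertex `w'`
that looks the same: the exchange of `w` and `w'` turns the target into a similar one. -/
theorem IsPartOf.exchange_left (hP : IsTarget G H A I B J P) (h : IsPartOf φ D R P)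
    (hI : G.IsIndepSet I) (hIA : I ⊆ A) {w w' : V} {v : W} (hwv : (w, v) ∈ P) (hwvφ : (w, v) ∉ φ)
    (hw : w ∈ I) (hw' : w' ∈ I) (hw'φ : ∀ q ∈ φ, q.1 ≠ w')
    (hadj : ∀ q ∈ P, q.1 ∉ I → (G.Adj w q.1 ↔ G.Adj w' q.1)) :
    ∃ P', IsTarget G H A I B J P' ∧ (Similar G P P' ∧ Prod.snd '' P' = Prod.snd '' P) ∧
      IsPartOf ((w', v) :: φ) (insert w' D) (insert v R) P' := by
  classical
  let σ := Equiv.swap w w'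
  have hσ : ∀ a ∈ Prod.fst '' P ∪ I, ∀ b ∈ Prod.fst '' P ∪ I,
      G.Adj (σ a) (σ b) ↔ G.Adj a b := fun a ha b hb =>
    adj_swap_iff hI hw hw' (by rintro _ ⟨q, hq, rfl⟩; exact hadj q hq) ha hb
  have hmem : ∀ {S : Set V}, w ∈ S → w' ∈ S → ∀ a ∈ S, σ a ∈ S := by
    intro S h1 h2 a ha
    simp only [σ, Equiv.swap_apply_def]
    split_ifs <;> assumption
  have hfix : ∀ q ∈ φ, Prod.map σ (1 : Equiv.Perm W) q = q := by
    intro q hq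
    have h1 : q.1 ≠ w := fun h1 =>
      hwvφ (hP.eq_of_fst_eq (h.subset q hq) hwv h1 ▸ hq)
    exact Prod.ext (Equiv.swap_apply_of_ne_of_ne h1 (hw'φ q hq)) rfl
  have hP' := isTarget_image hP (τ := 1) hσ (fun _ _ _ _ => Iff.rfl)
    (hmem (hIA hw) (hIA hw')) (fun _ h => h)
    (by rw [Equiv.symm_swap]; exact hmem hw hw') (fun _ h => h)
  have hnew : (w', v) ∈ Prod.map σ (1 : Equiv.Perm W) '' P := ⟨(w, v), hwv, by simp [σ]⟩
  refine ⟨_, hP', ⟨⟨σ, ?_, fun a ha b hb => hσ a (.inl ha) b (.inl hb)⟩, ?_⟩, ?_⟩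
  · simp only [← Set.image_comp]
    rfl
  · simp only [← Set.image_comp]
    rfl
  · -- A pair of the new target is in the new list, or both of its vertices are undecided.
    have hcase : ∀ q ∈ Prod.map σ (1 : Equiv.Perm W) '' P, q ∈ (w', v) :: φ ∨
        q.1 ∉ insert w' D ∧ q.2 ∉ insert v R := by
      rintro _ ⟨q, hq, rfl⟩
      by_cases hqφ : q ∈ φ
      · exact .inl (List.mem_cons_of_mem _ (by rwa [hfix q hqφ]))
      by_cases hqv : q.2 = v
      · obtain rfl := hP.eq_of_snd_eq hq hwv hqv
        exact .inl (List.mem_cons.2 (.inl (by simp [σ])))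
      refine .inr ⟨?_, ?_⟩
      · have hqw : q.1 ≠ w := fun h1 => hqv (by rw [hP.eq_of_fst_eq hq hwv h1])
        rintro (h1 | h1)
        · exact hqw (by simpa [σ, Equiv.swap_apply_eq_iff] using h1)
        · by_cases hqw' : q.1 = w'
          · rw [Prod.map_fst, hqw', Equiv.swap_apply_right] at h1
            exact hwvφ (h.left _ hwv h1)
          · rw [Prod.map_fst, Equiv.swap_apply_of_ne_of_ne hqw hqw'] at h1
            exact hqφ (h.left q hq h1)
      · rintro (h1 | h1)
        · exact hqv h1
        · exact hqφ (h.right q hq h1)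
    refine ⟨List.forall_mem_cons.2 ⟨hnew, fun q hq => ⟨q, h.subset q hq, hfix q hq⟩⟩, ?_, ?_⟩
    · exact fun q hq h1 => (hcase q hq).resolve_right fun h2 => h2.1 h1
    · exact fun q hq h1 => (hcase q hq).resolve_right fun h2 => h2.2 h1

theorem Compatible.swap {p q : V × W} (h : Compatible G H p q) : Compatible H G p.swap q.swap :=
  ⟨h.2.1, h.1, h.2.2.symm⟩

theorem IsTarget.swap (hP : IsTarget G H A I B J P) :
    IsTarget H G B J A I (Prod.swap '' P) := by
  refine ⟨?_, ?_, ?_⟩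
  · rintro _ ⟨p, hp, rfl⟩ _ ⟨q, hq, rfl⟩ hpq
    exact (hP.pairwise hp hq fun h => hpq (h ▸ rfl)).swap
  · rintro _ ⟨p, hp, rfl⟩
    exact ⟨(hP.subset hp).2, (hP.subset hp).1⟩
  · exact fun w hw v hv h => hP.saturated v hv w hw fun q hq =>
      (h _ (Set.mem_image_of_mem _ hq)).swap

/-- The exchange for vertices of the second graph. The domain of the target stays the same. -/
theorem IsPartOf.exchange_right (hP : IsTarget G H A I B J P) (h : IsPartOf φ D R P)
    (hJ : H.IsIndepSet J) (hJB : J ⊆ B) {w : V} {v v' : W} (hwv : (w, v) ∈ P) (hwvφ : (w, v) ∉ φ)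
    (hv : v ∈ J) (hv' : v' ∈ J) (hv'φ : ∀ q ∈ φ, q.2 ≠ v')
    (hadj : ∀ q ∈ P, q.2 ∉ J → (H.Adj v q.2 ↔ H.Adj v' q.2)) :
    ∃ P', IsTarget G H A I B J P' ∧ Similar G P P' ∧
      IsPartOf ((w, v') :: φ) (insert w D) (insert v' R) P' := by
  have hsw : ∀ {q : W × V} {ψ : List (V × W)}, q ∈ ψ.map Prod.swap ↔ q.swap ∈ ψ := fun {q ψ} =>
    ⟨fun h => by obtain ⟨p, hp, rfl⟩ := List.mem_map.1 h; rwa [Prod.swap_swap],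
      fun h => List.mem_map.2 ⟨q.swap, h, Prod.swap_swap q⟩⟩
  have hsw' : ∀ {q : W × V} {S : Set (V × W)}, q ∈ Prod.swap '' S ↔ q.swap ∈ S := fun {q S} => by
    rw [Set.image_swap_eq_preimage_swap, Set.mem_preimage]
  obtain ⟨P', h1, ⟨-, h2⟩, h3⟩ := IsPartOf.exchange_left (φ := φ.map Prod.swap) (D := R) (R := D)
    (w := v) (w' := v') (v := w) hP.swap
    ⟨fun q hq => hsw'.2 (h.subset _ (hsw.1 hq)),
      fun q hq hqR => hsw.2 (h.right _ (hsw'.1 hq) hqR),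
      fun q hq hqD => hsw.2 (h.left _ (hsw'.1 hq) hqD)⟩
    hJ hJB (hsw'.2 hwv) (fun h => hwvφ (hsw.1 h)) hv hv' (fun q hq => hv'φ _ (hsw.1 hq))
    (fun q hq => hadj _ (hsw'.1 hq))
  have hsw'' : ∀ {q : V × W}, q ∈ Prod.swap '' P' ↔ q.swap ∈ P' := fun {q} => by
    rw [Set.image_swap_eq_preimage_swap, Set.mem_preimage]
  have hcons : ∀ {q : W × V}, q ∈ (v', w) :: φ.map Prod.swap ↔ q.swap ∈ (w, v') :: φ :=
    fun {q} => hsw (ψ := (w, v') :: φ)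
  refine ⟨Prod.swap '' P', h1.swap, ⟨1, ?_, by simp⟩, fun q hq => ?_, fun q hq hqD => ?_,
    fun q hq hqR => ?_⟩
  · have h4 : Prod.fst '' (Prod.swap '' P') = Prod.snd '' P' := by
      rw [← Set.image_comp]; rfl
    have h5 : Prod.snd '' (Prod.swap '' P) = Prod.fst '' P := by
      rw [← Set.image_comp]; rfl
    rw [h4, h2, h5]
    simp
  · exact hsw''.2 (h3.subset _ (hcons.2 hq))
  · exact hcons.1 (h3.right _ (hsw''.1 hq) hqD)
  · exact hcons.1 (h3.left _ (hsw''.1 hq) hqR)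

end Exchange

/-! ### Correctness of the search -/

section Correctness

theorem foldl_flatMap_induction {β γ : Type*} {g : β → γ → List γ} {motive : γ → Prop} (l : List β)
    {L : List γ} (hL : ∀ s ∈ L, motive s)
    (hg : ∀ e ∈ l, ∀ s, motive s → ∀ s' ∈ g e s, motive s') :
    ∀ s ∈ l.foldl (fun L e => L.flatMap (g e)) L, motive s := by
  induction l generalizing L with
  | nil => exact hL
  | cons e l ih =>
    refine ih (fun s hs => ?_) fun e he => hg e (List.mem_cons_of_mem _ he)
    obtain ⟨s', hs', hs⟩ := List.mem_flatMap.1 hs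
    exact hg e List.mem_cons_self s' (hL s' hs') s hs

theorem exists_mem_foldl_flatMap {β γ : Type*} {g : β → γ → List γ} {motive : List β → γ → Prop}
    (l : List β) {L : List γ} (hL : ∃ s ∈ L, motive [] s)
    (hg : ∀ l', ∀ e ∈ l, ∀ s, motive l' s → ∃ s' ∈ g e s, motive (l' ++ [e]) s') :
    ∃ s ∈ l.foldl (fun L e => L.flatMap (g e)) L, motive l s := by
  induction l using List.reverseRecOn with
  | nil => exact hL
  | append_singleton l e ih =>
    obtain ⟨s, hs, hm⟩ := ih fun l' e he => hg l' e (List.mem_append_left _ he)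
    obtain ⟨s', hs', hm'⟩ := hg l e (by simp) s hm
    refine ⟨s', ?_, hm'⟩
    rw [List.foldl_append]
    exact List.mem_flatMap.2 ⟨s, hs, hs'⟩

/-- The graphs `G` and `H` have the adjacency matrices in `E`, and the lists of cover vertices in
`E` are vertex covers of the subgraphs induced by the vertices in use. -/
structure Represents (E : CoveredGraph × CoveredGraph) (G H : SimpleGraph ℕ) : Prop where
  adj_left : ∀ u v, adj E.1.1.1 u v = true ↔ G.Adj u v
  adj_right : ∀ u v, adj E.2.1.1 u v = true ↔ H.Adj u v
  cover_left : isCover E.1.1 E.1.2 = true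
  cover_right : isCover E.2.1 E.2.2 = true
  subset_left : E.1.2 ⊆ E.1.1.2
  subset_right : E.2.2 ⊆ E.2.1.2

variable {E : CoveredGraph × CoveredGraph} {G H : SimpleGraph ℕ}

theorem Represents.fits_iff (h : Represents E G H) {φ : List (ℕ × ℕ)} {p : ℕ × ℕ} :
    fits E φ p = true ↔ ∀ q ∈ φ, Compatible G H p q := by
  unfold fits
  rw [List.all_eq_true]
  refine forall₂_congr fun q _ => ?_
  rw [compatible, Compatible, ← h.adj_left, ← h.adj_right, ← Bool.eq_iff_iff]
  simp

theorem Represents.isIndepSet_left (h : Represents E G H) :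
    G.IsIndepSet {u | u ∈ independent E.1} := by
  intro u hu v hv _ huv
  rw [Set.mem_ofPred_eq, mem_independent] at hu hv
  rcases isCover_iff.1 h.cover_left u hu.1 v hv.1 ((h.adj_left u v).2 huv) with h | h
  · exact hu.2 h
  · exact hv.2 h

theorem Represents.isIndepSet_right (h : Represents E G H) :
    H.IsIndepSet {u | u ∈ independent E.2} := by
  intro u hu v hv _ huv
  rw [Set.mem_ofPred_eq, mem_independent] at hu hv
  rcases isCover_iff.1 h.cover_right u hu.1 v hv.1 ((h.adj_right u v).2 huv) with h | h
  · exact hu.2 h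
  · exact hv.2 h

/-- The results of the search are isomorphisms between induced subgraphs. -/
theorem Represents.pairwise_of_mem_leaves (h : Represents E G H) {φ : List (ℕ × ℕ)}
    (hφ : φ ∈ leaves E) :
    φ.Pairwise (Compatible G H) ∧ ∀ p ∈ φ, p.1 ∈ E.1.1.2 ∧ p.2 ∈ E.2.1.2 := by
  have hstep : ∀ φ φ' : List (ℕ × ℕ), IsStep E φ φ' →
      (φ.Pairwise (Compatible G H) ∧ ∀ p ∈ φ, p.1 ∈ E.1.1.2 ∧ p.2 ∈ E.2.1.2) →
      φ'.Pairwise (Compatible G H) ∧ ∀ p ∈ φ', p.1 ∈ E.1.1.2 ∧ p.2 ∈ E.2.1.2 := by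
    rintro φ φ' (rfl | ⟨p, hp1, hp2, hfit, rfl⟩) hφ
    · exact hφ
    · exact ⟨List.pairwise_cons.2 ⟨h.fits_iff.1 hfit, hφ.1⟩, List.forall_mem_cons.2
        ⟨⟨hp1.elim id fun h' => h.subset_left h', hp2.elim id fun h' => h.subset_right h'⟩, hφ.2⟩⟩
  refine foldl_flatMap_induction (motive := fun φ => φ.Pairwise (Compatible G H) ∧
    ∀ p ∈ φ, p.1 ∈ E.1.1.2 ∧ p.2 ∈ E.2.1.2) _ (foldl_flatMap_induction _
      (foldl_flatMap_induction _ ?_ ?_) ?_) ?_ φ hφ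
  · simp
  · exact fun u hu φ hφ φ' hφ' => hstep φ φ' (isStep_of_mem_extendLeft hu hφ') hφ
  · exact fun u hu φ hφ φ' hφ' => hstep φ φ' (isStep_of_mem_extendRight hu hφ') hφ
  · exact fun u hu φ hφ φ' hφ' => hstep φ φ' (isStep_of_mem_extendIndependent hu hφ') hφ

/-- The targets of the search, with the vertex lists of `E`. -/
abbrev Target (E : CoveredGraph × CoveredGraph) (G H : SimpleGraph ℕ) (P : Set (ℕ × ℕ)) : Prop :=
  IsTarget G H {u | u ∈ E.1.1.2} {u | u ∈ independent E.1} {v | v ∈ E.2.1.2}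
    {v | v ∈ independent E.2} P

variable {P : Set (ℕ × ℕ)} {φ : List (ℕ × ℕ)} {D R : Set ℕ}

theorem independent_subset {S : CoveredGraph} :
    {u | u ∈ independent S} ⊆ {u | u ∈ S.1.2} := fun _ hu => (mem_independent.1 hu).1

theorem Represents.fits_of_mem (h : Represents E G H) (hP : Target E G H P)
    (hφ : IsPartOf φ D R P) {p : ℕ × ℕ} (hp : p ∈ P) (hpφ : p ∉ φ) : fits E φ p = true :=
  h.fits_iff.2 fun q hq => hP.pairwise hp (hφ.subset q hq) fun hpq => hpφ (hpq ▸ hq)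

/-- If the target maps the cover vertex `u` to a vertex outside of the second cover, the
representative of its class of twins will do as well. -/
theorem extendLeft_spec (h : Represents E G H) (hP : Target E G H P) (hφ : IsPartOf φ D R P)
    {u : ℕ} : ∃ φ' ∈ extendLeft E u φ, ∃ P', Target E G H P' ∧ Similar G P P' ∧
      IsPartOf φ' (insert u D) R P' := by
  by_cases hu : ∃ v, (u, v) ∈ P ∧ (u, v) ∉ φ
  · obtain ⟨v, hv, hvφ⟩ := hu
    have hfit := h.fits_of_mem hP hφ hv hvφ
    have hvB := (hP.subset hv).2
    by_cases hvC : v ∈ E.2.2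
    · refine ⟨(u, v) :: φ, ?_, P, hP, .refl P, (hφ.cons hP hv).mono subset_rfl
        (Set.subset_insert _ _)⟩
      exact List.mem_cons_of_mem _ (List.mem_map.2 ⟨v, List.mem_append_left _
        (List.mem_filter.2 ⟨hvC, hfit⟩), rfl⟩)
    · have hvJ : v ∈ independent E.2 := mem_independent.2 ⟨hvB, hvC⟩
      obtain ⟨v', hv', htw⟩ := exists_mem_dedupBy (r := twins E.2)
        (by simp [twins])
        (List.mem_filter.2 ⟨hvJ, hfit⟩ : v ∈ (independent E.2).filter fun v => fits E φ (u, v))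
      obtain ⟨hv'J, hv'fit⟩ := List.mem_filter.1 (dedupBy_subset _ _ hv')
      obtain ⟨P', h1, h2, h3⟩ := hφ.exchange_right hP h.isIndepSet_right independent_subset hv hvφ
        hvJ hv'J (fun q hq => (h.fits_iff.1 hv'fit q hq).2.1.symm) (by
          intro q hq hqJ
          have hqC : q.2 ∈ E.2.2 := by
            by_contra hqC
            exact hqJ (mem_independent.2 ⟨(hP.subset hq).2, hqC⟩)
          have := List.all_eq_true.1 htw q.2 hqC
          rw [← h.adj_right, ← h.adj_right, beq_iff_eq.1 this])
      refine ⟨(u, v') :: φ, ?_, P', h1, h2, h3.mono subset_rfl (Set.subset_insert _ _)⟩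
      exact List.mem_cons_of_mem _ (List.mem_map.2 ⟨v', List.mem_append_right _ hv', rfl⟩)
  · push Not at hu
    refine ⟨φ, List.mem_cons_self, P, hP, .refl P, hφ.subset, ?_, hφ.right⟩
    rintro q hq (rfl | hqD)
    · exact hu q.2 hq
    · exact hφ.left q hq hqD

/-- Two vertices that can be mapped to the same vertex have the same neighbours among the vertices
that have been mapped. -/
theorem Represents.adj_left_iff (h : Represents E G H) (hP : Target E G H P)
    (hφ : IsPartOf φ D R P) {w w' v : ℕ} (hwv : (w, v) ∈ P) (hwvφ : (w, v) ∉ φ)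
    (hw' : fits E φ (w', v) = true) {q : ℕ × ℕ} (hq : q ∈ φ) : G.Adj w q.1 ↔ G.Adj w' q.1 :=
  (h.fits_iff.1 (h.fits_of_mem hP hφ hwv hwvφ) q hq).2.2.trans (h.fits_iff.1 hw' q hq).2.2.symm

theorem Represents.adj_right_iff (h : Represents E G H) (hP : Target E G H P)
    (hφ : IsPartOf φ D R P) {w v v' : ℕ} (hwv : (w, v) ∈ P) (hwvφ : (w, v) ∉ φ)
    (hv' : fits E φ (w, v') = true) {q : ℕ × ℕ} (hq : q ∈ φ) : H.Adj v q.2 ↔ H.Adj v' q.2 :=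
  (h.fits_iff.1 (h.fits_of_mem hP hφ hwv hwvφ) q hq).2.2.symm.trans (h.fits_iff.1 hv' q hq).2.2

theorem mem_cover_of_notMem_independent {S : CoveredGraph} {u : ℕ} (hu : u ∈ S.1.2)
    (hu' : u ∉ independent S) : u ∈ S.2 := by
  by_contra h
  exact hu' (mem_independent.2 ⟨hu, h⟩)

/-- If the target uses the cover vertex `v` of the second graph, then any preimage that fits will
do: what remains to be mapped to it lies outside of the first cover, and all vertices there that fit
have the same neighbours in the part of the first cover that the target uses. -/
theorem extendRight_spec (h : Represents E G H) (hP : Target E G H P) (hφ : IsPartOf φ D R P)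
    (hD : {u | u ∈ E.1.2} ⊆ D) {v : ℕ} :
    ∃ φ' ∈ extendRight E v φ, ∃ P', Target E G H P' ∧ Similar G P P' ∧
      IsPartOf φ' D (insert v R) P' := by
  by_cases hv : ∃ w, (w, v) ∈ P ∧ (w, v) ∉ φ
  · obtain ⟨w, hw, hwφ⟩ := hv
    have hfit := h.fits_of_mem hP hφ hw hwφ
    have hwI : w ∈ independent E.1 := mem_independent.2
      ⟨(hP.subset hw).1, fun hwC => hwφ (hφ.left _ hw (hD hwC))⟩
    have hmem : w ∈ (independent E.1).filter fun w => fits E φ (w, v) :=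
      List.mem_filter.2 ⟨hwI, hfit⟩
    obtain ⟨w', l, hl⟩ := List.exists_cons_of_ne_nil (List.ne_nil_of_mem hmem)
    obtain ⟨hw'I, hw'fit⟩ := List.mem_filter.1
      (hl ▸ List.mem_cons_self : w' ∈ (independent E.1).filter fun w => fits E φ (w, v))
    obtain ⟨P', h1, ⟨h2, -⟩, h3⟩ := hφ.exchange_left hP h.isIndepSet_left independent_subset hw hwφ
      hwI hw'I (fun q hq => (h.fits_iff.1 hw'fit q hq).1.symm) fun q hq hqI =>
        h.adj_left_iff hP hφ hw hwφ hw'fit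
          (hφ.left q hq (hD (mem_cover_of_notMem_independent (hP.subset hq).1 hqI)))
    exact ⟨(w', v) :: φ, by simp [extendRight, hl], P', h1, h2,
      h3.mono (Set.subset_insert _ _) subset_rfl⟩
  · push Not at hv
    refine ⟨φ, List.mem_cons_self, P, hP, .refl P, hφ.subset, hφ.left, ?_⟩
    rintro q hq (rfl | hqR)
    · exact hv q.1 hq
    · exact hφ.right q hq hqR

/-- When both covers have been dealt with, the remaining vertices can be mapped greedily: a target
that does not use `w` uses the vertex `v'` that the greedy choice assigns to `w`, by saturation, and
the preimage of `v'` can be exchanged with `w`. -/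
theorem extendIndependent_spec (h : Represents E G H) (hP : Target E G H P)
    (hφ : IsPartOf φ D R P) (hD : {u | u ∈ E.1.2} ⊆ D) (hR : {v | v ∈ E.2.2} ⊆ R) {w : ℕ}
    (hw : w ∈ independent E.1) :
    ∃ φ' ∈ extendIndependent E w φ, ∃ P', Target E G H P' ∧ Similar G P P' ∧
      IsPartOf φ' (insert w D) R P' := by
  have hI : ∀ q ∈ P, q ∉ φ → q.1 ∈ independent E.1 := fun q hq hqφ =>
    mem_independent.2 ⟨(hP.subset hq).1, fun hqC => hqφ (hφ.left q hq (hD hqC))⟩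
  have hJ : ∀ q ∈ P, q ∉ φ → q.2 ∈ independent E.2 := fun q hq hqφ =>
    mem_independent.2 ⟨(hP.subset hq).2, fun hqC => hqφ (hφ.right q hq (hR hqC))⟩
  rcases hl : (independent E.2).filter fun v => fits E φ (w, v) with _ | ⟨v', l⟩
  · refine ⟨φ, by simp [extendIndependent, hl], P, hP, .refl P, hφ.subset, ?_, hφ.right⟩
    rintro q hq (rfl | hqD)
    · by_contra hqφ
      have : q.2 ∈ (independent E.2).filter fun v => fits E φ (q.1, v) :=
        List.mem_filter.2 ⟨hJ q hq hqφ, h.fits_of_mem hP hφ hq hqφ⟩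
      rw [hl] at this
      simp at this
    · exact hφ.left q hq hqD
  · obtain ⟨hv'J, hv'fit⟩ := List.mem_filter.1
      (hl ▸ List.mem_cons_self : v' ∈ (independent E.2).filter fun v => fits E φ (w, v))
    have hfit := h.fits_iff.1 hv'fit
    refine ⟨(w, v') :: φ, by simp [extendIndependent, hl], ?_⟩
    by_cases hwP : ∃ v, (w, v) ∈ P
    · obtain ⟨v, hv⟩ := hwP
      have hvφ : (w, v) ∉ φ := fun hvφ => (hfit _ hvφ).1 rfl
      obtain ⟨P', h1, h2, h3⟩ := hφ.exchange_right hP h.isIndepSet_right independent_subset hv hvφ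
        (hJ _ hv hvφ) hv'J (fun q hq => (hfit q hq).2.1.symm) fun q hq hqJ =>
          h.adj_right_iff hP hφ hv hvφ hv'fit
            (hφ.right q hq (hR (mem_cover_of_notMem_independent (hP.subset hq).2 hqJ)))
      exact ⟨P', h1, h2, h3.mono subset_rfl (Set.subset_insert _ _)⟩
    · push Not at hwP
      -- The target is saturated, so it uses `v'` if it does not use `w`.
      obtain ⟨x, hx⟩ : ∃ x, (x, v') ∈ P := by
        by_contra! hv'P
        refine hP.saturated w hw v' hv'J fun q hq => ?_
        by_cases hqφ : q ∈ φ
        · exact hfit q hqφ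
        have hqw : w ≠ q.1 := by
          rintro rfl
          exact hwP q.2 hq
        have hqv : v' ≠ q.2 := by
          rintro rfl
          exact hv'P q.1 hq
        exact ⟨hqw, hqv, iff_of_false (h.isIndepSet_left hw (hI q hq hqφ) hqw)
          (h.isIndepSet_right hv'J (hJ q hq hqφ) hqv)⟩
      have hxφ : (x, v') ∉ φ := fun hxφ => (hfit _ hxφ).2.1 rfl
      obtain ⟨P', h1, ⟨h2, -⟩, h3⟩ := hφ.exchange_left hP h.isIndepSet_left independent_subset hx
        hxφ (hI _ hx hxφ) hw (fun q hq => (hfit q hq).1.symm) fun q hq hqI =>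
          h.adj_left_iff hP hφ hx hxφ hv'fit
            (hφ.left q hq (hD (mem_cover_of_notMem_independent (hP.subset hq).1 hqI)))
      exact ⟨P', h1, h2, h3.mono subset_rfl (Set.subset_insert _ _)⟩

/-- The search finds every target, up to a permutation of the vertices. -/
theorem Represents.exists_mem_leaves (h : Represents E G H) (hP : Target E G H P) :
    ∃ φ ∈ leaves E, Similar G P {q | q ∈ φ} := by
  let motive (D R : Set ℕ) (φ : List (ℕ × ℕ)) : Prop :=
    ∃ P', Target E G H P' ∧ Similar G P P' ∧ IsPartOf φ D R P'
  have h1 : ∃ φ ∈ E.1.2.foldl (fun L u => L.flatMap (extendLeft E u)) [[]],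
      motive {u | u ∈ E.1.2} ∅ φ := by
    refine exists_mem_foldl_flatMap (motive := fun l => motive {u | u ∈ l} ∅) _
      ⟨[], by simp, P, hP, .refl P, by simp, by simp, by simp⟩ ?_
    rintro l u hu φ ⟨P', hP', hPP', hφ⟩
    obtain ⟨φ', hφ', P'', h1, h2, h3⟩ := extendLeft_spec h hP' hφ (u := u)
    refine ⟨φ', hφ', P'', h1, hPP'.trans h2, h3.mono ?_ subset_rfl⟩
    intro a ha
    simpa [or_comm] using ha
  have h2 : ∃ φ ∈ E.2.2.foldl (fun L v => L.flatMap (extendRight E v))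
      (E.1.2.foldl (fun L u => L.flatMap (extendLeft E u)) [[]]),
      motive {u | u ∈ E.1.2} {v | v ∈ E.2.2} φ := by
    refine exists_mem_foldl_flatMap (motive := fun l => motive {u | u ∈ E.1.2} {v | v ∈ l}) _
      (by simpa using h1) ?_
    rintro l v hv φ ⟨P', hP', hPP', hφ⟩
    obtain ⟨φ', hφ', P'', h1, h2, h3⟩ := extendRight_spec h hP' hφ subset_rfl (v := v)
    refine ⟨φ', hφ', P'', h1, hPP'.trans h2, h3.mono subset_rfl ?_⟩
    intro a ha
    simpa [or_comm] using ha
  have h3 : ∃ φ ∈ leaves E,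
      motive ({u | u ∈ E.1.2} ∪ {u | u ∈ independent E.1}) {v | v ∈ E.2.2} φ := by
    refine exists_mem_foldl_flatMap
      (motive := fun l => motive ({u | u ∈ E.1.2} ∪ {u | u ∈ l}) {v | v ∈ E.2.2}) _
      (by simpa using h2) ?_
    rintro l w hw φ ⟨P', hP', hPP', hφ⟩
    obtain ⟨φ', hφ', P'', h1, h2, h3⟩ :=
      extendIndependent_spec h hP' hφ Set.subset_union_left subset_rfl hw
    refine ⟨φ', hφ', P'', h1, hPP'.trans h2, h3.mono ?_ subset_rfl⟩
    intro a ha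
    simp only [Set.mem_union, Set.mem_ofPred_eq, List.mem_append, List.mem_singleton,
      Set.mem_insert_iff] at ha ⊢
    tauto
  obtain ⟨φ, hφ, P', hP', hPP', hpart⟩ := h3
  refine ⟨φ, hφ, ?_⟩
  convert hPP'
  ext q
  refine ⟨fun hq => hpart.subset q hq, fun hq => hpart.left q hq ?_⟩
  by_cases hqC : q.1 ∈ E.1.2
  · exact .inl hqC
  · exact .inr (mem_independent.2 ⟨(hP'.subset hq).1, hqC⟩)

end Correctness

/-! ### Instances as data -/

section Instances

open Classical in
/-- The adjacency matrix as a list of rows. -/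
noncomputable def matrix {n : ℕ} (G : SimpleGraph (Fin n)) : List (List Bool) :=
  List.ofFn fun i => List.ofFn fun j => decide (G.Adj i j)

theorem enc_matrix {n : ℕ} (G : SimpleGraph (Fin n)) : enc (matrix G) = encodeGraph G := by
  change Data.ofList ((List.ofFn _).map fun l : List Bool => Data.ofList (l.map Data.ofBool)) = _
  simp only [List.map_ofFn, encodeGraph, Function.comp_def]

/-- A graph on `{0, …, n - 1}` as a graph on `ℕ`. -/
def natGraph {n : ℕ} (G : SimpleGraph (Fin n)) : SimpleGraph ℕ := G.map Fin.valEmbedding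

theorem natGraph_adj {n : ℕ} {G : SimpleGraph (Fin n)} {i j : Fin n} :
    (natGraph G).Adj i j ↔ G.Adj i j :=
  SimpleGraph.map_adj_apply (f := Fin.valEmbedding)

theorem adj_matrix {n : ℕ} (G : SimpleGraph (Fin n)) (u v : ℕ) :
    adj (matrix G) u v = true ↔ (natGraph G).Adj u v := by
  by_cases hu : u < n
  · by_cases hv : v < n
    · have := natGraph_adj (G := G) (i := ⟨u, hu⟩) (j := ⟨v, hv⟩)
      simp only at this
      rw [this]
      simp [adj, matrix, List.getD_eq_getElem?_getD, hu, hv]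
    · have : ¬ (natGraph G).Adj u v := by
        rintro ⟨-, i, j, -, -, rfl⟩
        exact hv j.2
      simp [adj, matrix, List.getD_eq_getElem?_getD, hu, hv, this]
  · have : ¬ (natGraph G).Adj u v := by
      rintro ⟨-, i, j, -, rfl, -⟩
      exact hu i.2
    simp [adj, matrix, List.getD_eq_getElem?_getD, hu, this]

noncomputable instance : Enc GraphPair := ⟨GraphPair.encode⟩

/-- The adjacency matrices of the two graphs, with the lists of their vertices. -/
noncomputable def toInput (x : GraphPair) :
    (List (List Bool) × List ℕ) × (List (List Bool) × List ℕ) :=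
  ((matrix x.G₁, List.range x.n₁), (matrix x.G₂, List.range x.n₂))

theorem poly_toInput : Poly toInput := by
  have h (x : GraphPair) : enc (matrix x.G₁, matrix x.G₂) = enc x := by
    rw [enc_pair, enc_matrix, enc_matrix]
    rfl
  have h1 : Poly (fun x : GraphPair => (matrix x.G₁, matrix x.G₂)) :=
    .of_const_time .id 1 X (fun x => by rw [h]; exact runs_id _) fun x => by simp [esize, h]
  have h2 : Poly (fun y : List (List Bool) × List (List Bool) =>
      ((y.1, List.range y.1.length), (y.2, List.range y.2.length))) := by fun_prop
  refine (h2.comp h1).congr fun x => ?_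
  simp [toInput, matrix]

@[fun_prop]
theorem Poly.toInput {α : Type} [Enc α] {f : α → GraphPair} (hf : Poly f) :
    Poly (fun x => toInput (f x)) :=
  poly_toInput.comp hf

theorem represents_withCovers {M₁ M₂ : List (List Bool)} {G H : SimpleGraph ℕ} {l₁ l₂ : List ℕ}
    (h₁ : ∀ u v, adj M₁ u v = true ↔ G.Adj u v) (h₂ : ∀ u v, adj M₂ u v = true ↔ H.Adj u v) :
    Represents (withCovers ((M₁, l₁), (M₂, l₂))) G H :=
  ⟨h₁, h₂, isCover_minCover _, isCover_minCover _, minCover_subset _, minCover_subset _⟩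

/-- The instance with minimum vertex covers. -/
noncomputable def coveredInput (x : GraphPair) : CoveredGraph × CoveredGraph :=
  withCovers (toInput x)

theorem represents_coveredInput (x : GraphPair) :
    Represents (coveredInput x) (natGraph x.G₁) (natGraph x.G₂) :=
  represents_withCovers (adj_matrix _) (adj_matrix _)

theorem length_minCover_le_of_vertexCoverNum_le {n k : ℕ} {G : SimpleGraph (Fin n)}
    (h : G.vertexCoverNum ≤ k) : (minCover (matrix G, List.range n)).length ≤ k := by
  classical
  obtain ⟨s, hs, hcover⟩ := G.vertexCoverNum_exists
  have h1 : isCover (matrix G, List.range n) (s.toFinset.toList.map Fin.val) = true := by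
    refine isCover_iff.2 fun u hu v hv huv => ?_
    rw [adj_matrix] at huv
    obtain ⟨-, i, j, hij, rfl, rfl⟩ := huv
    exact (hcover hij).imp (fun h => List.mem_map.2 ⟨i, by simpa using h, rfl⟩)
      (fun h => List.mem_map.2 ⟨j, by simpa using h, rfl⟩)
  refine (length_minCover_le h1).trans ?_
  rw [List.length_map, Finset.length_toList, Set.toFinset_card]
  have h2 : s.encard ≤ k := hs ▸ h
  rw [← Set.coe_fintypeCard] at h2
  exact_mod_cast h2

theorem coverBound_toInput_le {x : GraphPair} {k : ℕ} (h₁ : x.G₁.vertexCoverNum ≤ k)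
    (h₂ : x.G₂.vertexCoverNum ≤ k) : coverBound (toInput x) ≤ (9 * k) ^ k * 2 ^ k ^ 2 :=
  (leafBound_mono (length_minCover_le_of_vertexCoverNum_le h₁)
    (length_minCover_le_of_vertexCoverNum_le h₂)).trans (leafBound_self_le k)

/-! ### Common induced subgraphs as sets of pairs -/

variable {x : GraphPair}

/-- The graph of the isomorphism, as a set of pairs of numbers. -/
def pairs (s : CommonInducedSubgraph x.G₁ x.G₂) : Set (ℕ × ℕ) :=
  Set.range fun u : s.left => ((u.1 : ℕ), ((s.iso u).1 : ℕ))

theorem fst_image_pairs (s : CommonInducedSubgraph x.G₁ x.G₂) :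
    Prod.fst '' pairs s = Fin.val '' s.left := by
  rw [pairs, ← Set.range_comp]
  ext i
  simp

theorem pairwise_pairs (s : CommonInducedSubgraph x.G₁ x.G₂) :
    (pairs s).Pairwise (Compatible (natGraph x.G₁) (natGraph x.G₂)) := by
  rintro _ ⟨u, rfl⟩ _ ⟨v, rfl⟩ huv
  have hne : u ≠ v := fun h => huv (h ▸ rfl)
  refine ⟨fun h => hne (Subtype.ext (Fin.ext h)),
    fun h => hne (s.iso.injective (Subtype.ext (Fin.ext h))), ?_⟩
  rw [natGraph_adj, natGraph_adj]
  exact (s.iso.map_rel_iff (a := u) (b := v)).symm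

theorem pairs_subset (s : CommonInducedSubgraph x.G₁ x.G₂) :
    pairs s ⊆ {u | u ∈ List.range x.n₁} ×ˢ {v | v ∈ List.range x.n₂} := by
  rintro _ ⟨u, rfl⟩
  exact ⟨List.mem_range.2 u.1.2, List.mem_range.2 (s.iso u).1.2⟩

/-- The list `φ` of pairs describes an isomorphism between induced subgraphs. -/
def IsValid (x : GraphPair) (φ : List (ℕ × ℕ)) : Prop :=
  φ.Pairwise (Compatible (natGraph x.G₁) (natGraph x.G₂)) ∧ ∀ p ∈ φ, p.1 < x.n₁ ∧ p.2 < x.n₂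

theorem isValid_of_mem_leaves {φ : List (ℕ × ℕ)} (hφ : φ ∈ leaves (coveredInput x)) :
    IsValid x φ := by
  obtain ⟨h1, h2⟩ := (represents_coveredInput x).pairwise_of_mem_leaves hφ
  exact ⟨h1, fun p hp => ⟨List.mem_range.1 (h2 p hp).1, List.mem_range.1 (h2 p hp).2⟩⟩

theorem IsValid.compatible {φ : List (ℕ × ℕ)} (h : IsValid x φ) {p q : ℕ × ℕ} (hp : p ∈ φ)
    (hq : q ∈ φ) (hpq : p ≠ q) : Compatible (natGraph x.G₁) (natGraph x.G₂) p q :=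
  have : Std.Symm (Compatible (natGraph x.G₁) (natGraph x.G₂)) := ⟨fun _ _ h => h.symm⟩
  h.1.forall hp hq hpq

theorem IsValid.exists_subgraph {φ : List (ℕ × ℕ)} (h : IsValid x φ) :
    ∃ s : CommonInducedSubgraph x.G₁ x.G₂, pairs s = {q | q ∈ φ} := by
  classical
  let A : Set (Fin x.n₁) := {i | ∃ j : Fin x.n₂, ((i : ℕ), (j : ℕ)) ∈ φ}
  let B : Set (Fin x.n₂) := {j | ∃ i : Fin x.n₁, ((i : ℕ), (j : ℕ)) ∈ φ}
  have hA : ∀ i : A, ∃ j : B, ((i.1 : ℕ), (j.1 : ℕ)) ∈ φ := fun i =>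
    ⟨⟨i.2.choose, i.1, i.2.choose_spec⟩, i.2.choose_spec⟩
  have hB : ∀ j : B, ∃ i : A, ((i.1 : ℕ), (j.1 : ℕ)) ∈ φ := fun j =>
    ⟨⟨j.2.choose, j.1, j.2.choose_spec⟩, j.2.choose_spec⟩
  choose f hf using hA
  choose g hg using hB
  have hl : ∀ j, f (g j) = j := fun j => by
    by_contra hne
    have := h.compatible (hf (g j)) (hg j) fun heq => hne
      (Subtype.ext (Fin.ext (congrArg Prod.snd heq)))
    exact this.1 rfl
  have hr : ∀ i, g (f i) = i := fun i => by
    by_contra hne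
    have := h.compatible (hg (f i)) (hf i) fun heq => hne
      (Subtype.ext (Fin.ext (congrArg Prod.fst heq)))
    exact this.2.1 rfl
  refine ⟨⟨A, B, ⟨⟨f, g, hr, hl⟩, ?_⟩⟩, ?_⟩
  · intro i j
    change x.G₂.Adj (f i).1 (f j).1 ↔ x.G₁.Adj i.1 j.1
    by_cases hij : i = j
    · subst hij
      simp
    rw [← natGraph_adj (G := x.G₁), ← natGraph_adj (G := x.G₂)]
    exact (h.compatible (hf i) (hf j) fun heq => hij
      (Subtype.ext (Fin.ext (congrArg Prod.fst heq)))).2.2.symm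
  · ext ⟨i, j⟩
    constructor
    · rintro ⟨u, hu⟩
      rw [← hu]
      exact hf u
    · intro hij
      obtain ⟨hi, hj⟩ := h.2 _ hij
      let u : A := ⟨⟨i, hi⟩, ⟨j, hj⟩, hij⟩
      refine ⟨u, ?_⟩
      change ((i : ℕ), ((f u).1 : ℕ)) = (i, j)
      by_contra hne
      exact (h.compatible (hf u) hij hne).1 rfl

/-- The induced subgraph on numbers is isomorphic to the common induced subgraph. -/
noncomputable def isoInduce (s : CommonInducedSubgraph x.G₁ x.G₂) :
    s.graph ≃g (natGraph x.G₁).induce (Prod.fst '' pairs s) where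
  toEquiv := (Equiv.Set.image Fin.val s.left Fin.val_injective).trans
    (Equiv.setCongr (fst_image_pairs s).symm)
  map_rel_iff' {u v} := natGraph_adj (G := x.G₁) (i := u.1) (j := v.1)

theorem Similar.nonempty_iso {V W : Type*} {G : SimpleGraph V} {P P' : Set (V × W)}
    (h : Similar G P P') :
    Nonempty (G.induce (Prod.fst '' P) ≃g G.induce (Prod.fst '' P')) := by
  obtain ⟨σ, h1, h2⟩ := h
  exact ⟨⟨(σ.image (Prod.fst '' P)).trans (Equiv.setCongr h1.symm),
    fun {a b} => h2 a.1 a.2 b.1 b.2⟩⟩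

theorem same_of_similar {s t : CommonInducedSubgraph x.G₁ x.G₂}
    (h : Similar (natGraph x.G₁) (pairs s) (pairs t)) : s.Same t := by
  obtain ⟨e⟩ := h.nonempty_iso
  exact ⟨((isoInduce s).trans e).trans (isoInduce t).symm⟩

theorem compatible_of_isNonextendable {s : CommonInducedSubgraph x.G₁ x.G₂} {φ : List (ℕ × ℕ)}
    (hφ : IsValid x φ) (hs : pairs s = {q | q ∈ φ}) (hn : s.IsNonextendable) {p : ℕ × ℕ}
    (hp1 : p.1 < x.n₁) (hp2 : p.2 < x.n₂) :
    ¬ ∀ q ∈ φ, Compatible (natGraph x.G₁) (natGraph x.G₂) p q := by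
  intro hfit
  have hvalid : IsValid x (p :: φ) :=
    ⟨List.pairwise_cons.2 ⟨hfit, hφ.1⟩, List.forall_mem_cons.2 ⟨⟨hp1, hp2⟩, hφ.2⟩⟩
  obtain ⟨t, ht⟩ := hvalid.exists_subgraph
  have hmem : ∀ u : s.left, ∃ h : u.1 ∈ t.left, (t.iso ⟨u.1, h⟩ : Fin x.n₂) = s.iso u := by
    rintro ⟨u, hu⟩
    have h1 : ((u : ℕ), ((s.iso ⟨u, hu⟩).1 : ℕ)) ∈ pairs t := by
      rw [ht]
      exact List.mem_cons_of_mem _ (hs.subset ⟨⟨u, hu⟩, rfl⟩)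
    obtain ⟨⟨v, hv⟩, huv⟩ := h1
    obtain ⟨h3, h4⟩ := Prod.mk.inj huv
    obtain rfl : v = u := Fin.ext h3
    exact ⟨hv, Fin.ext h4⟩
  have heq := hn t ⟨fun u hu => (hmem ⟨u, hu⟩).1, fun u => (hmem u).2⟩
  have hpt : p ∈ pairs t := by
    rw [ht]
    exact List.mem_cons_self
  obtain ⟨v, rfl⟩ := hpt
  have h1 : ((v.1 : ℕ), ((s.iso ⟨v.1, heq ▸ v.2⟩).1 : ℕ)) ∈ pairs s := ⟨⟨v.1, heq ▸ v.2⟩, rfl⟩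
  rw [hs] at h1
  exact (hfit _ h1).1 rfl

theorem isNonextendable_of_forall {s : CommonInducedSubgraph x.G₁ x.G₂}
    (h : ∀ p : ℕ × ℕ, p.1 < x.n₁ → p.2 < x.n₂ →
      ¬ ∀ q ∈ pairs s, Compatible (natGraph x.G₁) (natGraph x.G₂) p q) : s.IsNonextendable := by
  rintro t ⟨hst, hiso⟩
  refine Set.Subset.antisymm (fun u hu => ?_) hst
  by_contra hus
  refine h ((u : ℕ), ((t.iso ⟨u, hu⟩).1 : ℕ)) u.2 (t.iso ⟨u, hu⟩).1.2 ?_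
  rintro _ ⟨v, rfl⟩
  refine pairwise_pairs t ⟨⟨u, hu⟩, rfl⟩ ⟨⟨v.1, hst v.2⟩, by simp [hiso v]⟩ fun heq => ?_
  have h1 : u = v.1 := Fin.ext (Prod.mk.inj heq).1
  exact hus (h1 ▸ v.2)

/-- A nonextendable isomorphism is a target of the search. -/
theorem isTarget_pairs {s : CommonInducedSubgraph x.G₁ x.G₂} (hs : s.IsNonextendable) :
    Target (coveredInput x) (natGraph x.G₁) (natGraph x.G₂) (pairs s) := by
  classical
  refine ⟨pairwise_pairs s, pairs_subset s, fun w hw v hv h => ?_⟩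
  have hw := List.mem_range.1 (mem_independent.1 hw).1
  have hv := List.mem_range.1 (mem_independent.1 hv).1
  have hfin : (pairs s).Finite := Set.finite_range _
  let φ := hfin.toFinset.toList
  have hφ : pairs s = {q | q ∈ φ} := by
    ext q
    simp [φ]
  have hvalid : IsValid x φ := by
    refine ⟨?_, fun p hp => ?_⟩
    · refine List.Nodup.pairwise_of_forall_ne (Finset.nodup_toList _) fun p hp q hq hpq => ?_
      exact pairwise_pairs s (hφ.symm ▸ hp) (hφ.symm ▸ hq) hpq
    · have := pairs_subset s (hφ.symm ▸ hp : p ∈ pairs s)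
      exact ⟨List.mem_range.1 this.1, List.mem_range.1 this.2⟩
  exact compatible_of_isNonextendable hvalid hφ hs (p := (w, v)) hw hv fun q hq =>
    h q (hφ.symm ▸ hq)

/-- Every nonextendable isomorphism is found up to isomorphism of its domain. -/
theorem exists_leaf_same {s : CommonInducedSubgraph x.G₁ x.G₂} (hs : s.IsNonextendable) :
    ∃ φ ∈ leaves (coveredInput x), ∀ t : CommonInducedSubgraph x.G₁ x.G₂,
      pairs t = {q | q ∈ φ} → s.Same t := by
  obtain ⟨φ, hφ, h⟩ := (represents_coveredInput x).exists_mem_leaves (isTarget_pairs hs)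
  exact ⟨φ, hφ, fun t ht => same_of_similar (ht ▸ h)⟩

/-! ### Maximal common induced subgraphs -/

theorem CommonInducedSubgraph.Same.symm {s t : CommonInducedSubgraph x.G₁ x.G₂}
    (h : s.Same t) : t.Same s :=
  let ⟨e⟩ := h
  ⟨e.symm⟩

theorem CommonInducedSubgraph.Same.trans {s t r : CommonInducedSubgraph x.G₁ x.G₂}
    (h : s.Same t) (h' : t.Same r) : s.Same r :=
  let ⟨e⟩ := h
  let ⟨f⟩ := h'
  ⟨e.trans f⟩

theorem CommonInducedSubgraph.Same.card_eq {s t : CommonInducedSubgraph x.G₁ x.G₂}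
    (h : s.Same t) : Nat.card s.left = Nat.card t.left :=
  let ⟨e⟩ := h
  Nat.card_congr e.toEquiv

theorem card_le_of_embedding {s t : CommonInducedSubgraph x.G₁ x.G₂}
    (h : Nonempty (s.graph ↪g t.graph)) : Nat.card s.left ≤ Nat.card t.left :=
  let ⟨e⟩ := h
  Nat.card_le_card_of_injective e e.injective

theorem same_of_embedding {s t : CommonInducedSubgraph x.G₁ x.G₂}
    (h : Nonempty (s.graph ↪g t.graph)) (hcard : Nat.card t.left ≤ Nat.card s.left) :
    s.Same t := by
  obtain ⟨e⟩ := h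
  have hbij : Function.Bijective e := (Nat.bijective_iff_injective_and_card e).2
    ⟨e.injective, le_antisymm (Nat.card_le_card_of_injective e e.injective) hcard⟩
  exact ⟨⟨Equiv.ofBijective e hbij, e.map_rel_iff⟩⟩

theorem CommonInducedSubgraph.IsMaximal.isNonextendable {s : CommonInducedSubgraph x.G₁ x.G₂}
    (hs : s.IsMaximal) : s.IsNonextendable := by
  rintro t ⟨hst, -⟩
  have h1 := (hs t ⟨x.G₁.induceHomOfLE hst⟩).card_eq
  refine (Set.eq_of_subset_of_ncard_le hst ?_ (Set.toFinite _)).symm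
  exact h1.ge

theorem CommonInducedSubgraph.IsMaximal.of_same {s t : CommonInducedSubgraph x.G₁ x.G₂}
    (hs : s.IsMaximal) (h : s.Same t) : t.IsMaximal := by
  rintro r ⟨f⟩
  obtain ⟨e⟩ := id h
  exact h.symm.trans (hs r ⟨f.comp e.toEmbedding⟩)

theorem exists_isMaximal (s : CommonInducedSubgraph x.G₁ x.G₂) :
    ∃ t : CommonInducedSubgraph x.G₁ x.G₂, Nonempty (s.graph ↪g t.graph) ∧ t.IsMaximal := by
  -- Take `t` with the largest number of vertices.
  have hbdd : ∀ t : CommonInducedSubgraph x.G₁ x.G₂, Nat.card t.left ≤ x.n₁ := fun t => by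
    simpa using Nat.card_le_card_of_injective (Subtype.val : t.left → Fin x.n₁)
      Subtype.val_injective
  let S := {n | ∃ t : CommonInducedSubgraph x.G₁ x.G₂,
    Nonempty (s.graph ↪g t.graph) ∧ Nat.card t.left = n}
  have hS : S.Nonempty := ⟨_, s, ⟨SimpleGraph.Embedding.refl⟩, rfl⟩
  have hS' : BddAbove S := ⟨x.n₁, by rintro _ ⟨t, -, rfl⟩; exact hbdd t⟩
  obtain ⟨t, ⟨e⟩, ht⟩ := Nat.sSup_mem hS hS'
  refine ⟨t, ⟨e⟩, fun r hr => same_of_embedding hr ?_⟩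
  obtain ⟨f⟩ := hr
  rw [ht]
  exact le_csSup hS' ⟨r, ⟨f.comp e⟩, rfl⟩

end Instances

/-! ### Output -/

/-- The table with one entry for each number `i` in `l`: zero if `i` is not used, and `j + 1` if `φ`
contains the pair `(i, j)`. -/
def table (l : List ℕ) (φ : List (ℕ × ℕ)) : List ℕ :=
  l.map fun i => ((φ.filter fun p => p.1 == i).map fun p => p.2 + 1).headD 0

@[fun_prop]
theorem Poly.table {l : α → List ℕ} {φ : α → List (ℕ × ℕ)} (hl : Poly l) (hφ : Poly φ) :
    Poly (fun x => table (l x) (φ x)) := by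
  unfold MCIS.table
  fun_prop

theorem enc_table {x : GraphPair} {s : CommonInducedSubgraph x.G₁ x.G₂} {φ : List (ℕ × ℕ)}
    (hs : pairs s = {q | q ∈ φ}) : enc (table (List.range x.n₁) φ) = encodeSubgraph x s := by
  classical
  have hmem : ∀ {q : ℕ × ℕ}, q ∈ φ ↔ q ∈ pairs s := fun {q} => by rw [hs]; rfl
  have h : table (List.range x.n₁) φ = List.ofFn fun i : Fin x.n₁ =>
      if h : i ∈ s.left then ((s.iso ⟨i, h⟩).1.1 + 1) else 0 := by
    unfold table
    rw [← List.map_coe_finRange_eq_range, List.map_map, List.ofFn_eq_map]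
    refine List.map_congr_left fun i _ => ?_
    simp only [Function.comp_apply]
    split_ifs with hi
    · have h1 : ((i : ℕ), ((s.iso ⟨i, hi⟩).1 : ℕ)) ∈ φ.filter fun p => p.1 == (i : ℕ) :=
        List.mem_filter.2 ⟨hmem.2 ⟨⟨i, hi⟩, rfl⟩, by simp⟩
      obtain ⟨p, l, hl⟩ := List.exists_cons_of_ne_nil (List.ne_nil_of_mem h1)
      rw [hl, List.map_cons, List.headD_cons]
      obtain ⟨h2, h3⟩ := List.mem_filter.1 (hl ▸ List.mem_cons_self :
        p ∈ φ.filter fun p => p.1 == (i : ℕ))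
      obtain ⟨⟨u, hu⟩, rfl⟩ := hmem.1 h2
      obtain rfl : u = i := Fin.ext (by simpa using h3)
      rfl
    · have h1 : (φ.filter fun p => p.1 == (i : ℕ)) = [] := by
        refine List.filter_eq_nil_iff.2 fun p hp hpi => hi ?_
        obtain ⟨⟨u, hu⟩, rfl⟩ := hmem.1 hp
        obtain rfl : u = i := Fin.ext (by simpa using hpi)
        exact hu
      simp [h1]
  rw [h]
  change Data.ofList ((List.ofFn _).map Data.ofNat) = _
  rw [List.map_ofFn, encodeSubgraph]
  congr 2
  ext i
  simp only [Function.comp_apply]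
  split_ifs <;> rfl

theorem exists_subgraphs {x : GraphPair} {Φ : List (List (ℕ × ℕ))} (h : ∀ φ ∈ Φ, IsValid x φ) :
    ∃ L : List (CommonInducedSubgraph x.G₁ x.G₂),
      List.Forall₂ (fun φ s => pairs s = {q | q ∈ φ}) Φ L := by
  induction Φ with
  | nil => exact ⟨[], .nil⟩
  | cons φ Φ ih =>
    obtain ⟨s, hs⟩ := (h φ List.mem_cons_self).exists_subgraph
    obtain ⟨L, hL⟩ := ih fun ψ hψ => h ψ (List.mem_cons_of_mem _ hψ)
    exact ⟨s :: L, .cons hs hL⟩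

theorem map_encodeSubgraph {x : GraphPair} {Φ : List (List (ℕ × ℕ))}
    {L : List (CommonInducedSubgraph x.G₁ x.G₂)}
    (h : List.Forall₂ (fun φ s => pairs s = {q | q ∈ φ}) Φ L) :
    Data.ofList (L.map (encodeSubgraph x)) = enc (Φ.map (table (List.range x.n₁))) := by
  induction h with
  | nil => rfl
  | cons h _ ih =>
    rw [List.map_cons, List.map_cons, enc_cons, ← ih, enc_table h]
    rfl

theorem exists_of_forall₂ {β γ : Type*} {r : β → γ → Prop} {l : List β} {l' : List γ}
    (h : List.Forall₂ r l l') :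
    (∀ b ∈ l, ∃ c ∈ l', r b c) ∧ ∀ c ∈ l', ∃ b ∈ l, r b c := by
  induction h with
  | nil => simp
  | cons h _ ih =>
    simp only [List.mem_cons, exists_eq_or_imp]
    refine ⟨?_, ?_⟩
    · rintro _ (rfl | hb)
      · exact .inl h
      · exact .inr (ih.1 _ hb)
    · rintro _ (rfl | hc)
      · exact .inl h
      · exact .inr (ih.2 _ hc)

theorem eval_le_mul_pow (P : ℕ[X]) {s : ℕ} (hs : 1 ≤ s) :
    P.eval s ≤ P.eval 1 * s ^ P.natDegree := by
  rw [eval_eq_sum_range, eval_eq_sum_range, Finset.sum_mul]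
  refine Finset.sum_le_sum fun i hi => ?_
  rw [one_pow, mul_one]
  exact Nat.mul_le_mul_left _ (Nat.pow_le_pow_right hs (Nat.lt_succ_iff.1 (Finset.mem_range.1 hi)))

theorem Listable.exists_outputsWithin {N : α → ℕ} {L : α → List β} (hL : Listable N L) :
    ∃ (p : Program) (C c : ℕ), ∀ x, p.OutputsWithin (enc x) (enc (L x))
      (C * N x * esize x ^ c) := by
  have h1 := hL.one_le
  obtain ⟨p, P, hL⟩ := hL
  let Q := P + P * (P + 1) + 1
  refine ⟨p, Q.eval 1, Q.natDegree, fun x => ?_⟩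
  obtain ⟨⟨t, ht, hr⟩, h2, h3⟩ := hL x
  refine ⟨t, hr, ?_⟩
  have h4 := esize_list_le h3
  have h5 := Nat.mul_le_mul_right (P.eval (esize x) + 1) h2
  have h6 := Nat.mul_le_mul_left (N x) (eval_le_mul_pow Q (esize_pos x))
  have h7 := h1 x
  calc t + esize (L x) ≤ N x * Q.eval (esize x) := by
        simp only [Q, eval_add, eval_mul, eval_one, mul_add (N x), mul_one]
        rw [mul_add] at h4
        rw [mul_assoc, mul_add] at h5
        simp only [mul_add, mul_one] at h4 h5 ⊢
        omega
    _ ≤ _ := h6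
    _ = _ := by ring

/-- A feasible function that works on a long list takes time polynomial in the length of that
list. -/
theorem Listable.exists_outputsWithin_comp {N : α → ℕ} {M : α × List β → ℕ} {L : α → List β}
    {h : α × List β → γ} (hL : Listable N L) (hh : Feasible M h)
    (hM : ∀ x, M (x, L x) ≤ N x) :
    ∃ (p : Program) (C c : ℕ), ∀ x, p.OutputsWithin (enc x) (enc (h (x, L x)))
      (C * N x ^ c * esize x ^ c) := by
  have h1 := hL.one_le
  obtain ⟨p, P, hL⟩ := hL
  obtain ⟨q, Q, hh⟩ := hh
  let R := X + P * (P + 1) + 2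
  let c := max (R.natDegree * Q.natDegree) (Q.natDegree + 1 + P.natDegree)
  refine ⟨.seq (.cons .id p) q, P.eval 1 + 3 + 2 * (Q.eval 1 * (R.eval 1) ^ Q.natDegree), c,
    fun x => ?_⟩
  obtain ⟨r1, h2, h3⟩ := hL x
  obtain ⟨r2, h4⟩ := hh (x, L x)
  obtain ⟨t, ht, hr⟩ := ((runs_id _).cons r1).seq r2
  refine ⟨t, hr, ?_⟩
  change t + esize (h (x, L x)) ≤ _
  have hN := h1 x
  have hs := esize_pos x
  have h5 : esize (x, L x) ≤ N x * R.eval (esize x) := by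
    have h4 := esize_list_le h3
    have h5 := Nat.mul_le_mul_right (P.eval (esize x) + 1) h2
    have h6 := Nat.mul_le_mul_right (esize x) hN
    simp only [R, esize_pair, eval_add, eval_mul, eval_one, eval_X, eval_ofNat, mul_add (N x)]
    rw [mul_assoc, mul_add] at h5
    simp only [mul_add, mul_one] at h4 h5 ⊢
    omega
  have h6 : esize (x, L x) ≤ N x * (R.eval 1 * esize x ^ R.natDegree) :=
    h5.trans (Nat.mul_le_mul_left _ (eval_le_mul_pow R hs))
  have h7 : Q.eval (esize (x, L x)) ≤
      Q.eval 1 * (N x * (R.eval 1 * esize x ^ R.natDegree)) ^ Q.natDegree :=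
    (eval_le_mul_pow Q (esize_pos _)).trans (by gcongr)
  set K := Q.eval 1 * (R.eval 1) ^ Q.natDegree with hK
  have hc1 : R.natDegree * Q.natDegree ≤ c := le_max_left _ _
  have hc2 : Q.natDegree + 1 + P.natDegree ≤ c := le_max_right _ _
  have h8 : N x * Q.eval (esize (x, L x)) ≤ K * (N x ^ c * esize x ^ c) := by
    calc _ ≤ N x * (Q.eval 1 * (N x * (R.eval 1 * esize x ^ R.natDegree)) ^ Q.natDegree) := by
          gcongr
      _ = K * (N x ^ (Q.natDegree + 1) * esize x ^ (R.natDegree * Q.natDegree)) := by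
          rw [hK, pow_mul]; ring
      _ ≤ _ := by
          gcongr
          omega
  have h9 : M (x, L x) * Q.eval (esize (x, L x)) ≤ K * (N x ^ c * esize x ^ c) :=
    (Nat.mul_le_mul_right _ (hM x)).trans h8
  have h10 : Q.eval (esize (x, L x)) ≤ K * (N x ^ c * esize x ^ c) :=
    (Nat.le_mul_of_pos_left _ hN).trans h8
  have h11 : N x * P.eval (esize x) ≤ P.eval 1 * (N x ^ c * esize x ^ c) := by
    calc _ ≤ N x * (P.eval 1 * esize x ^ P.natDegree) := by
          gcongr
          exact eval_le_mul_pow P hs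
      _ = P.eval 1 * (N x ^ 1 * esize x ^ P.natDegree) := by ring
      _ ≤ _ := by
          gcongr
          · omega
          · omega
  have h12 : 1 ≤ N x ^ c * esize x ^ c := Nat.mul_pos (pow_pos hN _) (pow_pos hs _)
  calc t + esize (h (x, L x)) ≤ P.eval 1 * (N x ^ c * esize x ^ c) + 3 * 1 +
        2 * (K * (N x ^ c * esize x ^ c)) := by omega
    _ ≤ P.eval 1 * (N x ^ c * esize x ^ c) + 3 * (N x ^ c * esize x ^ c) +
        2 * (K * (N x ^ c * esize x ^ c)) := by gcongr
    _ = _ := by ring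

/-! ### The three algorithms -/

theorem listable_leaves_coveredInput :
    Listable (fun x => coverBound (toInput x)) (fun x => leaves (coveredInput x)) :=
  listable_leaves_withCovers.comp
    (poly_toInput.feasible fun _ => listable_leaves_withCovers.one_le _) fun _ => le_rfl

theorem leaves_lists : ∃ (p : Program) (C c : ℕ), ∀ (x : GraphPair) (k : ℕ),
    x.G₁.vertexCoverNum ≤ k → x.G₂.vertexCoverNum ≤ k →
      Lists p x (fun _ => True) (fun s => s.IsNonextendable)
        (C * ((9 * k) ^ k * 2 ^ k ^ 2) * x.encode.size ^ c) := by
  obtain ⟨p, C, c, h⟩ := (listable_leaves_coveredInput.map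
    (g := fun x φ => table (toInput x).1.2 φ)
    (.table (poly_toInput.comp (by fun_prop)).fst.snd (by fun_prop))).exists_outputsWithin
  refine ⟨p, C, c, fun x k h₁ h₂ => ?_⟩
  obtain ⟨L, hL⟩ := exists_subgraphs (x := x) (Φ := leaves (coveredInput x))
    fun φ hφ => isValid_of_mem_leaves hφ
  refine ⟨L, fun _ _ => trivial, fun s hs => ?_, ?_⟩
  · obtain ⟨φ, hφ, hsame⟩ := exists_leaf_same hs
    obtain ⟨t, ht, htφ⟩ := (exists_of_forall₂ hL).1 φ hφ
    exact ⟨t, ht, hsame t htφ⟩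
  · rw [map_encodeSubgraph hL]
    obtain ⟨t, hr, ht⟩ := h x
    exact ⟨t, hr, ht.trans (by gcongr; exacts [coverBound_toInput_le h₁ h₂, le_rfl])⟩

/-- Whether no pair of vertices can be added to the isomorphism `φ`. The vertex covers have no
influence on `fits`, so the empty lists take their place. -/
def isNonextendable (r : (List (List Bool) × List ℕ) × (List (List Bool) × List ℕ))
    (φ : List (ℕ × ℕ)) : Bool :=
  r.1.2.all fun u => r.2.2.all fun v => !fits ((r.1, []), (r.2, [])) φ (u, v)

@[fun_prop]
theorem Poly.isNonextendable
    {r : α → (List (List Bool) × List ℕ) × (List (List Bool) × List ℕ)}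
    {φ : α → List (ℕ × ℕ)} (hr : Poly r) (hφ : Poly φ) :
    Poly (fun x => isNonextendable (r x) (φ x)) := by
  unfold MCIS.isNonextendable
  fun_prop

theorem isNonextendable_iff {x : GraphPair} {s : CommonInducedSubgraph x.G₁ x.G₂}
    {φ : List (ℕ × ℕ)} (hφ : IsValid x φ) (hs : pairs s = {q | q ∈ φ}) :
    isNonextendable (toInput x) φ = true ↔ s.IsNonextendable := by
  have h1 : isNonextendable (toInput x) φ = true ↔ ∀ u < x.n₁, ∀ v < x.n₂,
      ¬ ∀ q ∈ φ, Compatible (natGraph x.G₁) (natGraph x.G₂) (u, v) q := by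
    simp only [← (represents_coveredInput x).fits_iff]
    rw [isNonextendable]
    simp only [List.all_eq_true, toInput, List.mem_range, Bool.not_eq_true', Bool.not_eq_true]
    rfl
  rw [h1]
  refine ⟨fun h => isNonextendable_of_forall fun p hp1 hp2 hp => ?_,
    fun h u hu v hv => compatible_of_isNonextendable hφ hs h (p := (u, v)) hu hv⟩
  exact h p.1 hp1 p.2 hp2 fun q hq => hp q (hs ▸ hq)

/-- The results of the search that are nonextendable. -/
noncomputable def nonextendableLeaves (x : GraphPair) : List (List (ℕ × ℕ)) :=
  (leaves (coveredInput x)).filter (isNonextendable (toInput x))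

theorem listable_nonextendableLeaves :
    Listable (fun x => coverBound (toInput x)) nonextendableLeaves :=
  listable_leaves_coveredInput.filter (t := fun x φ => isNonextendable (toInput x) φ) (by fun_prop)

theorem isValid_of_mem_nonextendableLeaves {x : GraphPair} {φ : List (ℕ × ℕ)}
    (hφ : φ ∈ nonextendableLeaves x) : IsValid x φ :=
  isValid_of_mem_leaves (List.mem_filter.1 hφ).1

/-- Maximal common induced subgraphs are nonextendable, whatever isomorphism presents them, so they
pass the filter. -/
theorem exists_nonextendableLeaf_same {x : GraphPair} {s : CommonInducedSubgraph x.G₁ x.G₂}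
    (hs : s.IsMaximal) : ∃ φ ∈ nonextendableLeaves x,
      ∀ t : CommonInducedSubgraph x.G₁ x.G₂, pairs t = {q | q ∈ φ} → s.Same t := by
  obtain ⟨φ, hφ, hsame⟩ := exists_leaf_same hs.isNonextendable
  have hv := isValid_of_mem_leaves hφ
  obtain ⟨t, ht⟩ := hv.exists_subgraph
  exact ⟨φ, List.mem_filter.2 ⟨hφ, (isNonextendable_iff hv ht).2
    (hs.of_same (hsame t ht)).isNonextendable⟩, hsame⟩

theorem nonextendableLeaves_lists : ∃ (p : Program) (C c : ℕ), ∀ (x : GraphPair) (k : ℕ),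
    x.G₁.vertexCoverNum ≤ k → x.G₂.vertexCoverNum ≤ k →
      Lists p x (fun s => s.IsNonextendable) (fun s => s.IsMaximal)
        (C * ((9 * k) ^ k * 2 ^ k ^ 2) * x.encode.size ^ c) := by
  obtain ⟨p, C, c, h⟩ := (listable_nonextendableLeaves.map
    (g := fun x φ => table (toInput x).1.2 φ)
    (.table (poly_toInput.comp (by fun_prop)).fst.snd (by fun_prop))).exists_outputsWithin
  refine ⟨p, C, c, fun x k h₁ h₂ => ?_⟩
  obtain ⟨L, hL⟩ := exists_subgraphs (x := x) (Φ := nonextendableLeaves x)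
    fun φ hφ => isValid_of_mem_nonextendableLeaves hφ
  refine ⟨L, fun s hs => ?_, fun s hs => ?_, ?_⟩
  · obtain ⟨φ, hφ, hsφ⟩ := (exists_of_forall₂ hL).2 s hs
    exact (isNonextendable_iff (isValid_of_mem_nonextendableLeaves hφ) hsφ).1
      (List.mem_filter.1 hφ).2
  · obtain ⟨φ, hφ, hsame⟩ := exists_nonextendableLeaf_same hs
    obtain ⟨t, ht, htφ⟩ := (exists_of_forall₂ hL).1 φ hφ
    exact ⟨t, ht, hsame t htφ⟩
  · rw [map_encodeSubgraph hL]
    obtain ⟨t, hr, ht⟩ := h x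
    exact ⟨t, hr, ht.trans (by gcongr; exacts [coverBound_toInput_le h₁ h₂, le_rfl])⟩

/-! ### Embeddings between common induced subgraphs -/

/-- Whether the subgraph induced by the domain of `s` embeds into the one induced by the domain of
`t`: the search for isomorphisms between their induced subgraphs finds one that uses all
vertices of the first graph. -/
def embeds (M : List (List Bool)) (s t : List (ℕ × ℕ)) : Bool :=
  (leaves (withCovers ((M, s.map Prod.fst), (M, t.map Prod.fst)))).any
    fun ω => decide (s.length ≤ ω.length)

/-- The time bound for the search of an embedding. -/
def embedBound (M : List (List Bool)) (s t : List (ℕ × ℕ)) : ℕ :=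
  coverBound ((M, s.map Prod.fst), (M, t.map Prod.fst))

theorem Feasible.embeds {M : α → List (List Bool)} {s t : α → List (ℕ × ℕ)} (hM : Poly M)
    (hs : Poly s) (ht : Poly t) :
    Feasible (fun x => embedBound (M x) (s x) (t x)) (fun x => embeds (M x) (s x) (t x)) := by
  have h1 : Poly (fun x => ((M x, (s x).map Prod.fst), (M x, (t x).map Prod.fst))) := by fun_prop
  exact (listable_leaves_withCovers.comp
    (h1.feasible fun _ => listable_leaves_withCovers.one_le _) fun _ => le_rfl).any
    (t := fun x ω => decide ((s x).length ≤ ω.length)) (by fun_prop)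

theorem IsValid.nodup_map_fst {x : GraphPair} {φ : List (ℕ × ℕ)} (h : IsValid x φ) :
    (φ.map Prod.fst).Nodup := by
  rw [List.nodup_iff_pairwise_ne, List.pairwise_map]
  exact h.1.imp fun h => h.1

theorem mem_map_fst {x : GraphPair} {s : CommonInducedSubgraph x.G₁ x.G₂} {φ : List (ℕ × ℕ)}
    (hs : pairs s = {q | q ∈ φ}) (a : ℕ) : a ∈ φ.map Prod.fst ↔ a ∈ Prod.fst '' pairs s := by
  rw [hs]
  simp

theorem IsValid.ncard_eq {x : GraphPair} {s : CommonInducedSubgraph x.G₁ x.G₂} {φ : List (ℕ × ℕ)}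
    (h : IsValid x φ) (hs : pairs s = {q | q ∈ φ}) : (Prod.fst '' pairs s).ncard = φ.length := by
  have h1 : Prod.fst '' pairs s = ((φ.map Prod.fst).toFinset : Set ℕ) := by
    ext a
    rw [← mem_map_fst hs]
    simp
  rw [h1, Set.ncard_coe_finset, List.toFinset_card_of_nodup h.nodup_map_fst, List.length_map]

theorem IsValid.length_eq {x : GraphPair} {s : CommonInducedSubgraph x.G₁ x.G₂} {φ : List (ℕ × ℕ)}
    (h : IsValid x φ) (hs : pairs s = {q | q ∈ φ}) : φ.length = Nat.card s.left := by
  rw [← h.ncard_eq hs, ← Nat.card_coe_set_eq]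
  exact (Nat.card_congr (isoInduce s).toEquiv).symm

/-- The search applied to the two domains finds an embedding if there is one: an isomorphism that
uses all vertices of the first graph is saturated, so it is a target of the search, and the vertex
permutations by which a result may differ from the target preserve the number of vertices. -/
theorem embeds_iff {x : GraphPair} {s t : CommonInducedSubgraph x.G₁ x.G₂} {φ ψ : List (ℕ × ℕ)}
    (hφ : IsValid x φ) (hs : pairs s = {q | q ∈ φ}) (ht : pairs t = {q | q ∈ ψ}) :
    embeds (matrix x.G₁) φ ψ = true ↔ Nonempty (s.graph ↪g t.graph) := by
  set G := natGraph x.G₁ with hG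
  have hrep : Represents (withCovers ((matrix x.G₁, φ.map Prod.fst),
      (matrix x.G₁, ψ.map Prod.fst))) G G :=
    represents_withCovers (adj_matrix _) (adj_matrix _)
  rw [embeds, List.any_eq_true]
  constructor
  · rintro ⟨ω, hω, hlen⟩
    obtain ⟨h1, h2⟩ := hrep.pairwise_of_mem_leaves hω
    have hlen : φ.length ≤ ω.length := by simpa using hlen
    have hnodup : (ω.map Prod.fst).Nodup := by
      rw [List.nodup_iff_pairwise_ne, List.pairwise_map]
      exact h1.imp fun h => h.1
    have hsub : ω.map Prod.fst ⊆ φ.map Prod.fst := fun a ha => by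
      obtain ⟨p, hp, rfl⟩ := List.mem_map.1 ha
      exact (h2 p hp).1
    have hperm := (List.subperm_of_subset hnodup hsub).perm_of_length_le (by simpa using hlen)
    have hf : ∀ a : Prod.fst '' pairs s, ∃ b : Prod.fst '' pairs t, (a.1, b.1) ∈ ω := fun a => by
      obtain ⟨p, hp, hpa⟩ := List.mem_map.1 (hperm.mem_iff.2 ((mem_map_fst hs _).2 a.2))
      exact ⟨⟨p.2, (mem_map_fst ht _).1 (h2 p hp).2⟩, by rw [← hpa]; exact hp⟩
    choose f hf using hf
    have : Std.Symm (Compatible G G) := ⟨fun _ _ h => h.symm⟩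
    have hcomp : ∀ a b, a ≠ b → Compatible G G (a.1, (f a).1) (b.1, (f b).1) := fun a b hab =>
      h1.forall (hf a) (hf b) fun h => hab (Subtype.ext (congrArg Prod.fst h))
    have hinj : Function.Injective f := fun a b hab => by
      by_contra hne
      exact (hcomp a b hne).2.1 (congrArg Subtype.val hab)
    have e : G.induce (Prod.fst '' pairs s) ↪g G.induce (Prod.fst '' pairs t) :=
      ⟨⟨f, hinj⟩, fun {a b} => by
        by_cases hab : a = b
        · subst hab
          simp
        · exact (hcomp a b hab).2.2.symm⟩
    exact ⟨((isoInduce t).symm.toEmbedding.comp e).comp (isoInduce s).toEmbedding⟩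
  · rintro ⟨e₀⟩
    let e : G.induce (Prod.fst '' pairs s) ↪g G.induce (Prod.fst '' pairs t) :=
      ((isoInduce t).toEmbedding.comp e₀).comp (isoInduce s).symm.toEmbedding
    let P : Set (ℕ × ℕ) := Set.range fun a : Prod.fst '' pairs s => (a.1, (e a).1)
    have hfst : Prod.fst '' P = Prod.fst '' pairs s := by
      rw [← Set.range_comp]
      exact Subtype.range_coe
    have hP : Target (withCovers ((matrix x.G₁, φ.map Prod.fst),
        (matrix x.G₁, ψ.map Prod.fst))) G G P := by
      refine ⟨?_, ?_, ?_⟩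
      · rintro _ ⟨a, rfl⟩ _ ⟨b, rfl⟩ hab
        have hne : a ≠ b := fun h => hab (h ▸ rfl)
        exact ⟨fun h => hne (Subtype.ext h), fun h => hne (e.injective (Subtype.ext h)),
          (e.map_rel_iff (a := a) (b := b)).symm⟩
      · rintro _ ⟨a, rfl⟩
        exact ⟨(mem_map_fst hs _).2 a.2, (mem_map_fst ht _).2 (e a).2⟩
      · intro w hw v _ h
        have hw : w ∈ Prod.fst '' pairs s := (mem_map_fst hs _).1 (mem_independent.1 hw).1
        exact (h _ ⟨⟨w, hw⟩, rfl⟩).1 rfl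
    obtain ⟨ω, hω, σ, hσ, -⟩ := hrep.exists_mem_leaves hP
    refine ⟨ω, hω, ?_⟩
    have h1 : (Prod.fst '' {q | q ∈ ω}).ncard = φ.length := by
      rw [hσ, hfst, Set.ncard_image_of_injective _ σ.injective, hφ.ncard_eq hs]
    have h2 : Prod.fst '' {q | q ∈ ω} = ((ω.map Prod.fst).toFinset : Set ℕ) := by
      ext a
      simp
    rw [h2, Set.ncard_coe_finset] at h1
    have h3 := List.toFinset_card_le (ω.map Prod.fst)
    rw [h1, List.length_map] at h3
    simpa using h3

/-! ### The maximal common induced subgraphs -/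

/-- Whether the domain of `s` does not embed into a larger domain of an element of `L`. -/
def isMaximalIn (M : List (List Bool)) (L : List (List (ℕ × ℕ))) (s : List (ℕ × ℕ)) : Bool :=
  !L.any fun t => if decide (s.length + 1 ≤ t.length) then embeds M s t else false

/-- Whether the domains of `s` and `t` induce isomorphic subgraphs. -/
def isIsomorphic (M : List (List Bool)) (s t : List (ℕ × ℕ)) : Bool :=
  if s.length == t.length then embeds M s t else false

/-- The elements of `L` whose domains are maximal in `L`, each once up to isomorphism. -/
def maximalRepresentatives (M : List (List Bool)) (L : List (List (ℕ × ℕ))) :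
    List (List (ℕ × ℕ)) :=
  dedupBy (isIsomorphic M) (L.filter (isMaximalIn M L))

/-- The maximum of the time bounds for the embeddings of `s` into the elements of `L`. -/
def embedBoundInto (M : List (List Bool)) (L : List (List (ℕ × ℕ))) (s : List (ℕ × ℕ)) : ℕ :=
  (L.map fun t => embedBound M s t).foldr max 1

/-- The maximum of the time bounds for the embeddings between elements of `L`. -/
def embedBoundAll (M : List (List Bool)) (L : List (List (ℕ × ℕ))) : ℕ :=
  (L.map fun s => embedBoundInto M L s).foldr max 1

theorem feasible_maximalRepresentatives {M : α → List (List Bool)} {L : α → List (List (ℕ × ℕ))}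
    (hM : Poly M) (hL : Poly L) :
    Feasible (fun x => embedBoundAll (M x) (L x))
      (fun x => maximalRepresentatives (M x) (L x)) := by
  have h1 : ∀ x, 1 ≤ embedBoundAll (M x) (L x) := fun x => (foldr_max_le_iff.1 le_rfl).1
  have h2 : ∀ x, ∀ s ∈ L x, embedBoundInto (M x) (L x) s ≤ embedBoundAll (M x) (L x) :=
    fun x => (foldr_max_le_iff.1 le_rfl).2
  have h3 : ∀ (M : List (List Bool)) L s, 1 ≤ embedBoundInto M L s :=
    fun M L s => (foldr_max_le_iff.1 le_rfl).1
  have h4 : ∀ (M : List (List Bool)) L s, ∀ t ∈ L, embedBound M s t ≤ embedBoundInto M L s :=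
    fun M L s => (foldr_max_le_iff.1 le_rfl).2
  have h5 : Feasible (fun z : (α × List (ℕ × ℕ)) × List (ℕ × ℕ) => embedBound (M z.1.1) z.1.2 z.2)
      (fun z => embeds (M z.1.1) z.1.2 z.2) := .embeds (by fun_prop) (by fun_prop) (by fun_prop)
  have h6 : Feasible (fun y : α × List (ℕ × ℕ) => embedBoundInto (M y.1) (L y.1) y.2)
      (fun y => isMaximalIn (M y.1) (L y.1) y.2) := by
    have hnot : Poly (fun b : Bool => !b) := by fun_prop
    refine Feasible.comp (g := fun b : Bool => !b) hnot (Feasible.any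
      (M := fun z : (α × List (ℕ × ℕ)) × List (ℕ × ℕ) => embedBound (M z.1.1) z.1.2 z.2)
      (f := fun y t => if decide (y.2.length + 1 ≤ t.length) then embeds (M y.1) y.2 t else false)
      (Poly.feasible (f := fun y : α × List (ℕ × ℕ) => L y.1) (by fun_prop) fun y => h3 _ _ _)
      (.ite (Poly.feasible (by fun_prop) h5.one_le) h5
        (Poly.feasible (by fun_prop) h5.one_le)) ?_) fun y => h3 _ _ _
    exact fun y t ht => h4 _ _ _ t ht
  refine Feasible.dedupBy
    (M := fun z : (α × List (ℕ × ℕ)) × List (ℕ × ℕ) => embedBound (M z.1.1) z.1.2 z.2)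
    (r := fun x s t => isIsomorphic (M x) s t)
    (Feasible.filter (f := fun x s => isMaximalIn (M x) (L x) s) (hL.feasible h1) h6 h2)
    (.ite (Poly.feasible (by fun_prop) h5.one_le) h5 (Poly.feasible (by fun_prop) h5.one_le)) ?_
  intro x s hs t ht
  exact (h4 _ _ _ t (List.mem_filter.1 ht).1).trans (h2 x s (List.mem_filter.1 hs).1)

theorem isIsomorphic_iff {x : GraphPair} {s t : CommonInducedSubgraph x.G₁ x.G₂}
    {φ ψ : List (ℕ × ℕ)} (hφ : IsValid x φ) (hψ : IsValid x ψ) (hs : pairs s = {q | q ∈ φ})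
    (ht : pairs t = {q | q ∈ ψ}) : isIsomorphic (matrix x.G₁) φ ψ = true ↔ s.Same t := by
  rw [isIsomorphic, hφ.length_eq hs, hψ.length_eq ht]
  constructor
  · intro h
    split_ifs at h with hcard
    exact same_of_embedding ((embeds_iff hφ hs ht).1 h) (beq_iff_eq.1 hcard).ge
  · intro h
    rw [if_pos (beq_iff_eq.2 h.card_eq), embeds_iff hφ hs ht]
    exact ⟨h.some.toEmbedding⟩

/-- The maximal elements among the nonextendable results of the search are maximal among all common
induced subgraphs, as every common induced subgraph embeds into a maximal one, and the maximal
ones are found. -/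
theorem isMaximalIn_iff {x : GraphPair} {s : CommonInducedSubgraph x.G₁ x.G₂} {φ : List (ℕ × ℕ)}
    (hφ : IsValid x φ) (hs : pairs s = {q | q ∈ φ}) :
    isMaximalIn (matrix x.G₁) (nonextendableLeaves x) φ = true ↔ s.IsMaximal := by
  have h1 : isMaximalIn (matrix x.G₁) (nonextendableLeaves x) φ = true ↔
      ∀ ψ ∈ nonextendableLeaves x, φ.length < ψ.length →
        ¬ embeds (matrix x.G₁) φ ψ = true := by
    simp only [isMaximalIn, Bool.not_eq_true', List.any_eq_false]
    refine forall₂_congr fun ψ _ => ?_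
    by_cases h : φ.length < ψ.length
    · simp [h]
    · simp [h]
  rw [h1]
  constructor
  · rintro h t ⟨e⟩
    obtain ⟨r, ⟨f⟩, hr⟩ := exists_isMaximal t
    obtain ⟨ψ, hψ, hsame⟩ := exists_nonextendableLeaf_same hr
    have hψv := isValid_of_mem_nonextendableLeaves hψ
    obtain ⟨r', hr'⟩ := hψv.exists_subgraph
    obtain ⟨g⟩ := id (hsame r' hr')
    have h2 := h ψ hψ
    rw [embeds_iff hφ hs hr', hφ.length_eq hs, hψv.length_eq hr'] at h2
    have h3 : Nat.card r'.left ≤ Nat.card s.left := by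
      by_contra! h3
      exact h2 h3 ⟨(g.toEmbedding.comp f).comp e⟩
    rw [← (hsame r' hr').card_eq] at h3
    exact same_of_embedding ⟨e⟩ ((card_le_of_embedding ⟨f⟩).trans h3)
  · intro h ψ hψ hlt hemb
    have hψv := isValid_of_mem_nonextendableLeaves hψ
    obtain ⟨t, ht⟩ := hψv.exists_subgraph
    have h2 := (h t ((embeds_iff hφ hs ht).1 hemb)).card_eq
    rw [← hφ.length_eq hs, ← hψv.length_eq ht] at h2
    omega

theorem vertexCoverNum_le_vertexCover (x : GraphPair) :
    x.G₁.vertexCoverNum ≤ x.vertexCover ∧ x.G₂.vertexCoverNum ≤ x.vertexCover := by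
  have h (n : ℕ) (G : SimpleGraph (Fin n)) : (G.vertexCoverNum.toNat : ℕ∞) = G.vertexCoverNum :=
    ENat.natCast_toNat G.vertexCoverNum_ne_top_of_finite
  exact ⟨(h _ x.G₁).symm.le.trans (Nat.cast_le.2 (le_max_left _ _)),
    (h _ x.G₂).symm.le.trans (Nat.cast_le.2 (le_max_right _ _))⟩

/-- The vertex cover of the whole graph covers all its induced subgraphs. -/
theorem embedBoundAll_le (x : GraphPair) :
    embedBoundAll (matrix x.G₁) (nonextendableLeaves x) ≤
      (9 * x.vertexCover) ^ x.vertexCover * 2 ^ x.vertexCover ^ 2 := by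
  have hle : leafBound x.vertexCover x.vertexCover ≤
    (9 * x.vertexCover) ^ x.vertexCover * 2 ^ x.vertexCover ^ 2 := leafBound_self_le _
  have h1 : 1 ≤ leafBound x.vertexCover x.vertexCover :=
    Nat.one_le_two_pow.trans (two_pow_le_leafBound x.vertexCover x.vertexCover).1
  have h2 : ∀ φ ∈ nonextendableLeaves x,
      (minCover (matrix x.G₁, φ.map Prod.fst)).length ≤ x.vertexCover := by
    intro φ hφ
    refine (length_minCover_le (D := minCover (matrix x.G₁, List.range x.n₁)) ?_).trans
      (length_minCover_le_of_vertexCoverNum_le (vertexCoverNum_le_vertexCover x).1)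
    have hsub : ∀ u ∈ φ.map Prod.fst, u ∈ List.range x.n₁ := by
      intro u hu
      obtain ⟨p, hp, rfl⟩ := List.mem_map.1 hu
      exact List.mem_range.2 ((isValid_of_mem_nonextendableLeaves hφ).2 p hp).1
    exact isCover_iff.2 fun u hu v hv =>
      isCover_iff.1 (isCover_minCover (matrix x.G₁, List.range x.n₁)) u (hsub u hu) v (hsub v hv)
  refine le_trans (foldr_max_le_iff.2 ⟨h1, fun φ hφ => foldr_max_le_iff.2 ⟨h1, fun ψ hψ => ?_⟩⟩) hle
  exact leafBound_mono (h2 φ hφ) (h2 ψ hψ)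

theorem forall₂_pairwise {β γ : Type*} {r : β → γ → Prop} {R : β → β → Prop} {S : γ → γ → Prop}
    {l : List β} {l' : List γ} (h : List.Forall₂ r l l') (hl : l.Pairwise R)
    (hRS : ∀ a ∈ l, ∀ b ∈ l, ∀ c d, r a c → r b d → R a b → S c d) : l'.Pairwise S := by
  induction h with
  | nil => exact .nil
  | @cons a c l l' hac h ih =>
    obtain ⟨h1, h2⟩ := List.pairwise_cons.1 hl
    refine List.pairwise_cons.2 ⟨fun d hd => ?_, ih h2 fun a ha b hb =>
      hRS a (List.mem_cons_of_mem _ ha) b (List.mem_cons_of_mem _ hb)⟩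
    obtain ⟨b, hb, hbd⟩ := (exists_of_forall₂ h).2 d hd
    exact hRS a List.mem_cons_self b (List.mem_cons_of_mem _ hb) c d hac hbd (h1 b hb)

theorem primrec_pow : Primrec₂ (fun a b : ℕ => a ^ b) := Primrec₂.unpaired'.1 Nat.Primrec.pow

theorem computable_bound (C c : ℕ) :
    Computable (fun k : ℕ => C * ((9 * k) ^ k * 2 ^ k ^ 2) ^ c) := by
  refine Primrec.to_comp ?_
  have hk : Primrec (fun k : ℕ => k) := Primrec.id
  exact Primrec.nat_mul.comp (.const C) (primrec_pow.comp (Primrec.nat_mul.comp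
    (primrec_pow.comp (Primrec.nat_mul.comp (.const 9) hk) hk)
    (primrec_pow.comp (.const 2) (primrec_pow.comp hk (.const 2)))) (.const c))

theorem fixedParameterEnumerable_mcisEnumeration :
    FixedParameterEnumerable mcisEnumeration GraphPair.vertexCover := by
  have hlist : Listable (fun x : GraphPair =>
      (9 * x.vertexCover) ^ x.vertexCover * 2 ^ x.vertexCover ^ 2) nonextendableLeaves :=
    listable_nonextendableLeaves.mono fun x => coverBound_toInput_le
      (vertexCoverNum_le_vertexCover x).1 (vertexCoverNum_le_vertexCover x).2
  have hrep : Feasible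
      (fun y : GraphPair × List (List (ℕ × ℕ)) => embedBoundAll (matrix y.1.G₁) y.2)
      (fun y => (maximalRepresentatives (matrix y.1.G₁) y.2).map (table (List.range y.1.n₁))) := by
    have h0 : Poly (fun y : GraphPair × List (List (ℕ × ℕ)) => toInput y.1) :=
      poly_toInput.comp (by fun_prop)
    have h1 := feasible_maximalRepresentatives h0.fst.fst Poly.snd'
    have h2 : Poly (fun z : List ℕ × List (List (ℕ × ℕ)) => z.2.map (table z.1)) := by fun_prop
    exact Feasible.comp h2 ((h0.fst.snd.feasible h1.one_le).pair h1) h1.one_le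
  obtain ⟨p, C, c, hp⟩ := hlist.exists_outputsWithin_comp hrep embedBoundAll_le
  refine ⟨p, _, c, computable_bound C c, fun x => ?_⟩
  set Φ := maximalRepresentatives (matrix x.G₁) (nonextendableLeaves x) with hΦ
  have hmem : ∀ φ ∈ Φ, φ ∈ nonextendableLeaves x ∧
      isMaximalIn (matrix x.G₁) (nonextendableLeaves x) φ = true := fun φ hφ =>
    List.mem_filter.1 (dedupBy_subset _ _ hφ)
  have hvalid : ∀ φ ∈ Φ, IsValid x φ := fun φ hφ =>
    isValid_of_mem_nonextendableLeaves (hmem φ hφ).1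
  obtain ⟨L, hL⟩ := exists_subgraphs hvalid
  have hmax : ∀ s ∈ L, s.IsMaximal := fun s hs => by
    obtain ⟨φ, hφ, hsφ⟩ := (exists_of_forall₂ hL).2 s hs
    exact (isMaximalIn_iff (hvalid φ hφ) hsφ).1 (hmem φ hφ).2
  have hpair : L.Pairwise fun s t => ¬ s.Same t := by
    refine forall₂_pairwise hL (dedupBy_pairwise _ _) fun φ hφ ψ hψ s t hs ht h => ?_
    rw [← isIsomorphic_iff (hvalid φ hφ) (hvalid ψ hψ) hs ht, h]
    simp
  have hall : ∀ s : CommonInducedSubgraph x.G₁ x.G₂, s.IsMaximal → ∃ t ∈ L, s.Same t := by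
    intro s hs
    obtain ⟨φ, hφ, hsame⟩ := exists_nonextendableLeaf_same hs
    have hφv := isValid_of_mem_nonextendableLeaves hφ
    obtain ⟨t, ht⟩ := hφv.exists_subgraph
    have hst := hsame t ht
    have hφmax := (isMaximalIn_iff hφv ht).2 (hs.of_same hst)
    obtain ⟨ψ, hψ, hφψ⟩ := exists_mem_dedupBy (r := isIsomorphic (matrix x.G₁))
      ((isIsomorphic_iff hφv hφv ht ht).2 ⟨SimpleGraph.Iso.refl⟩)
      (List.mem_filter.2 ⟨hφ, hφmax⟩)
    obtain ⟨r, hr, hrψ⟩ := (exists_of_forall₂ hL).1 ψ hψ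
    exact ⟨r, hr, hst.trans ((isIsomorphic_iff hφv (hvalid ψ hψ) ht hrψ).1 hφψ)⟩
  have hout := hp x
  simp only [← hΦ] at hout
  rw [← map_encodeSubgraph hL] at hout
  lift L to List {s : CommonInducedSubgraph x.G₁ x.G₂ // s.IsMaximal} using hmax
  refine ⟨L, fun s => ?_, ?_, ?_⟩
  · obtain ⟨t, ht, hst⟩ := hall s.1 s.2
    obtain ⟨t, ht', rfl⟩ := List.mem_map.1 ht
    exact ⟨t, ht', hst⟩
  · rw [List.pairwise_map] at hpair
    exact hpair
  · rw [List.map_map] at hout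
    exact hout

end MCIS

theorem mainTheorem6 :
    (∃ (p : MCIS.Program) (C c : ℕ), ∀ (x : MCIS.GraphPair) (k : ℕ),
      x.G₁.vertexCoverNum ≤ k → x.G₂.vertexCoverNum ≤ k →
        MCIS.Lists p x (fun s => s.IsNonextendable) (fun s => s.IsMaximal)
          (C * ((9 * k) ^ k * 2 ^ k ^ 2) * x.encode.size ^ c)) ∧
    (∃ (p : MCIS.Program) (C c : ℕ), ∀ (x : MCIS.GraphPair) (k : ℕ),
      x.G₁.vertexCoverNum ≤ k → x.G₂.vertexCoverNum ≤ k →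
        MCIS.Lists p x (fun _ => True) (fun s => s.IsNonextendable)
          (C * ((9 * k) ^ k * 2 ^ k ^ 2) * x.encode.size ^ c)) ∧
    MCIS.FixedParameterEnumerable MCIS.mcisEnumeration MCIS.GraphPair.vertexCover :=
  ⟨MCIS.nonextendableLeaves_lists, MCIS.leaves_lists,
    MCIS.fixedParameterEnumerable_mcisEnumeration⟩
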